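/- Let $n\ge 1$. Let $V\ge 0$ be a real-valued function on $\mathbb R^n$ and let $H=-\Delta+V$ be self-adjoint in $L^2(\mathbb R^n)$; that is, $H$ is a self-adjoint operator such that for every $f\in D(H)$ the function $Vf$ is locally integrable and $Hf=-\Delta f+Vf$ in the sense of distributions. For continuous $\varphi:\mathbb R\to\mathbb C$ let $\varphi(H)=\int\varphi(\lambda)\,dE_\lambda$, where $dE_\lambda$ is the spectral measure of $H$, and if $\varphi(H)$ is a bounded integral operator, let $\varphi(H)(x,y)$ be its kernel (any version; bounds on $\nabla_x$ are for a version that is differentiable in $x$). A dyadic system is a family $\{\varphi_j\}_{j\in\mathbb Z}\subset C_c^\infty(\mathbb R)$ such that (i) $\operatorname{supp}\varphi_j\subset\{x: 2^{j-2}\le|x|\le 2^j\}$ for all $j\in\mathbb Z$; (ii) for every $k\in\mathbb N_0$ there is $c_k$ with $|\varphi_j^{(k)}(x)|\le c_k2^{-kj}$ for all $j\in\mathbb Z$, $x\in\mathbb R$. Proposition. (a) Let $\alpha\in\{0,1\}$. Suppose that there are constants $A$ and $c>0$ such that $$|\nabla_x^\alpha e^{-tH}(x,y)|\le A\,t^{-(n+\alpha)/2}e^{-c|x-y|^2/t}\qquad\text{for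 all } t>0,\ x,y\in\mathbb R^n .$$ Then for every dyadic system $\{\varphi_j\}$ the operators $\varphi_j(H)$ have integral kernels such that for every $N\in\mathbb N_0$ there is $c_N>0$ with $$|\nabla_x^\alpha\varphi_j(H)(x,y)|\le c_N\,2^{j(n+\alpha)/2}(1+2^{j/2}|x-y|)^{-N}\qquad\text{for all } j\in\mathbb Z,\ x,y\in\mathbb R^n .$$ (b) Consequently, if the heat kernel bound holds for both $\alpha=0$ and $\alpha=1$, then $H$ satisfies the dyadic kernel estimates: for every dyadic system $\{\varphi_j\}$ the operators $\varphi_j(H)$ have integral kernels that satisfy the last estimate for both $\alpha=0$ and $\alpha=1$ and every $N\in\mathbb N_0$, with constants $c_N$ independent of $j,x,y$. (c) In particular, the Hermite operator $-\Delta+|x|^2$, with domain $\{f\in L^2(\mathbb R^n): -\Delta f+|x|^2f\in L^2(\mathbb R^n)\}$ (distributions), is self-adjoint and satisfies the dyadic kernel estimates of (b). -/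

import Mathlib

open MeasureTheory
open scoped InnerProductSpace ContDiff

noncomputable section

namespace SchrodingerKernel

/-! ### Functional calculus of an unbounded self-adjoint operator -/

section FunctionalCalculus

variable {𝓗 : Type*} [NormedAddCommGroup 𝓗] [InnerProductSpace ℂ 𝓗] [CompleteSpace 𝓗]

/-- `R = (H + i)⁻¹`: for all `f, g`, one has `R f = g` iff `g ∈ D(H)` and `H g + i g = f`. -/
def IsResolventAtI (H : 𝓗 →ₗ.[ℂ] 𝓗) (R : 𝓗 →L[ℂ] 𝓗) : Prop :=
  ∀ f g : 𝓗, R f = g ↔ (g, f - Complex.I • g) ∈ H.graph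

theorem exists_isResolventAtI {H : 𝓗 →ₗ.[ℂ] 𝓗} (hH : IsSelfAdjoint H) :
    ∃ R : 𝓗 →L[ℂ] 𝓗, IsResolventAtI H R := by
  have hd := hH.dense_domain
  have hadj : H.adjoint = H := hH
  have hsym : ∀ x y : H.domain, inner ℂ (H x) (y : 𝓗) = inner ℂ (x : 𝓗) (H y) := by
    have h := LinearPMap.adjoint_isFormalAdjoint hd
    rw [hadj] at h
    exact h
  have hnorm : ∀ (c : ℂ), c * c = -1 → (starRingEnd ℂ) c = -c → ∀ x : H.domain,
      ‖(x : 𝓗)‖ ^ 2 ≤ ‖H x + c • (x : 𝓗)‖ ^ 2 := by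
    intro c hc hc' x
    have h1 : inner ℂ (H x + c • (x : 𝓗)) (H x + c • (x : 𝓗))
        = inner ℂ (H x) (H x) + inner ℂ (x : 𝓗) (x : 𝓗) := by
      simp only [inner_add_left, inner_add_right, inner_smul_left, inner_smul_right, hc',
        hsym x x]
      linear_combination (-(inner ℂ (x : 𝓗) (x : 𝓗))) * hc
    rw [inner_self_eq_norm_sq_to_K, inner_self_eq_norm_sq_to_K, inner_self_eq_norm_sq_to_K] at h1
    have h2 : ‖H x + c • (x : 𝓗)‖ ^ 2 = ‖H x‖ ^ 2 + ‖(x : 𝓗)‖ ^ 2 := by exact_mod_cast h1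
    rw [h2]
    nlinarith [sq_nonneg ‖H x‖]
  let S : H.domain →ₗ[ℂ] 𝓗 := H.toFun + Complex.I • H.domain.subtype
  have hS : ∀ x : H.domain, S x = H x + Complex.I • (x : 𝓗) := fun x => rfl
  have hbd : ∀ x : H.domain, ‖x‖ ≤ ‖S x‖ := fun x =>
    by
    have h := hnorm Complex.I Complex.I_mul_I Complex.conj_I x
    exact (sq_le_sq₀ (norm_nonneg _) (norm_nonneg _)).1 h
  have hinj : Function.Injective S := by
    rw [← LinearMap.ker_eq_bot, LinearMap.ker_eq_bot']
    intro x hx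
    have := hbd x
    rw [hx, norm_zero] at this
    exact norm_le_zero_iff.1 this
  have hclosed : IsClosed (LinearMap.range S : Set 𝓗) := by
    refine IsSeqClosed.isClosed fun u y hu hy => ?_
    choose x hx using hu
    have hc : CauchySeq (fun k => (x k : 𝓗)) := by
      have huc := hy.cauchySeq
      rw [Metric.cauchySeq_iff] at huc ⊢
      intro ε hε
      obtain ⟨M, hM⟩ := huc ε hε
      refine ⟨M, fun k hk l hl => lt_of_le_of_lt ?_ (hM k hk l hl)⟩
      have := hbd (x k - x l)
      rw [map_sub, hx, hx] at this
      simpa [dist_eq_norm] using this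
    obtain ⟨z, hz⟩ := cauchySeq_tendsto_of_complete hc
    have hHx : Filter.Tendsto (fun k => H (x k)) Filter.atTop (nhds (y - Complex.I • z)) := by
      have : (fun k => H (x k)) = fun k => u k - Complex.I • (x k : 𝓗) := by
        funext k
        rw [← hx k, hS]
        abel
      rw [this]
      exact hy.sub (hz.const_smul _)
    have hg : (z, y - Complex.I • z) ∈ H.graph := by
      have hcl : IsClosed (H.graph : Set (𝓗 × 𝓗)) := hH.isClosed
      exact hcl.mem_of_tendsto (hz.prodMk_nhds hHx)
        (Filter.Eventually.of_forall fun k => H.mem_graph (x k))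
    obtain ⟨w, hw1, hw2⟩ := (LinearPMap.mem_graph_iff H).1 hg
    refine ⟨w, ?_⟩
    rw [hS, hw2, hw1]
    simp
  have horth : (LinearMap.range S)ᗮ = ⊥ := by
    rw [Submodule.eq_bot_iff]
    intro z hz
    have hz' : ∀ x : H.domain, inner ℂ (Complex.I • z) (x : 𝓗) = inner ℂ z (H x) := by
      intro x
      have h := Submodule.inner_left_of_mem_orthogonal (LinearMap.mem_range_self S x) hz
      rw [hS, inner_add_right, inner_smul_right] at h
      rw [inner_smul_left, Complex.conj_I]
      linear_combination (-1 : ℂ) * h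
    have hzd : z ∈ H.adjoint.domain := H.mem_adjoint_domain_of_exists z ⟨_, hz'⟩
    have hza : H.adjoint ⟨z, hzd⟩ = Complex.I • z := LinearPMap.adjoint_apply_eq hd ⟨z, hzd⟩ hz'
    have hgr : (z, Complex.I • z) ∈ H.graph := by
      rw [← hadj]
      exact (LinearPMap.mem_graph_iff _).2 ⟨⟨z, hzd⟩, rfl, hza⟩
    obtain ⟨w, hw1, hw2⟩ := (LinearPMap.mem_graph_iff H).1 hgr
    have := hnorm (-Complex.I) (by simp) (by simp) w
    rw [hw2, hw1] at this
    simp only [neg_smul, add_neg_cancel, norm_zero] at this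
    have h0 : ‖z‖ = 0 := by nlinarith [norm_nonneg z]
    exact norm_eq_zero.1 h0
  have hsurj : Function.Surjective S := by
    have : CompleteSpace (LinearMap.range S) := hclosed.completeSpace_coe
    exact LinearMap.range_eq_top.1 (Submodule.orthogonal_eq_bot_iff.1 horth)
  let e : H.domain ≃ₗ[ℂ] 𝓗 := LinearEquiv.ofBijective S ⟨hinj, hsurj⟩
  have he : ∀ f : 𝓗, S (e.symm f) = f := fun f => e.apply_symm_apply f
  let R : 𝓗 →L[ℂ] 𝓗 := LinearMap.mkContinuous (H.domain.subtype ∘ₗ e.symm.toLinearMap) 1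
    (fun f => by
      have := hbd (e.symm f)
      rw [he] at this
      simpa using this)
  have hR : ∀ f, R f = (e.symm f : 𝓗) := fun f => rfl
  refine ⟨R, fun f g => ⟨?_, fun h => ?_⟩⟩
  · rintro rfl
    refine (LinearPMap.mem_graph_iff H).2 ⟨e.symm f, (hR f).symm, ?_⟩
    rw [hR]
    refine eq_sub_of_add_eq ?_
    rw [← hS, he]
  · obtain ⟨w, hw1, hw2⟩ := (LinearPMap.mem_graph_iff H).1 h
    have : S w = f := by
      rw [hS, hw2, hw1]
      exact sub_add_cancel _ _
    have h2 : e.symm f = w := by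
      rw [← this]
      exact e.symm_apply_apply w
    rw [hR, h2, hw1]

open Classical in
/-- The bounded operator `(H + i)⁻¹`. It exists for every self-adjoint `H`, as proved above;
the value `0` is used only where it does not exist. -/
def resolventAtI (H : 𝓗 →ₗ.[ℂ] 𝓗) : 𝓗 →L[ℂ] 𝓗 :=
  if h : ∃ R : 𝓗 →L[ℂ] 𝓗, IsResolventAtI H R then h.choose else 0

theorem isResolventAtI_resolventAtI {H : 𝓗 →ₗ.[ℂ] 𝓗} (hH : IsSelfAdjoint H) :
    IsResolventAtI H (resolventAtI H) := by
  have h := exists_isResolventAtI hH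
  rw [resolventAtI, dif_pos h]
  exact h.choose_spec

/-- The operator `ψ(H)` for `H` self-adjoint and `ψ : ℝ → ℂ` continuous with compact support,
through the continuous functional calculus of the bounded normal operator `R = (H + i)⁻¹`:
`ψ(λ)` as a function of `z = (λ + i)⁻¹` is `z ↦ ψ (Re z⁻¹)` for `z ≠ 0`, and it tends to `0`
as `z → 0`, that is, as `|λ| → ∞`. -/
def compactCalculus (H : 𝓗 →ₗ.[ℂ] 𝓗) (ψ : ℝ → ℂ) : 𝓗 →L[ℂ] 𝓗 :=
  open Classical in
  cfc (fun z : ℂ => if z = 0 then 0 else ψ (z⁻¹).re) (resolventAtI H)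

/-- The bounded operator `T` is `φ(H) = ∫ φ(λ) dE_λ`, for `H` self-adjoint and `φ : ℝ → ℂ`
continuous, possibly unbounded: `ψ(H) T = (ψ φ)(H)` for every continuous `ψ` with compact support.
Since `ψ(H) → 1` strongly as `ψ ↑ 1`, at most one bounded `T` has this property, and there is one
exactly when the spectral integral `∫ φ(λ) dE_λ` is an everywhere defined bounded operator. -/
def IsFunctionOf (H : 𝓗 →ₗ.[ℂ] 𝓗) (φ : ℝ → ℂ) (T : 𝓗 →L[ℂ] 𝓗) : Prop :=
  ∀ ψ : ℝ → ℂ, Continuous ψ → HasCompactSupport ψ →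
    (compactCalculus H ψ).comp T = compactCalculus H (fun l => ψ l * φ l)

end FunctionalCalculus

/-! ### Schrödinger operators on `L²(ℝⁿ)` -/

/-- `ℝⁿ` with the Euclidean norm. -/
abbrev Rn (n : ℕ) : Type := EuclideanSpace ℝ (Fin n)

/-- The complex Hilbert space `L²(ℝⁿ)`. -/
abbrev L2 (n : ℕ) : Type := Lp ℂ 2 (volume : Measure (Rn n))

/-- Test functions: the elements of `C_c^∞(ℝⁿ)`. -/
def IsTestFunction {n : ℕ} (ψ : Rn n → ℂ) : Prop := ContDiff ℝ ∞ ψ ∧ HasCompactSupport ψ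

theorem IsTestFunction.integrable_mul {n : ℕ} {ψ u : Rn n → ℂ} (hψ : IsTestFunction ψ)
    (hu : LocallyIntegrable u volume) : Integrable (fun x => u x * ψ x) volume := by
  have := hu.integrable_smul_left_of_hasCompactSupport hψ.1.continuous hψ.2
  refine this.congr (Filter.Eventually.of_forall fun x => ?_)
  simp [mul_comm]

theorem IsTestFunction.laplacian {n : ℕ} {ψ : Rn n → ℂ} (hψ : IsTestFunction ψ) :
    IsTestFunction (Laplacian.laplacian ψ) := by
  have key : Laplacian.laplacian ψ = fun x => ∑ i, iteratedFDeriv ℝ 2 ψ x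
      ![(EuclideanSpace.basisFun (Fin n) ℝ) i, (EuclideanSpace.basisFun (Fin n) ℝ) i] := by
    funext x
    rw [InnerProductSpace.laplacian_eq_iteratedFDeriv_orthonormalBasis ψ
      (EuclideanSpace.basisFun (Fin n) ℝ)]
  refine ⟨?_, ?_⟩
  · rw [key]
    refine ContDiff.sum fun i _ => ?_
    have h2 : ContDiff ℝ ∞ (iteratedFDeriv ℝ 2 ψ) :=
      hψ.1.iteratedFDeriv_right (m := ∞) (i := 2) (by exact_mod_cast le_refl _)
    exact (ContinuousMultilinearMap.apply ℝ (fun _ : Fin 2 => Rn n) ℂ _).contDiff.comp h2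
  · rw [key]
    refine (hψ.2.iteratedFDeriv (𝕜 := ℝ) 2).mono' ?_
    refine (Function.support_subset_iff'.2 fun x hx => ?_).trans subset_closure
    have : iteratedFDeriv ℝ 2 ψ x = 0 := by simpa using hx
    simp [this]

theorem locallyIntegrable_L2 {n : ℕ} (f : L2 n) : LocallyIntegrable (f : Rn n → ℂ) volume :=
  (Lp.memLp f).locallyIntegrable (by norm_num)

/-- The graph of `-Δ + V` on its maximal domain: the pairs `(f, g)` of elements of `L²(ℝⁿ)` such
that `V f` is locally integrable and `-Δ f + V f = g` in the sense of distributions. -/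
def schrodingerGraph {n : ℕ} (V : Rn n → ℝ) : Submodule ℂ (L2 n × L2 n) where
  carrier := {p | LocallyIntegrable (fun x => (V x : ℂ) * p.1 x) volume ∧
    ∀ ψ : Rn n → ℂ, IsTestFunction ψ →
      (∫ x, p.1 x * (-Laplacian.laplacian ψ x)) + (∫ x, (V x : ℂ) * p.1 x * ψ x)
        = ∫ x, p.2 x * ψ x}
  add_mem' := by
    rintro ⟨f₁, g₁⟩ ⟨f₂, g₂⟩ ⟨h₁, e₁⟩ ⟨h₂, e₂⟩
    have hf := Lp.coeFn_add f₁ f₂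
    have hg := Lp.coeFn_add g₁ g₂
    refine ⟨(h₁.add h₂).congr ?_, fun ψ hψ => ?_⟩
    · filter_upwards [hf] with x hx
      simp only [Prod.mk_add_mk, Pi.add_apply, hx]
      ring
    · have hL := hψ.laplacian
      have a₁ := hL.integrable_mul (locallyIntegrable_L2 f₁)
      have a₂ := hL.integrable_mul (locallyIntegrable_L2 f₂)
      have b₁ := hψ.integrable_mul h₁
      have b₂ := hψ.integrable_mul h₂
      have c₁ := hψ.integrable_mul (locallyIntegrable_L2 g₁)
      have c₂ := hψ.integrable_mul (locallyIntegrable_L2 g₂)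
      have E₁ := e₁ ψ hψ
      have E₂ := e₂ ψ hψ
      simp only [mul_neg, integral_neg] at E₁ E₂
      have A : (∫ x, (f₁ + f₂ : L2 n) x * (Laplacian.laplacian ψ x))
          = (∫ x, f₁ x * (Laplacian.laplacian ψ x))
            + ∫ x, f₂ x * (Laplacian.laplacian ψ x) := by
        rw [← integral_add a₁ a₂]
        refine integral_congr_ae ?_
        filter_upwards [hf] with x hx
        simp only [hx, Pi.add_apply]
        ring
      have B : (∫ x, (V x : ℂ) * (f₁ + f₂ : L2 n) x * ψ x)
          = (∫ x, (V x : ℂ) * f₁ x * ψ x) + ∫ x, (V x : ℂ) * f₂ x * ψ x := by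
        rw [← integral_add b₁ b₂]
        refine integral_congr_ae ?_
        filter_upwards [hf] with x hx
        simp only [hx, Pi.add_apply]
        ring
      have C : (∫ x, (g₁ + g₂ : L2 n) x * ψ x)
          = (∫ x, g₁ x * ψ x) + ∫ x, g₂ x * ψ x := by
        rw [← integral_add c₁ c₂]
        refine integral_congr_ae ?_
        filter_upwards [hg] with x hx
        simp only [hx, Pi.add_apply]
        ring
      simp only [Prod.mk_add_mk, mul_neg, integral_neg]
      rw [A, B, C, ← E₁, ← E₂]
      ring
  zero_mem' := by
    have h0 := Lp.coeFn_zero ℂ 2 (volume : Measure (Rn n))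
    refine ⟨?_, fun ψ hψ => ?_⟩
    · refine (locallyIntegrable_zero (X := Rn n) (ε'' := ℂ)).congr ?_
      filter_upwards [h0] with x hx
      simp
    · have A : (∫ x, (0 : L2 n) x * (-Laplacian.laplacian ψ x)) = 0 :=
        integral_eq_zero_of_ae (by filter_upwards [h0] with x hx; simp)
      have B : (∫ x, (V x : ℂ) * (0 : L2 n) x * ψ x) = 0 :=
        integral_eq_zero_of_ae (by filter_upwards [h0] with x hx; simp)
      have C : (∫ x, (0 : L2 n) x * ψ x) = 0 :=
        integral_eq_zero_of_ae (by filter_upwards [h0] with x hx; simp)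
      simp only [Prod.fst_zero, Prod.snd_zero]
      rw [A, B, C, add_zero]
  smul_mem' := by
    rintro c ⟨f, g⟩ ⟨h, e⟩
    have hf := Lp.coeFn_smul c f
    have hg := Lp.coeFn_smul c g
    refine ⟨(h.smul c).congr ?_, fun ψ hψ => ?_⟩
    · filter_upwards [hf] with x hx
      simp only [Prod.smul_mk, Pi.smul_apply, hx, smul_eq_mul]
      ring
    · have E := e ψ hψ
      have A : (∫ x, (c • f : L2 n) x * (-Laplacian.laplacian ψ x))
          = c * ∫ x, f x * (-Laplacian.laplacian ψ x) := by
        rw [← integral_const_mul]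
        refine integral_congr_ae ?_
        filter_upwards [hf] with x hx
        simp only [hx, Pi.smul_apply, smul_eq_mul]
        ring
      have B : (∫ x, (V x : ℂ) * (c • f : L2 n) x * ψ x) = c * ∫ x, (V x : ℂ) * f x * ψ x := by
        rw [← integral_const_mul]
        refine integral_congr_ae ?_
        filter_upwards [hf] with x hx
        simp only [hx, Pi.smul_apply, smul_eq_mul]
        ring
      have C : (∫ x, (c • g : L2 n) x * ψ x) = c * ∫ x, g x * ψ x := by
        rw [← integral_const_mul]
        refine integral_congr_ae ?_
        filter_upwards [hg] with x hx
        simp only [hx, Pi.smul_apply, smul_eq_mul]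
        ring
      simp only [Prod.smul_mk]
      rw [A, B, C, ← E]
      ring

/-- The maximal operator `-Δ + V` in `L²(ℝⁿ)`: its domain consists of the `f ∈ L²` such that `V f`
is locally integrable and the distribution `-Δ f + V f` belongs to `L²`. A self-adjoint operator
`H` is a Schrödinger operator `-Δ + V` if `H ≤ schrodingerOp V`; for `0 ≤ V` locally integrable
the only such `H` is `schrodingerOp V` itself, which is also the form sum of `-Δ` and `V`. -/
def schrodingerOp {n : ℕ} (V : Rn n → ℝ) : L2 n →ₗ.[ℂ] L2 n :=
  (schrodingerGraph V).toLinearPMap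

/-- The pair `(f, g)` is in the graph of `schrodingerOp V` iff `-Δ f + V f = g` as above. -/
theorem graph_schrodingerOp {n : ℕ} (V : Rn n → ℝ) :
    (schrodingerOp V).graph = schrodingerGraph V := by
  refine Submodule.toLinearPMap_graph_eq _ ?_
  rintro ⟨f, g⟩ ⟨-, e⟩ hf
  simp only at hf e ⊢
  subst hf
  have h0 := Lp.coeFn_zero ℂ 2 (volume : Measure (Rn n))
  have hg : ∀ᵐ x, g x = 0 := by
    refine ae_eq_zero_of_integral_contDiff_smul_eq_zero (locallyIntegrable_L2 g) ?_
    intro ψ hψ hc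
    have ht : IsTestFunction (fun x => (ψ x : ℂ)) := by
      refine ⟨Complex.ofRealCLM.contDiff.comp hψ, ?_⟩
      exact hc.comp_left (g := fun r : ℝ => (r : ℂ)) (by simp)
    have E := e _ ht
    rw [integral_eq_zero_of_ae, integral_eq_zero_of_ae, add_zero] at E
    · rw [E]
      refine integral_congr_ae (Filter.Eventually.of_forall fun x => ?_)
      simp [mul_comm]
    · filter_upwards [h0] with x hx
      rw [hx]; simp
    · filter_upwards [h0] with x hx
      rw [hx]; simp
  exact Lp.eq_zero_iff_ae_eq_zero.2 hg

/-! ### Integral kernels and the estimates -/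

/-- The bounded operator `T` has the integral kernel `K`: `T f (x) = ∫ K(x, y) f(y) dy`. -/
def IsIntegralKernel {n : ℕ} (T : L2 n →L[ℂ] L2 n) (K : Rn n → Rn n → ℂ) : Prop :=
  Measurable (Function.uncurry K) ∧
    ∀ f : L2 n, ∀ᵐ x, Integrable (fun y => K x y * f y) ∧ T f x = ∫ y, K x y * f y

/-- `K` is (a version of) the kernel `φ(H)(x, y)` of the bounded operator `φ(H)`. -/
def IsKernelOf {n : ℕ} (H : L2 n →ₗ.[ℂ] L2 n) (φ : ℝ → ℂ) (K : Rn n → Rn n → ℂ) : Prop :=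
  ∃ T : L2 n →L[ℂ] L2 n, IsFunctionOf H φ T ∧ IsIntegralKernel T K

/-- The kernel `K(x, y)` can be differentiated `α` times in `x`, where `α = 0, 1`. -/
def XDifferentiable {n : ℕ} (α : Fin 2) (K : Rn n → Rn n → ℂ) : Prop :=
  α = 1 → ∀ y, Differentiable ℝ (fun x => K x y)

/-- `|∇_x^α K(x, y)|` for `α = 0, 1`. -/
def xGradNorm {n : ℕ} (α : Fin 2) (K : Rn n → Rn n → ℂ) (x y : Rn n) : ℝ :=
  if α = 0 then ‖K x y‖ else ‖fderiv ℝ (fun x' => K x' y) x‖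

/-- The upper Gaussian bound
`|∇_x^α e^{-tH}(x, y)| ≤ A t^{-(n+α)/2} e^{-c |x-y|²/t}` for all `t > 0` and all `x, y`. -/
def HeatGaussianBound {n : ℕ} (H : L2 n →ₗ.[ℂ] L2 n) (α : Fin 2) : Prop :=
  ∃ p : ℝ → Rn n → Rn n → ℂ,
    (∀ t > 0, IsKernelOf H (fun l => (Real.exp (-t * l) : ℂ)) (p t) ∧ XDifferentiable α (p t)) ∧
    ∃ A c : ℝ, 0 < c ∧ ∀ t > 0, ∀ x y,
      xGradNorm α (p t) x y
        ≤ A * t ^ (-((n : ℝ) + (α : ℕ)) / 2) * Real.exp (-c * ‖x - y‖ ^ 2 / t)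

/-- A smooth dyadic system `{φ_j}`, `j ∈ ℤ`: functions in `C_c^∞(ℝ)` with
(i) `supp φ_j ⊆ {x : 2^{j-2} ≤ |x| ≤ 2^j}`, and
(ii) `|φ_j^{(k)}(x)| ≤ c_k 2^{-kj}`, where `c_k` depends on neither `j` nor `x`. -/
structure IsDyadicSystem (φ : ℤ → ℝ → ℂ) : Prop where
  smooth : ∀ j, ContDiff ℝ ∞ (φ j)
  supp : ∀ j, tsupport (φ j) ⊆ {x : ℝ | (2 : ℝ) ^ (j - 2) ≤ |x| ∧ |x| ≤ (2 : ℝ) ^ j}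
  bound : ∀ k : ℕ, ∃ c : ℝ, ∀ (j : ℤ) (x : ℝ),
    ‖iteratedDeriv k (φ j) x‖ ≤ c * (2 : ℝ) ^ (-((k : ℤ) * j))

/-- The decay estimates, uniform in `j`, for the kernels `K_j`: for every `N` there is `c_N` with
`|∇_x^α K_j(x, y)| ≤ c_N 2^{j(n+α)/2} (1 + 2^{j/2} |x - y|)^{-N}` for all `j, x, y`. -/
def UniformDecay {n : ℕ} (α : Fin 2) (K : ℤ → Rn n → Rn n → ℂ) : Prop :=
  (∀ j, XDifferentiable α (K j)) ∧
    ∀ N : ℕ, ∃ c : ℝ, 0 < c ∧ ∀ (j : ℤ) (x y : Rn n),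
      xGradNorm α (K j) x y
        ≤ c * ((2 : ℝ) ^ ((j : ℝ) * ((n : ℝ) + (α : ℕ)) / 2)
          / (1 + (2 : ℝ) ^ ((j : ℝ) / 2) * ‖x - y‖) ^ N)

/-- The dyadic kernel estimates for `H`: for every dyadic system, the operators `φ_j(H)` have kernels that satisfy
the decay estimates for `φ_j(H)(x, y)` and for `∇_x φ_j(H)(x, y)`. -/
def DyadicKernelDecay {n : ℕ} (H : L2 n →ₗ.[ℂ] L2 n) : Prop :=
  ∀ φ : ℤ → ℝ → ℂ, IsDyadicSystem φ →
    ∃ K : ℤ → Rn n → Rn n → ℂ, (∀ j, IsKernelOf H (φ j) (K j)) ∧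
      UniformDecay 0 K ∧ UniformDecay 1 K

/-- The Hermite operator `-Δ + |x|²` in `L²(ℝⁿ)`. -/
def hermiteOp (n : ℕ) : L2 n →ₗ.[ℂ] L2 n := schrodingerOp (fun x : Rn n => ‖x‖ ^ 2)

end SchrodingerKernel

end

/-! Fix `j` and put `t = 2^{-j}`, `q = 2^{j/2}`, `T = e^{-tH}`. On the support of `φ_j` the number
`u = e^{-tλ}` stays in `[e^{-1}, e]`, so `φ_j(λ) = u F_j(u) u` with a smooth, compactly supported
`F_j` whose derivatives are bounded uniformly in `j` (`dyadic_eq_logPull`, `UniformBump`). Hence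
`φ_j(H) = T G T`, where `G = F_j(T)` is a Fourier integral over the unitary group `e^{irT}` of the
bounded self-adjoint operator `T` (`IsFunctionOf.mul_fourierOp_mul`).

The heart of the matter is that `e^{irT}` spreads mass over a distance of order `|r|` in units of
`1/q`. Conjugation of `T` by the weight `e^{q|z-y|}` leaves a Gaussian kernel, so the conjugated
group grows at most like `e^{D|r|}`, with `D` independent of `j`. Unitarity handles the region
`q|z-y| ≤ 2D|r|` and the exponential bound the rest; together the weight `(1 + q|z-y|)^N` costs only
a multiple of `(1 + |r|)^N` (`GaussianKernel.norm_wave_poly_le`), which is integrable against the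
Fourier transform of `F_j`, uniformly in `j`. The outer factors `T` turn this weighted `L²` bound
into a pointwise one: the kernel is `∫ p(x,z) (G p(·,y))(z) dz`, and `1 + q|x-y| ≤ (1 + q|x-z|)(1 +
q|z-y|)` (`GaussianKernel.integral_gaussianAt_mul_le`). A derivative in `x` falls on `p(x,z)` alone.

If only the gradient of the heat kernel is bounded, a bound for the kernel itself is recovered by
integrating the gradient along rays that lead away from `y`. The value at infinity vanishes for
almost every `y` because `T` maps into `L²` (`exists_kernel_of_gradient_bound`). So the case `α = 1`
alone yields both estimates.

For the Hermite operator, the functions `e^{iξ·x - |x|²/2}` evolve explicitly under the heat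
equation, and a Gaussian integral shows that Mehler's kernel reproduces this evolution. These
functions are total and the evolution solves `E' = -HE` weakly against the whole maximal domain.
Symmetry of the Mehler operators then passes to `H` (`IsHeatFlow.graph_symm`), maximality gives the
reverse inclusion `H* ⊆ H`, and `IsHeatFlow.isFunctionOf` identifies the Mehler operators with
`e^{-tH}`. What remains is a gradient bound for Mehler's kernel in terms of `coth t`. -/

noncomputable section

namespace SchrodingerKernel

/-! ### Functional calculus through `(H + i)⁻¹`, and Fourier integrals of bounded functions of `H`.
-/

section Resolvent

variable {𝓗 : Type*} [NormedAddCommGroup 𝓗] [InnerProductSpace ℂ 𝓗] [CompleteSpace 𝓗]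

open Complex ContinuousLinearMap

theorem IsSelfAdjoint.graph_symm {H : 𝓗 →ₗ.[ℂ] 𝓗} (hH : IsSelfAdjoint H) {a b c d : 𝓗}
    (h₁ : (a, b) ∈ H.graph) (h₂ : (c, d) ∈ H.graph) : inner ℂ b c = inner ℂ a d := by
  have hadj : H.adjoint = H := hH
  have h := LinearPMap.adjoint_isFormalAdjoint hH.dense_domain
  rw [hadj] at h
  obtain ⟨u, hu, hu'⟩ := (LinearPMap.mem_graph_iff H).1 h₁
  obtain ⟨v, hv, hv'⟩ := (LinearPMap.mem_graph_iff H).1 h₂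
  have e := h u v
  rwa [hu, hu', hv, hv'] at e

/-- The half `H* ⊆ H` of self-adjointness. It turns a weak identity against the graph into
membership of the domain. -/
theorem IsSelfAdjoint.mem_graph_of_forall {H : 𝓗 →ₗ.[ℂ] 𝓗} (hH : IsSelfAdjoint H) {z w : 𝓗}
    (h : ∀ a b, (a, b) ∈ H.graph → inner ℂ w a = inner ℂ z b) : (z, w) ∈ H.graph := by
  have hadj : H.adjoint = H := hH
  have hz' : ∀ x : H.domain, inner ℂ w (x : 𝓗) = inner ℂ z (H x) := fun x => h _ _ (H.mem_graph x)
  have hzd : z ∈ H.adjoint.domain := H.mem_adjoint_domain_of_exists z ⟨_, hz'⟩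
  have hza := LinearPMap.adjoint_apply_eq hH.dense_domain ⟨z, hzd⟩ hz'
  rw [← hadj]
  exact (LinearPMap.mem_graph_iff _).2 ⟨⟨z, hzd⟩, rfl, hza⟩

theorem resolventAtI_mem_graph {H : 𝓗 →ₗ.[ℂ] 𝓗} (hH : IsSelfAdjoint H) (f : 𝓗) :
    (resolventAtI H f, f - I • resolventAtI H f) ∈ H.graph :=
  ((isResolventAtI_resolventAtI hH) f _).1 rfl

theorem resolventAtI_apply_eq {H : 𝓗 →ₗ.[ℂ] 𝓗} (hH : IsSelfAdjoint H) {g h : 𝓗}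
    (hg : (g, h) ∈ H.graph) : resolventAtI H (h + I • g) = g :=
  ((isResolventAtI_resolventAtI hH) _ g).2 (by simpa using hg)

theorem resolventAtI_injective {H : 𝓗 →ₗ.[ℂ] 𝓗} (hH : IsSelfAdjoint H) {f : 𝓗}
    (hf : resolventAtI H f = 0) : f = 0 := by
  have h := resolventAtI_mem_graph hH f
  rw [hf] at h
  simpa using LinearPMap.graph_fst_eq_zero_snd H h rfl

/-- Symmetry of `H` on the pairs `(Ne, e - iNe)` and `(Nf, f - iNf)`. It is the operator form of `(λ
+ i)⁻¹ - (λ - i)⁻¹ = -2i / (λ² + 1)`. -/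
theorem resolventAtI_sub_star {H : 𝓗 →ₗ.[ℂ] 𝓗} (hH : IsSelfAdjoint H) :
    resolventAtI H - star (resolventAtI H)
      = (-2 * I) • (star (resolventAtI H) * resolventAtI H) := by
  set N := resolventAtI H with hN
  refine ContinuousLinearMap.ext fun f => ext_inner_left ℂ fun e => ?_
  have h := IsSelfAdjoint.graph_symm hH (resolventAtI_mem_graph hH e) (resolventAtI_mem_graph hH f)
  simp only [← hN, inner_sub_left, inner_sub_right, inner_smul_left, inner_smul_right,
    conj_I] at h
  simp only [sub_apply, smul_apply, mul_apply_eq_comp, inner_sub_right, inner_smul_right,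
    star_eq_adjoint, adjoint_inner_right]
  linear_combination h

/-- `U = 1 - 2iN` is the Cayley transform `(H - i)(H + i)⁻¹`. The relation for `N - N*` gives `U*U =
1`, and injectivity of `U*` upgrades this to `UU* = 1`. So `U` is unitary, and `N` is an affine
function of it. -/
theorem isStarNormal_resolventAtI {H : 𝓗 →ₗ.[ℂ] 𝓗} (hH : IsSelfAdjoint H) :
    IsStarNormal (resolventAtI H) := by
  have hrel := resolventAtI_sub_star hH
  set N := resolventAtI H with hN
  set U : 𝓗 →L[ℂ] 𝓗 := 1 - (2 * I) • N with hU
  have hUs : star U = 1 + (2 * I) • star N := by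
    rw [hU, star_sub, star_smul, star_one]
    simp [sub_eq_add_neg, ← neg_smul]
  have h1 : star U * U = 1 := by
    rw [hUs, hU]
    have e : (1 + (2 * I) • star N) * (1 - (2 * I) • N)
        = 1 - (2 * I) • (N - star N) - ((2 * I) * (2 * I)) • (star N * N) := by
      simp only [add_mul, mul_sub, one_mul, mul_one, smul_mul_smul_comm, smul_sub]
      abel
    rw [e, hrel, smul_smul, sub_sub, ← add_smul]
    have : (2 * I * (-2 * I) + 2 * I * (2 * I)) = 0 := by ring
    rw [this, zero_smul, sub_zero]
  -- A vector killed by `U*` is orthogonal to the range of `H - i`, so `Hz = -iz` by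
  -- self-adjointness, and then `z = (H + i)⁻¹ (Hz + iz) = 0`.
  have hker : ∀ z, star U z = 0 → z = 0 := by
    intro z hz
    have hg : (z, -I • z) ∈ H.graph := by
      refine IsSelfAdjoint.mem_graph_of_forall hH fun a b hab => ?_
      have h2 : inner ℂ (star U z) (b + I • a) = 0 := by rw [hz, inner_zero_left]
      rw [star_eq_adjoint, adjoint_inner_left, hU] at h2
      simp only [sub_apply, one_apply_eq_self, smul_apply] at h2
      rw [hN, resolventAtI_apply_eq hH hab] at h2
      simp only [inner_sub_right, inner_add_right, inner_smul_right] at h2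
      rw [inner_smul_left]
      simp only [map_neg, conj_I, neg_neg]
      linear_combination -h2
    have h3 := resolventAtI_apply_eq hH hg
    simpa using h3.symm
  have h2 : U * star U = 1 := by
    refine ContinuousLinearMap.ext fun z => ?_
    have h3 : star U ((1 - U * star U) z) = 0 := by
      have : star U * (1 - U * star U) = 0 := by
        rw [mul_sub, mul_one, ← mul_assoc, h1, one_mul, sub_self]
      exact congrArg (fun A : 𝓗 →L[ℂ] 𝓗 => A z) this
    have h4 := hker _ h3
    rw [sub_apply, sub_eq_zero] at h4
    exact h4.symm
  have hcomm : Commute (star U) U := by rw [Commute, SemiconjBy, h1, h2]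
  have hNU : N = (-(2 * I))⁻¹ • (U - 1) := by
    rw [hU, sub_sub_cancel_left, ← neg_smul, smul_smul, inv_mul_cancel₀ (by simp), one_smul]
  have hNUs : star N = (2 * I)⁻¹ • (star U - 1) := by
    rw [hUs, add_sub_cancel_left, smul_smul, inv_mul_cancel₀ (by simp), one_smul]
  refine ⟨?_⟩
  rw [hNUs, hNU]
  exact (((hcomm.sub_left (Commute.one_left _)).sub_right (Commute.one_right _)).smul_left
    _).smul_right _

/-- The functional calculus turns `resolventAtI_sub_star` into `z - z̄ = -2i|z|²` on the spectrum.
This is the circle traced by `(λ + i)⁻¹`, `λ` real, together with `0`; inversion maps it to the line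
`Im = 1`, so that `λ = Re z⁻¹`. -/
theorem im_eq_of_mem_spectrum_resolventAtI {H : 𝓗 →ₗ.[ℂ] 𝓗} (hH : IsSelfAdjoint H) {z : ℂ}
    (hz : z ∈ spectrum ℂ (resolventAtI H)) : z.im = -‖z‖ ^ 2 := by
  have hn := isStarNormal_resolventAtI hH
  have hrel := resolventAtI_sub_star hH
  set N := resolventAtI H
  have e1 : cfc (fun z : ℂ => z - star z) N = N - star N := by
    rw [cfc_sub (fun z => z) (fun z => star z) N, cfc_star_id (R := ℂ) (a := N), cfc_id' ℂ N]
  have e2 : cfc (fun z : ℂ => (-2 * I) • (star z * z)) N = (-2 * I) • (star N * N) := by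
    rw [cfc_smul (-2 * I) (fun z => star z * z) N, cfc_mul (fun z => star z) (fun z => z) N,
      cfc_star_id (R := ℂ) (a := N), cfc_id' ℂ N]
  have h := (cfc_eq_cfc_iff_eqOn (f := fun z : ℂ => z - star z)
    (g := fun z : ℂ => (-2 * I) • (star z * z)) (a := N)).1 (by rw [e1, e2, hrel]) hz
  have h' := congrArg Complex.im h
  simp at h'
  rw [Complex.sq_norm, Complex.normSq_apply]
  linarith

theorem inv_eq_of_mem_spectrum_resolventAtI {H : 𝓗 →ₗ.[ℂ] 𝓗} (hH : IsSelfAdjoint H) {z : ℂ}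
    (hz : z ∈ spectrum ℂ (resolventAtI H)) (h0 : z ≠ 0) : z⁻¹ = (z⁻¹).re + I := by
  have h := im_eq_of_mem_spectrum_resolventAtI hH hz
  apply Complex.ext
  · simp
  · have : (0 : ℝ) < ‖z‖ ^ 2 := by positivity
    simp only [inv_im, add_im, ofReal_im, I_im, zero_add, Complex.normSq_eq_norm_sq, h]
    field_simp

open Classical in
/-- The function `z ↦ ψ (Re z⁻¹)` that expresses `ψ(H)` through the resolvent. -/
def resolventSymbol (ψ : ℝ → ℂ) (z : ℂ) : ℂ := if z = 0 then 0 else ψ (z⁻¹).re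

theorem compactCalculus_eq (H : 𝓗 →ₗ.[ℂ] 𝓗) (ψ : ℝ → ℂ) :
    compactCalculus H ψ = cfc (resolventSymbol ψ) (resolventAtI H) := rfl

theorem resolventSymbol_zero (ψ : ℝ → ℂ) : resolventSymbol ψ 0 = 0 := by simp [resolventSymbol]

theorem resolventSymbol_of_ne (ψ : ℝ → ℂ) {z : ℂ} (hz : z ≠ 0) :
    resolventSymbol ψ z = ψ (z⁻¹).re := by simp [resolventSymbol, hz]

theorem abs_re_inv_ge {H : 𝓗 →ₗ.[ℂ] 𝓗} (hH : IsSelfAdjoint H) {z : ℂ}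
    (hz : z ∈ spectrum ℂ (resolventAtI H)) (h0 : z ≠ 0) : ‖z‖⁻¹ - 1 ≤ |(z⁻¹).re| := by
  have h := inv_eq_of_mem_spectrum_resolventAtI hH hz h0
  have h2 : ‖z⁻¹‖ ≤ ‖((z⁻¹).re : ℂ)‖ + ‖I‖ := by
    conv_lhs => rw [h]
    exact norm_add_le _ _
  rw [norm_inv, norm_I, Complex.norm_real, Real.norm_eq_abs] at h2
  linarith

/-- Along the spectrum `z → 0` forces `|λ| → ∞` by `abs_re_inv_ge`, so a compactly supported `ψ` has
a symbol that vanishes near `0` there. Off the spectrum this can fail: on the imaginary axis the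
symbol is `ψ 0` away from the origin. -/
theorem continuousOn_resolventSymbol {H : 𝓗 →ₗ.[ℂ] 𝓗} (hH : IsSelfAdjoint H) {ψ : ℝ → ℂ}
    (hψ : Continuous ψ) (hc : HasCompactSupport ψ) :
    ContinuousOn (resolventSymbol ψ) (spectrum ℂ (resolventAtI H)) := by
  intro z hz
  by_cases h0 : z = 0
  · subst h0
    obtain ⟨M, hM⟩ := hc.isCompact.isBounded.subset_closedBall (0 : ℝ)
    have hM' : ∀ l, M < |l| → ψ l = 0 := by
      intro l hl
      by_contra hne
      have := hM (subset_tsupport _ hne)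
      rw [Metric.mem_closedBall, dist_zero_right, Real.norm_eq_abs] at this
      linarith
    have : ∀ᶠ w in nhdsWithin 0 (spectrum ℂ (resolventAtI H)), resolventSymbol ψ w = 0 := by
      have hball : Metric.ball (0 : ℂ) (|M| + 2)⁻¹ ∈ nhds (0 : ℂ) :=
        Metric.ball_mem_nhds _ (by positivity)
      filter_upwards [mem_nhdsWithin_of_mem_nhds hball, self_mem_nhdsWithin] with w hw hws
      by_cases hw0 : w = 0
      · rw [hw0, resolventSymbol_zero]
      · rw [resolventSymbol_of_ne _ hw0]
        apply hM'
        have h1 := abs_re_inv_ge hH hws hw0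
        rw [Metric.mem_ball, dist_zero_right] at hw
        have h2 : |M| + 2 < ‖w‖⁻¹ := by
          rw [lt_inv_comm₀ (by positivity) (norm_pos_iff.2 hw0)]
          exact hw
        linarith [le_abs_self M]
    refine ContinuousWithinAt.congr_of_eventuallyEq (f := fun _ => 0)
      continuousWithinAt_const this (resolventSymbol_zero ψ)
  · have hc : ContinuousAt (fun w : ℂ => ψ (w⁻¹).re) z :=
      hψ.continuousAt.comp (Complex.continuous_re.continuousAt.comp (continuousAt_inv₀ h0))
    refine (hc.congr ?_).continuousWithinAt
    filter_upwards [isOpen_ne.mem_nhds h0] with w hw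
    rw [resolventSymbol_of_ne _ hw]

theorem resolventSymbol_mul (ψ χ : ℝ → ℂ) :
    resolventSymbol (fun l => ψ l * χ l) = fun z => resolventSymbol ψ z * resolventSymbol χ z := by
  funext z
  by_cases h : z = 0 <;> simp [resolventSymbol, h]

theorem compactCalculus_mul {H : 𝓗 →ₗ.[ℂ] 𝓗} (hH : IsSelfAdjoint H) {ψ χ : ℝ → ℂ}
    (hψ : Continuous ψ) (hψc : HasCompactSupport ψ) (hχ : Continuous χ)
    (hχc : HasCompactSupport χ) :
    compactCalculus H (fun l => ψ l * χ l) = compactCalculus H ψ * compactCalculus H χ := by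
  have hn := isStarNormal_resolventAtI hH
  simp only [compactCalculus_eq]
  rw [resolventSymbol_mul, cfc_mul _ _ _ (continuousOn_resolventSymbol hH hψ hψc)
    (continuousOn_resolventSymbol hH hχ hχc)]

theorem compactCalculus_star (H : 𝓗 →ₗ.[ℂ] 𝓗) (ψ : ℝ → ℂ) :
    compactCalculus H (fun l => star (ψ l)) = star (compactCalculus H ψ) := by
  simp only [compactCalculus_eq]
  rw [← cfc_star]
  congr 1
  funext z
  by_cases h : z = 0 <;> simp [resolventSymbol, h]

/-- On the spectrum `λ + i = z⁻¹`, which the factor `z` cancels. -/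
theorem compactCalculus_resolvent {H : 𝓗 →ₗ.[ℂ] 𝓗} (hH : IsSelfAdjoint H) {ψ : ℝ → ℂ}
    (hψ : Continuous ψ) (hψc : HasCompactSupport ψ) :
    compactCalculus H (fun l => ψ l * (l + I)) * resolventAtI H = compactCalculus H ψ := by
  have hn := isStarNormal_resolventAtI hH
  have hc : ContinuousOn (resolventSymbol (fun l => ψ l * (l + I)))
      (spectrum ℂ (resolventAtI H)) :=
    continuousOn_resolventSymbol hH (hψ.mul (by fun_prop)) hψc.mul_right
  simp only [compactCalculus_eq]
  conv_lhs => rw [← cfc_id' ℂ (resolventAtI H)]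
  -- The previous rewriting also reached the argument of the first `cfc`; it is undone there.
  conv_lhs =>
    arg 1
    rw [cfc_id' ℂ (resolventAtI H)]
  rw [← cfc_mul _ _ _ hc]
  refine cfc_congr fun z hz => ?_
  by_cases h : z = 0
  · simp [h, resolventSymbol_zero]
  · simp only [resolventSymbol_of_ne _ h]
    rw [← inv_eq_of_mem_spectrum_resolventAtI hH hz h, mul_assoc, inv_mul_cancel₀ h, mul_one]

/-- `ψ(H) H g = (ψ id)(H) g` on the domain of `H`. -/
theorem compactCalculus_apply_graph {H : 𝓗 →ₗ.[ℂ] 𝓗} (hH : IsSelfAdjoint H) {ψ : ℝ → ℂ}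
    (hψ : Continuous ψ) (hψc : HasCompactSupport ψ) {g h : 𝓗} (hg : (g, h) ∈ H.graph) :
    compactCalculus H (fun l => ψ l * l) g = compactCalculus H ψ h := by
  have hn := isStarNormal_resolventAtI hH
  have e1 : compactCalculus H (fun l => ψ l * (l + I))
      = compactCalculus H (fun l => ψ l * l) + I • compactCalculus H ψ := by
    simp only [compactCalculus_eq]
    rw [← cfc_const_mul _ _ _ (continuousOn_resolventSymbol hH hψ hψc),
      ← cfc_add _ _ _ (continuousOn_resolventSymbol (ψ := fun l => ψ l * l) hH (by fun_prop)
        hψc.mul_right) ((continuousOn_resolventSymbol hH hψ hψc).const_mul I)]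
    congr 1
    funext z
    by_cases h : z = 0
    · simp [h, resolventSymbol_zero]
    · simp only [resolventSymbol_of_ne _ h]
      ring
  have e2 : compactCalculus H (fun l => ψ l * (l + I)) (resolventAtI H (h + I • g))
      = compactCalculus H ψ (h + I • g) :=
    congrArg (fun A : 𝓗 →L[ℂ] 𝓗 => A (h + I • g)) (compactCalculus_resolvent hH hψ hψc)
  rw [resolventAtI_apply_eq hH hg, e1, _root_.add_apply, smul_apply, map_add, map_smul] at e2
  exact add_right_cancel e2

/-- The plateau functions `χ_m`. -/
def plateau (m : ℝ) (l : ℝ) : ℂ := ((max 0 (min 1 (m + 1 - |l|)) : ℝ) : ℂ)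

theorem continuous_plateau (m : ℝ) : Continuous (plateau m) := by
  unfold plateau; fun_prop

theorem plateau_eq_one {m l : ℝ} (h : |l| ≤ m) : plateau m l = 1 := by
  have : max 0 (min 1 (m + 1 - |l|)) = 1 := by
    rw [min_eq_left (by linarith), max_eq_right zero_le_one]
  rw [plateau, this, ofReal_one]

theorem hasCompactSupport_plateau (m : ℝ) : HasCompactSupport (plateau m) := by
  refine HasCompactSupport.of_support_subset_isCompact (isCompact_closedBall (0 : ℝ) (m + 1)) ?_
  intro l hl
  by_contra h
  rw [Metric.mem_closedBall, dist_zero_right, Real.norm_eq_abs, not_le] at h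
  apply hl
  have : max 0 (min 1 (m + 1 - |l|)) = 0 := by
    rw [max_eq_left]
    exact (min_le_right _ _).trans (by linarith)
  rw [plateau, this, ofReal_zero]

theorem norm_one_sub_plateau_le (m l : ℝ) : ‖1 - plateau m l‖ ≤ 1 := by
  rw [plateau, ← ofReal_one, ← ofReal_sub, Complex.norm_real, Real.norm_eq_abs, abs_le]
  have h1 : max 0 (min 1 (m + 1 - |l|)) ≤ 1 := max_le zero_le_one (min_le_left _ _)
  have h2 := le_max_left 0 (min 1 (m + 1 - |l|))
  constructor <;> linarith

/-- The operators `ψ(H)` have no common kernel. -/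
theorem eq_zero_of_forall_compactCalculus {H : 𝓗 →ₗ.[ℂ] 𝓗} (hH : IsSelfAdjoint H) {f : 𝓗}
    (h : ∀ ψ : ℝ → ℂ, Continuous ψ → HasCompactSupport ψ → compactCalculus H ψ f = 0) :
    f = 0 := by
  have hn := isStarNormal_resolventAtI hH
  apply resolventAtI_injective hH
  set N := resolventAtI H with hN
  -- The symbol `z (1 - χ_m(λ))` vanishes for `|λ| ≤ m`, and otherwise `|z| ≤ 1/m` because `|λ| ≤
  -- |z⁻¹|`. Since `χ_m(H) f = 0`, this bounds `N f` itself.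
  have key : ∀ m : ℝ, 0 < m → ‖N f‖ ≤ m⁻¹ * ‖f‖ := by
    intro m hm
    have hc := continuousOn_resolventSymbol hH (continuous_plateau m) (hasCompactSupport_plateau m)
    have e : N - N * compactCalculus H (plateau m)
        = cfc (fun z : ℂ => z - z * resolventSymbol (plateau m) z) N := by
      rw [compactCalculus_eq, ← hN, cfc_sub (fun z : ℂ => z)
        (fun z => z * resolventSymbol (plateau m) z) N continuousOn_id
        (continuousOn_id.mul hc), cfc_mul (fun z : ℂ => z) _ N continuousOn_id hc, cfc_id' ℂ N]
    have hb : ‖N - N * compactCalculus H (plateau m)‖ ≤ m⁻¹ := by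
      rw [e]
      refine norm_cfc_le (by positivity) fun z hz => ?_
      by_cases h0 : z = 0
      · simp [h0, hm.le]
      · rw [resolventSymbol_of_ne _ h0]
        by_cases hl : |(z⁻¹).re| ≤ m
        · rw [plateau_eq_one hl]
          simp [hm.le]
        · have h1 : m ≤ ‖z‖⁻¹ := by
            rw [← norm_inv]
            exact (not_le.1 hl).le.trans (abs_re_le_norm _)
          have h2 : ‖z‖ ≤ m⁻¹ := (le_inv_comm₀ hm (norm_pos_iff.2 h0)).1 h1
          rw [← mul_one_sub, norm_mul]
          calc ‖z‖ * _ ≤ m⁻¹ * 1 :=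
                mul_le_mul h2 (norm_one_sub_plateau_le _ _) (norm_nonneg _) (by positivity)
            _ = m⁻¹ := mul_one _
    have h1 : N f = (N - N * compactCalculus H (plateau m)) f := by
      rw [sub_apply, mul_apply_eq_comp,
        h _ (continuous_plateau m) (hasCompactSupport_plateau m), map_zero, sub_zero]
    rw [h1]
    exact le_of_opNorm_le _ hb f
  have hlim : Filter.Tendsto (fun m : ℝ => m⁻¹ * ‖f‖) Filter.atTop (nhds 0) := by
    simpa using tendsto_inv_atTop_zero.mul_const ‖f‖
  refine norm_le_zero_iff.1 (ge_of_tendsto hlim ?_)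
  filter_upwards [Filter.eventually_gt_atTop 0] with m hm using key m hm

/-- Uniqueness of `φ(H)`. It makes it enough to test operator identities after multiplication by
`ψ(H)`, the only form in which `IsFunctionOf` gives information. -/
theorem ext_of_forall_compactCalculus {H : 𝓗 →ₗ.[ℂ] 𝓗} (hH : IsSelfAdjoint H) {S T : 𝓗 →L[ℂ] 𝓗}
    (h : ∀ ψ : ℝ → ℂ, Continuous ψ → HasCompactSupport ψ →
      compactCalculus H ψ * S = compactCalculus H ψ * T) : S = T := by
  refine ContinuousLinearMap.ext fun f => sub_eq_zero.1 ?_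
  refine eq_zero_of_forall_compactCalculus hH fun ψ hψ hψc => ?_
  rw [map_sub, sub_eq_zero]
  exact congrArg (fun A : 𝓗 →L[ℂ] 𝓗 => A f) (h ψ hψ hψc)

/-- `IsFunctionOf` prescribes only products with `ψ(H)` on the left. Testing with a further `χ(H)`
on the left reduces the product on the right to multiplicativity of the compact calculus. -/
theorem IsFunctionOf.mul_compactCalculus {H : 𝓗 →ₗ.[ℂ] 𝓗} (hH : IsSelfAdjoint H) {φ : ℝ → ℂ}
    (hφ : Continuous φ) {T : 𝓗 →L[ℂ] 𝓗} (hT : IsFunctionOf H φ T) {ψ : ℝ → ℂ}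
    (hψ : Continuous ψ) (hψc : HasCompactSupport ψ) :
    T * compactCalculus H ψ = compactCalculus H (fun l => ψ l * φ l) := by
  refine ext_of_forall_compactCalculus hH fun χ hχ hχc => ?_
  have h1 : compactCalculus H χ * T = compactCalculus H (fun l => χ l * φ l) := hT χ hχ hχc
  have h2 := compactCalculus_mul (ψ := fun l => χ l * φ l) hH (hχ.mul hφ) hχc.mul_right hψ hψc
  have h3 := compactCalculus_mul (χ := fun l => ψ l * φ l) hH hχ hχc (hψ.mul hφ) hψc.mul_right
  rw [← mul_assoc, h1, ← h2, ← h3]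
  congr 1
  funext l
  ring

theorem IsFunctionOf.isSelfAdjoint {H : 𝓗 →ₗ.[ℂ] 𝓗} (hH : IsSelfAdjoint H) {φ : ℝ → ℝ}
    (hφ : Continuous φ) {T : 𝓗 →L[ℂ] 𝓗} (hT : IsFunctionOf H (fun l => (φ l : ℂ)) T) :
    IsSelfAdjoint T := by
  have hφ' : Continuous (fun l => (φ l : ℂ)) := by fun_prop
  refine ext_of_forall_compactCalculus hH fun χ hχ hχc => ?_
  have hs : Continuous fun l => star (χ l) := hχ.star
  have hsc : HasCompactSupport fun l => star (χ l) := hχc.comp_left (star_zero _)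
  have h1 := congrArg star (hT.mul_compactCalculus hH hφ' hs hsc)
  rw [star_mul, compactCalculus_star, star_star] at h1
  rw [h1, ← compactCalculus_star]
  refine Eq.trans ?_ (hT χ hχ hχc).symm
  congr 1
  funext l
  simp

/-- The unitary group `e^{irT}` of a bounded operator `T`. -/
def wave (T : 𝓗 →L[ℂ] 𝓗) (r : ℝ) : 𝓗 →L[ℂ] 𝓗 := NormedSpace.exp (((r : ℂ) * I) • T)

/-- `∫ g(s) e^{2πisT} ds`, the function of `T` whose Fourier transform is `g`. -/
def fourierOp (g : ℝ → ℂ) (T : 𝓗 →L[ℂ] 𝓗) : 𝓗 →L[ℂ] 𝓗 := ∫ s, g s • wave T (2 * Real.pi * s)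

theorem continuous_wave (T : 𝓗 →L[ℂ] 𝓗) : Continuous (wave T) := by
  let +nondep : NormedAlgebra ℚ (𝓗 →L[ℂ] 𝓗) := NormedAlgebra.restrictScalars ℚ ℂ _
  unfold wave
  fun_prop

theorem wave_mem_unitary {T : 𝓗 →L[ℂ] 𝓗} (hT : IsSelfAdjoint T) (r : ℝ) :
    wave T r ∈ unitary (𝓗 →L[ℂ] 𝓗) := by
  let +nondep : NormedAlgebra ℚ (𝓗 →L[ℂ] 𝓗) := .restrictScalars ℚ ℂ _
  refine NormedSpace.exp_mem_unitary_of_mem_skewAdjoint ?_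
  rw [skewAdjoint.mem_iff, star_smul, hT.star_eq, ← neg_smul]
  congr 1
  simp

theorem norm_wave_le {T : 𝓗 →L[ℂ] 𝓗} (hT : IsSelfAdjoint T) (r : ℝ) : ‖wave T r‖ ≤ 1 := by
  have h1 := CStarRing.norm_star_mul_self (x := wave T r)
  rw [(Unitary.mem_iff.1 (wave_mem_unitary hT r)).1] at h1
  have h2 : ‖(1 : 𝓗 →L[ℂ] 𝓗)‖ ≤ 1 := ContinuousLinearMap.norm_id_le
  nlinarith [norm_nonneg (wave T r)]

theorem integrable_smul_wave {T : 𝓗 →L[ℂ] 𝓗} (hT : IsSelfAdjoint T) {g : ℝ → ℂ}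
    (hg : Integrable g) : Integrable fun s => g s • wave T (2 * Real.pi * s) := by
  refine hg.norm.mono' (hg.1.smul ((continuous_wave T).comp
    (by fun_prop)).aestronglyMeasurable) (Filter.Eventually.of_forall fun s => ?_)
  rw [norm_smul]
  exact mul_le_of_le_one_right (norm_nonneg _) (norm_wave_le hT _)

theorem wave_cfc {N : 𝓗 →L[ℂ] 𝓗} (hN : IsStarNormal N) {σ : ℂ → ℂ}
    (hσ : ContinuousOn σ (spectrum ℂ N)) (r : ℝ) :
    wave (cfc σ N) r = cfc (fun z => Complex.exp (r * I * σ z)) N := by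
  rw [wave, ← cfc_const_mul _ _ _ hσ, ← CFC.complex_exp_eq_normedSpace_exp,
    ← cfc_comp' Complex.exp (fun z => r * I * σ z) N
      Complex.continuous_exp.continuousOn (hσ.const_mul _)]

/-- `T` need not be a continuous function of the resolvent, since `φ` is not controlled at infinity.
On the support of `ψ`, however, `φ` agrees with a cut-off `χ`, and `A = χ(H)` is such a function.
`ψ(H)` intertwines `T` with `A`, hence their exponentials and their Fourier integrals, and for `A`
everything is computed on the spectrum. -/
theorem IsFunctionOf.compactCalculus_mul_fourierOp {H : 𝓗 →ₗ.[ℂ] 𝓗} (hH : IsSelfAdjoint H)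
    {φ : ℝ → ℝ} (hφ : Continuous φ) {T : 𝓗 →L[ℂ] 𝓗} (hT : IsFunctionOf H (fun l => (φ l : ℂ)) T)
    {F g : ℝ → ℂ} (hF : Continuous F) (hgc : Continuous g) (hg : Integrable g)
    (hFg : ∀ u, F u = ∫ s, g s * Complex.exp ((2 * Real.pi * s : ℝ) * I * u)) {ψ : ℝ → ℂ}
    (hψ : Continuous ψ) (hψc : HasCompactSupport ψ) :
    compactCalculus H ψ * fourierOp g T = compactCalculus H (fun l => ψ l * F (φ l)) := by
  have hn := isStarNormal_resolventAtI hH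
  have hφ' : Continuous (fun l => (φ l : ℂ)) := by fun_prop
  obtain ⟨m, hm⟩ := hψc.isCompact.isBounded.subset_closedBall (0 : ℝ)
  have hm' : ∀ l, ψ l ≠ 0 → plateau m l = 1 := by
    intro l hl
    have := hm (subset_tsupport _ hl)
    rw [Metric.mem_closedBall, dist_zero_right, Real.norm_eq_abs] at this
    exact plateau_eq_one this
  set χ : ℝ → ℂ := fun l => plateau m l * φ l with hχ
  have hχc : Continuous χ := (continuous_plateau m).mul hφ'
  have hχs : HasCompactSupport χ := (hasCompactSupport_plateau m).mul_right
  set σ := resolventSymbol χ with hσ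
  have hσc := continuousOn_resolventSymbol hH hχc hχs
  set A := compactCalculus H χ with hA
  have hAs : IsSelfAdjoint A := by
    rw [IsSelfAdjoint, hA, ← compactCalculus_star]
    congr 1
    funext l
    simp [hχ, plateau]
  have hsemi : SemiconjBy (compactCalculus H ψ) T A := by
    rw [SemiconjBy, hA, ← compactCalculus_mul hH hχc hχs hψ hψc]
    refine (hT ψ hψ hψc).trans ?_
    congr 1
    funext l
    by_cases h : ψ l = 0
    · simp [h]
    · simp only [hχ, hm' l h, one_mul, mul_comm (ψ l)]
  have hwave : ∀ r, compactCalculus H ψ * wave T r = wave A r * compactCalculus H ψ := by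
    intro r
    let +nondep : NormedAlgebra ℚ (𝓗 →L[ℂ] 𝓗) := .restrictScalars ℚ ℂ _
    exact SemiconjBy.exp_right (hsemi.smul_right _)
  have h1 : compactCalculus H ψ * fourierOp g T = fourierOp g A * compactCalculus H ψ := by
    rw [fourierOp, fourierOp, ← integral_const_mul_of_integrable
      (integrable_smul_wave (hT.isSelfAdjoint hH hφ) hg),
      ← integral_mul_const_of_integrable (integrable_smul_wave hAs hg)]
    refine integral_congr_ae (Filter.Eventually.of_forall fun s => ?_)
    simp only [mul_smul_comm, smul_mul_assoc, hwave]
  have h2 : fourierOp g A = cfc (fun z => F (σ z).re) (resolventAtI H) := by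
    have hre : ∀ z, (((σ z).re : ℝ) : ℂ) = σ z := by
      intro z
      by_cases h0 : z = 0
      · simp [hσ, h0, resolventSymbol_zero]
      · rw [hσ, resolventSymbol_of_ne _ h0]
        simp [hχ, plateau]
    have h3 : ∀ s, g s • wave A (2 * Real.pi * s)
        = cfc (fun z => g s * Complex.exp ((2 * Real.pi * s : ℝ) * I * σ z))
          (resolventAtI H) := by
      intro s
      rw [hA, compactCalculus_eq, wave_cfc hn hσc,
        cfc_const_mul (g s) (fun z => Complex.exp ((2 * Real.pi * s : ℝ) * I * σ z)) _
        (Complex.continuous_exp.comp_continuousOn (hσc.const_mul _))]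
    simp only [fourierOp, h3]
    rw [← cfc_integral _ (fun s => ‖g s‖) (resolventAtI H) ?_ ?_ hg.norm.2]
    · refine cfc_congr fun z _ => ?_
      simp only [hFg, hre]
    · refine ContinuousOn.mul (hgc.comp_continuousOn continuousOn_fst) ?_
      refine Complex.continuous_exp.comp_continuousOn (ContinuousOn.mul (by fun_prop) ?_)
      exact hσc.comp continuousOn_snd fun p hp => hp.2
    · refine Filter.Eventually.of_forall fun s z _ => ?_
      rw [norm_mul, ← hre, mul_right_comm, ← ofReal_mul, Complex.norm_exp_ofReal_mul_I, mul_one]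
  rw [h1, h2, compactCalculus_eq, compactCalculus_eq, ← cfc_mul (fun z => F (σ z).re) _ _
    (hF.comp_continuousOn (Complex.continuous_re.comp_continuousOn hσc))
    (continuousOn_resolventSymbol hH hψ hψc)]
  refine cfc_congr fun z _ => ?_
  by_cases h0 : z = 0
  · simp [h0, resolventSymbol_zero]
  · simp only [hσ, resolventSymbol_of_ne _ h0, hχ]
    by_cases h : ψ (z⁻¹).re = 0
    · rw [h, mul_zero, zero_mul]
    · rw [hm' _ h, one_mul, ofReal_re, mul_comm]

/-- `φ(H) F(φ(H)) φ(H)` is the function `φ² F ∘ φ` of `H`. -/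
theorem IsFunctionOf.mul_fourierOp_mul {H : 𝓗 →ₗ.[ℂ] 𝓗} (hH : IsSelfAdjoint H)
    {φ : ℝ → ℝ} (hφ : Continuous φ) {T : 𝓗 →L[ℂ] 𝓗} (hT : IsFunctionOf H (fun l => (φ l : ℂ)) T)
    {F g : ℝ → ℂ} (hF : Continuous F) (hgc : Continuous g) (hg : Integrable g)
    (hFg : ∀ u, F u = ∫ s, g s * Complex.exp ((2 * Real.pi * s : ℝ) * I * u)) :
    IsFunctionOf H (fun l => φ l * F (φ l) * φ l) (T * fourierOp g T * T) := by
  intro ψ hψ hψc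
  have hφ' : Continuous (fun l => (φ l : ℂ)) := by fun_prop
  have e1 : compactCalculus H ψ * T = _ := hT ψ hψ hψc
  have e2 := hT.compactCalculus_mul_fourierOp hH hφ hF hgc hg hFg (hψ.mul hφ') hψc.mul_right
  have e3 : compactCalculus H (fun l => ψ l * φ l * F (φ l)) * T = _ :=
    hT _ ((hψ.mul hφ').mul (hF.comp hφ)) hψc.mul_right.mul_right
  change compactCalculus H ψ * (T * fourierOp g T * T) = _
  rw [← mul_assoc, ← mul_assoc, e1]
  refine (congrArg (· * T) e2).trans (e3.trans ?_)
  congr 1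
  funext l
  ring

end Resolvent

/-! ### Integral operators dominated by a convolution. -/

section IntegralOperators

open scoped ENNReal

variable {n : ℕ}

/-- Young's inequality `L¹ * L² ⊆ L²`: Cauchy–Schwarz with `k = k^{1/2} k^{1/2}`, then Tonelli. With
values in `ℝ≥0∞` no integrability has to be known beforehand. -/
theorem lintegral_sub_left_mul_sq_le {k f : Rn n → ℝ≥0∞} (hk : Measurable k) (hf : Measurable f) :
    ∫⁻ x, (∫⁻ y, k (x - y) * f y) ^ 2 ≤ (∫⁻ y, k y) ^ 2 * ∫⁻ y, f y ^ 2 := by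
  have h1 : ∀ x, (∫⁻ y, k (x - y) * f y) ^ 2 ≤ (∫⁻ y, k y) * ∫⁻ y, k (x - y) * f y ^ 2 := by
    intro x
    have hkx : Measurable fun y => k (x - y) := hk.comp (measurable_const.sub measurable_id)
    have hs : ∀ y, k (x - y) ^ (1 / 2 : ℝ) * (k (x - y) ^ (1 / 2 : ℝ) * f y) = k (x - y) * f y := by
      intro y
      rw [← mul_assoc, ← ENNReal.rpow_add_of_nonneg _ _ (by norm_num) (by norm_num)]
      norm_num
    have h := ENNReal.lintegral_mul_le_Lp_mul_Lq (volume : Measure (Rn n))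
      (p := 2) (q := 2) (by constructor <;> norm_num)
      (f := fun y => k (x - y) ^ (1 / 2 : ℝ)) (g := fun y => k (x - y) ^ (1 / 2 : ℝ) * f y)
      (hkx.pow_const _).aemeasurable ((hkx.pow_const _).mul hf).aemeasurable
    simp only [Pi.mul_apply, hs] at h
    have e1 : ∀ y, (k (x - y) ^ (1 / 2 : ℝ)) ^ (2 : ℝ) = k (x - y) := by
      intro y
      rw [← ENNReal.rpow_mul]
      norm_num
    have e2 : ∀ y, (k (x - y) ^ (1 / 2 : ℝ) * f y) ^ (2 : ℝ) = k (x - y) * f y ^ 2 := by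
      intro y
      rw [ENNReal.mul_rpow_of_nonneg _ _ (by norm_num), e1, ENNReal.rpow_two]
    simp only [e1, e2] at h
    rw [lintegral_sub_left_eq_self k x] at h
    calc _ ≤ ((∫⁻ y, k y) ^ (1 / 2 : ℝ) * (∫⁻ y, k (x - y) * f y ^ 2) ^ (1 / 2 : ℝ)) ^ 2 := by
          gcongr
      _ = _ := by
          rw [mul_pow, ← ENNReal.rpow_two, ← ENNReal.rpow_two, ← ENNReal.rpow_mul,
            ← ENNReal.rpow_mul]
          norm_num
  calc _ ≤ ∫⁻ x, (∫⁻ y, k y) * ∫⁻ y, k (x - y) * f y ^ 2 := lintegral_mono h1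
    _ = (∫⁻ y, k y) * ∫⁻ x, ∫⁻ y, k (x - y) * f y ^ 2 := by
        refine lintegral_const_mul _ ?_
        exact Measurable.lintegral_prod_right'
          (f := fun z : Rn n × Rn n => k (z.1 - z.2) * f z.2 ^ 2) (by fun_prop)
    _ = (∫⁻ y, k y) * ∫⁻ y, ∫⁻ x, k (x - y) * f y ^ 2 := by
        rw [lintegral_lintegral_swap (by fun_prop)]
    _ = _ := by
        have : ∀ y, ∫⁻ x, k (x - y) * f y ^ 2 = (∫⁻ x, k x) * f y ^ 2 := by
          intro y
          rw [lintegral_mul_const _ (by fun_prop), lintegral_sub_right_eq_self k y]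
        simp only [this]
        rw [lintegral_const_mul _ (by fun_prop), ← mul_assoc, sq]

/-- `K(x, y)` is measurable and dominated by the convolution kernel `g(x - y)`. -/
structure IsDominated (K : Rn n → Rn n → ℂ) (g : Rn n → ℝ) : Prop where
  meas : Measurable (Function.uncurry K)
  integrable : Integrable g
  measurable : Measurable g
  le : ∀ x y, ‖K x y‖ ≤ g (x - y)

namespace IsDominated

variable {K : Rn n → Rn n → ℂ} {g : Rn n → ℝ}

theorem nonneg (h : IsDominated K g) (x : Rn n) : 0 ≤ g x := by
  simpa using (norm_nonneg _).trans (h.le x 0)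

theorem integral_nonneg (h : IsDominated K g) : 0 ≤ ∫ x, g x :=
  MeasureTheory.integral_nonneg h.nonneg

theorem lintegral_eq (h : IsDominated K g) :
    ∫⁻ y, ENNReal.ofReal (g y) = ENNReal.ofReal (∫ y, g y) :=
  (ofReal_integral_eq_lintegral_ofReal h.integrable (.of_forall h.nonneg)).symm

theorem norm (h : IsDominated K g) : IsDominated (fun x y => ((‖K x y‖ : ℝ) : ℂ)) g where
  meas := by
    have := h.meas.norm
    exact Complex.measurable_ofReal.comp this
  integrable := h.integrable
  measurable := h.measurable
  le x y := by simpa using h.le x y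

theorem measurable_left (h : IsDominated K g) (x : Rn n) : Measurable (K x) :=
  h.meas.comp measurable_prodMk_left

theorem measurable_right (h : IsDominated K g) (y : Rn n) : Measurable fun x => K x y :=
  h.meas.comp measurable_prodMk_right

theorem lintegral_le (h : IsDominated K g) {f : Rn n → ℂ} (hf : Measurable f) :
    ∫⁻ x, (∫⁻ y, ‖K x y * f y‖ₑ) ^ 2 ≤ ENNReal.ofReal (∫ y, g y) ^ 2 * ∫⁻ y, ‖f y‖ₑ ^ 2 := by
  rw [← h.lintegral_eq]
  refine le_trans (lintegral_mono fun x => ?_) (lintegral_sub_left_mul_sq_le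
    (k := fun y => ENNReal.ofReal (g y)) (f := fun y => ‖f y‖ₑ)
    h.measurable.ennreal_ofReal hf.enorm)
  gcongr with y
  rw [enorm_mul]
  gcongr
  rw [← ofReal_norm]
  exact ENNReal.ofReal_le_ofReal (h.le x y)

theorem ae_integrable_of_measurable (h : IsDominated K g) {f : Rn n → ℂ} (hf : Measurable f)
    (hf2 : MemLp f 2) : ∀ᵐ x, Integrable fun y => K x y * f y := by
  have hfin : ∫⁻ y, ‖f y‖ₑ ^ 2 < ⊤ := by
    have := lintegral_rpow_enorm_lt_top_of_eLpNorm_lt_top two_ne_zero ENNReal.ofNat_ne_top hf2.2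
    simpa using this
  have hm : Measurable fun x => ∫⁻ y, ‖K x y * f y‖ₑ :=
    Measurable.lintegral_prod_right'
      (f := fun z : Rn n × Rn n => ‖K z.1 z.2 * f z.2‖ₑ)
      ((h.meas.mul (hf.comp measurable_snd)).enorm)
  have h2 : ∫⁻ x, (∫⁻ y, ‖K x y * f y‖ₑ) ^ 2 ≠ ⊤ :=
    ((h.lintegral_le hf).trans_lt (ENNReal.mul_lt_top (by simp) hfin)).ne
  filter_upwards [ae_lt_top (hm.pow_const 2) h2] with x hx
  refine ⟨((h.measurable_left x).mul hf).aestronglyMeasurable, ?_⟩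
  by_contra hne
  rw [HasFiniteIntegral, not_lt, top_le_iff] at hne
  rw [hne] at hx
  simp at hx

theorem eLpNorm_integral_le_of_measurable (h : IsDominated K g) {f : Rn n → ℂ}
    (hf : Measurable f) : eLpNorm (fun x => ∫ y, K x y * f y) 2
      ≤ ENNReal.ofReal (∫ y, g y) * eLpNorm f 2 := by
  rw [eLpNorm_eq_lintegral_rpow_enorm_toReal two_ne_zero ENNReal.ofNat_ne_top,
    eLpNorm_eq_lintegral_rpow_enorm_toReal two_ne_zero ENNReal.ofNat_ne_top]
  simp only [ENNReal.toReal_ofNat, ENNReal.rpow_ofNat]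
  have h1 : ∫⁻ x, ‖∫ y, K x y * f y‖ₑ ^ 2
      ≤ ENNReal.ofReal (∫ y, g y) ^ 2 * ∫⁻ y, ‖f y‖ₑ ^ 2 := by
    refine le_trans (lintegral_mono fun x => ?_) (h.lintegral_le hf)
    gcongr
    exact enorm_integral_le_lintegral_enorm _
  calc _ ≤ (ENNReal.ofReal (∫ y, g y) ^ 2 * ∫⁻ y, ‖f y‖ₑ ^ 2) ^ (1 / 2 : ℝ) := by gcongr
    _ = _ := by
      rw [ENNReal.mul_rpow_of_nonneg _ _ (by norm_num), ← ENNReal.rpow_two, ← ENNReal.rpow_mul]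
      norm_num

theorem integral_congr_right {f f' : Rn n → ℂ} (hff : f =ᵐ[volume] f') (x : Rn n) :
    ∫ y, K x y * f y = ∫ y, K x y * f' y := by
  refine integral_congr_ae ?_
  filter_upwards [hff] with y hy using by rw [hy]

theorem ae_integrable (h : IsDominated K g) {f : Rn n → ℂ} (hf : MemLp f 2) :
    ∀ᵐ x, Integrable fun y => K x y * f y := by
  obtain ⟨f', hf', hff⟩ := hf.1.aemeasurable
  filter_upwards [h.ae_integrable_of_measurable hf' ((memLp_congr_ae hff).1 hf)] with x hx
  refine hx.congr ?_
  filter_upwards [hff] with y hy using by rw [hy]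

theorem memLp_integral (h : IsDominated K g) {f : Rn n → ℂ} (hf : MemLp f 2) :
    MemLp (fun x => ∫ y, K x y * f y) 2 ∧
      eLpNorm (fun x => ∫ y, K x y * f y) 2 ≤ ENNReal.ofReal (∫ y, g y) * eLpNorm f 2 := by
  obtain ⟨f', hf', hff⟩ := hf.1.aemeasurable
  have e : (fun x => ∫ y, K x y * f y) = fun x => ∫ y, K x y * f' y := by
    funext x
    exact integral_congr_right hff x
  have hle : eLpNorm (fun x => ∫ y, K x y * f y) 2
      ≤ ENNReal.ofReal (∫ y, g y) * eLpNorm f 2 := by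
    rw [e, eLpNorm_congr_ae hff]
    exact h.eLpNorm_integral_le_of_measurable hf'
  refine ⟨⟨?_, hle.trans_lt (ENNReal.mul_lt_top (by simp) hf.2)⟩, hle⟩
  rw [e]
  have : StronglyMeasurable fun z : Rn n × Rn n => K z.1 z.2 * f' z.2 :=
    (h.meas.mul (hf'.comp measurable_snd)).stronglyMeasurable
  exact this.integral_prod_right'.aestronglyMeasurable

/-- `‖K‖` is dominated by the same `g`, so `∫ ‖K‖ ‖f‖` is in `L²` and pairs with `‖u‖`. This is what
permits Fubini below. -/
theorem integrable_prod (h : IsDominated K g) {u f : Rn n → ℂ} (hu : MemLp u 2)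
    (hf : MemLp f 2) :
    Integrable (fun z : Rn n × Rn n => u z.1 * (K z.1 z.2 * f z.2)) (volume.prod volume) := by
  have hm : AEStronglyMeasurable (fun z : Rn n × Rn n => u z.1 * (K z.1 z.2 * f z.2))
      (volume.prod volume) :=
    (hu.1.comp_fst).mul (h.meas.aestronglyMeasurable.mul hf.1.comp_snd)
  refine (integrable_prod_iff hm).2 ⟨?_, ?_⟩
  · filter_upwards [h.ae_integrable hf] with x hx
    exact hx.const_mul _
  · have h1 := (h.norm.memLp_integral (f := fun y => ((‖f y‖ : ℝ) : ℂ))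
      (by simpa using! hf.norm.ofReal)).1
    have h2 := hu.norm.integrable_mul h1.norm
    refine h2.congr (.of_forall fun x => ?_)
    simp only [Pi.mul_apply, norm_mul, integral_const_mul]
    congr 1
    have : (fun y => ((‖K x y‖ : ℝ) : ℂ) * ((‖f y‖ : ℝ) : ℂ))
        = fun y => ((‖K x y‖ * ‖f y‖ : ℝ) : ℂ) := by
      funext y; push_cast; rfl
    rw [this, integral_complex_ofReal, Complex.norm_real, Real.norm_of_nonneg]
    exact MeasureTheory.integral_nonneg fun y => by positivity

theorem integral_swap (h : IsDominated K g) {u f : Rn n → ℂ} (hu : MemLp u 2)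
    (hf : MemLp f 2) :
    ∫ x, u x * ∫ y, K x y * f y = ∫ y, (∫ x, u x * K x y) * f y := by
  have := integral_integral_swap (f := fun x y => u x * (K x y * f y)) (h.integrable_prod hu hf)
  simp only [integral_const_mul] at this
  rw [this]
  refine integral_congr_ae (.of_forall fun y => ?_)
  simp only [← mul_assoc, integral_mul_const]

end IsDominated

/-- Passes from a pointwise formula to an operator on classes of functions. Integral operators and
multiplication operators are both built in this way. -/
theorem exists_clm_of_ae (Φ : L2 n → Rn n → ℂ) (C : ℝ)
    (hΦ : ∀ f, MemLp (Φ f) 2)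
    (hadd : ∀ f g, Φ (f + g) =ᵐ[volume] fun x => Φ f x + Φ g x)
    (hsmul : ∀ (c : ℂ) f, Φ (c • f) =ᵐ[volume] fun x => c * Φ f x)
    (hle : ∀ f, ‖(hΦ f).toLp (Φ f)‖ ≤ C * ‖f‖) :
    ∃ T : L2 n →L[ℂ] L2 n, (∀ f, T f =ᵐ[volume] Φ f) ∧ ∀ f, ‖T f‖ ≤ C * ‖f‖ := by
  refine ⟨LinearMap.mkContinuous
    { toFun := fun f => (hΦ f).toLp (Φ f)
      map_add' := fun f g => ?_
      map_smul' := fun c f => ?_ } C hle, fun f => (hΦ f).coeFn_toLp, hle⟩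
  · apply Lp.ext
    filter_upwards [(hΦ (f + g)).coeFn_toLp, (hΦ f).coeFn_toLp, (hΦ g).coeFn_toLp, hadd f g,
      Lp.coeFn_add ((hΦ f).toLp (Φ f)) ((hΦ g).toLp (Φ g))] with x h1 h2 h3 h4 h5
    rw [h1, h4, h5, Pi.add_apply, h2, h3]
  · apply Lp.ext
    filter_upwards [(hΦ (c • f)).coeFn_toLp, (hΦ f).coeFn_toLp, hsmul c f,
      Lp.coeFn_smul c ((hΦ f).toLp (Φ f))] with x h1 h2 h3 h4
    rw [h1, h3, RingHom.id_apply, h4, Pi.smul_apply, h2, smul_eq_mul]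

theorem IsDominated.exists_isIntegralKernel {K : Rn n → Rn n → ℂ} {g : Rn n → ℝ}
    (h : IsDominated K g) :
    ∃ T : L2 n →L[ℂ] L2 n, IsIntegralKernel T K := by
  refine Exists.elim (exists_clm_of_ae (fun (f : L2 n) x => ∫ y, K x y * f y) (∫ y, g y)
    (fun f => (h.memLp_integral (Lp.memLp f)).1) ?_ ?_ ?_) fun T hT => ?_
  rotate_right
  · replace hT := hT.1
    refine ⟨T, h.meas, fun f => ?_⟩
    filter_upwards [h.ae_integrable (Lp.memLp f), hT f] with x h1 h2 using ⟨h1, h2⟩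
  · intro f f'
    filter_upwards [h.ae_integrable (Lp.memLp f), h.ae_integrable (Lp.memLp f')] with x h1 h2
    rw [← integral_add h1 h2]
    refine integral_congr_ae ?_
    filter_upwards [Lp.coeFn_add f f'] with y hy
    rw [hy, Pi.add_apply, mul_add]
  · intro c f
    refine .of_forall fun x => ?_
    simp only
    rw [← integral_const_mul]
    refine integral_congr_ae ?_
    filter_upwards [Lp.coeFn_smul c f] with y hy
    rw [hy, Pi.smul_apply, smul_eq_mul, mul_left_comm]
  · intro f
    rw [Lp.norm_toLp, Lp.norm_def]
    refine (ENNReal.toReal_mono (by finiteness) (h.memLp_integral (Lp.memLp f)).2).trans ?_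
    rw [ENNReal.toReal_mul, ENNReal.toReal_ofReal h.integral_nonneg]

theorem IsDominated.norm_apply_le {K : Rn n → Rn n → ℂ} {g : Rn n → ℝ}
    (h : IsDominated K g) {T : L2 n →L[ℂ] L2 n} (hT : IsIntegralKernel T K) (f : L2 n) :
    ‖T f‖ ≤ (∫ y, g y) * ‖f‖ := by
  have e : T f =ᵐ[volume] fun x => ∫ y, K x y * f y := (hT.2 f).mono fun x hx => hx.2
  rw [Lp.norm_def, Lp.norm_def, eLpNorm_congr_ae e]
  refine (ENNReal.toReal_mono (by finiteness) (h.memLp_integral (Lp.memLp f)).2).trans ?_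
  rw [ENNReal.toReal_mul, ENNReal.toReal_ofReal h.integral_nonneg]

theorem IsDominated.opNorm_le {K : Rn n → Rn n → ℂ} {g : Rn n → ℝ}
    (h : IsDominated K g) {T : L2 n →L[ℂ] L2 n} (hT : IsIntegralKernel T K) :
    ‖T‖ ≤ ∫ y, g y :=
  T.opNorm_le_bound h.integral_nonneg (h.norm_apply_le hT)

/-- Multiplication by a bounded measurable function. -/
theorem exists_mulOp {w : Rn n → ℝ} (hw : Measurable w) {C : ℝ} (hC : ∀ x, |w x| ≤ C) :
    ∃ M : L2 n →L[ℂ] L2 n, ∀ f, M f =ᵐ[volume] fun x => (w x : ℂ) * f x := by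
  have hle : ∀ (f : L2 n), ∀ᵐ x, ‖(w x : ℂ) * f x‖ ≤ C * ‖f x‖ := fun f => .of_forall fun x => by
    rw [norm_mul, Complex.norm_real]
    exact mul_le_mul_of_nonneg_right (hC x) (norm_nonneg _)
  have hmem : ∀ f : L2 n, MemLp (fun x => (w x : ℂ) * f x) 2 := fun f =>
    (Lp.memLp f).of_le_mul ((Complex.measurable_ofReal.comp hw).aestronglyMeasurable.mul
      (Lp.aestronglyMeasurable f)) (hle f)
  refine Exists.elim (exists_clm_of_ae (fun (f : L2 n) x => (w x : ℂ) * f x) C hmem ?_ ?_ ?_)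
    fun T hT => ⟨T, hT.1⟩
  · intro f g
    filter_upwards [Lp.coeFn_add f g] with x hx
    rw [hx, Pi.add_apply, mul_add]
  · intro c f
    filter_upwards [Lp.coeFn_smul c f] with x hx
    rw [hx, Pi.smul_apply, smul_eq_mul, mul_left_comm]
  · intro f
    refine Lp.norm_le_mul_norm_of_ae_le_mul ?_
    filter_upwards [(hmem f).coeFn_toLp] with x hx
    rw [hx, norm_mul, Complex.norm_real]
    exact mul_le_mul_of_nonneg_right (hC x) (norm_nonneg _)

end IntegralOperators

/-! ### Gaussian integrals and elementary inequalities. -/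

section GaussianIntegrals

variable {n : ℕ}

theorem integral_gaussian_Rn {b : ℝ} (hb : 0 < b) :
    ∫ z : Rn n, Real.exp (-b * ‖z‖ ^ 2) = (Real.pi / b) ^ ((n : ℝ) / 2) := by
  simpa using GaussianFourier.integral_rexp_neg_mul_sq_norm (V := Rn n) hb

/-- A function that is not integrable has integral `0` by convention, whereas the formula gives a
positive value. -/
theorem integrable_gaussian_Rn {b : ℝ} (hb : 0 < b) :
    Integrable fun z : Rn n => Real.exp (-b * ‖z‖ ^ 2) := by
  by_contra h
  have h1 := integral_undef h
  rw [integral_gaussian_Rn hb] at h1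
  have : 0 < (Real.pi / b) ^ ((n : ℝ) / 2) := by positivity
  linarith

theorem integral_scaled_gaussian {c q : ℝ} (hc : 0 < c) (hq : 0 < q) :
    ∫ z : Rn n, q ^ n * Real.exp (-c * q ^ 2 * ‖z‖ ^ 2) = (Real.pi / c) ^ ((n : ℝ) / 2) := by
  have h := integral_gaussian_Rn (n := n) (b := c * q ^ 2) (by positivity)
  simp only [neg_mul] at h ⊢
  rw [integral_const_mul, h, ← div_div, Real.div_rpow (by positivity) (by positivity)]
  have : (q ^ 2) ^ ((n : ℝ) / 2) = q ^ n := by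
    rw [← Real.rpow_natCast q 2, ← Real.rpow_mul hq.le, ← Real.rpow_natCast q n]
    congr 1
    push_cast
    ring
  rw [this]
  field_simp

/-- The function `z ↦ e^{-b |x - z|²}`. -/
def gaussianAt (b : ℝ) (x z : Rn n) : ℝ := Real.exp (-b * ‖x - z‖ ^ 2)

theorem gaussianAt_pos (b : ℝ) (x z : Rn n) : 0 < gaussianAt b x z := Real.exp_pos _

theorem gaussianAt_comm (b : ℝ) (x z : Rn n) : gaussianAt b x z = gaussianAt b z x := by
  rw [gaussianAt, gaussianAt, norm_sub_rev]

theorem continuous_gaussianAt (b : ℝ) (x : Rn n) : Continuous (gaussianAt b x) := by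
  unfold gaussianAt; fun_prop

theorem gaussianAt_mul_self (b : ℝ) (x z : Rn n) :
    gaussianAt b x z * gaussianAt b x z = gaussianAt (2 * b) x z := by
  simp only [gaussianAt, ← Real.exp_add]
  congr 1
  ring

theorem integrable_gaussianAt {b : ℝ} (hb : 0 < b) (x : Rn n) : Integrable (gaussianAt b x) :=
  (integrable_gaussian_Rn hb).comp_sub_left x

theorem memLp_gaussianAt {b : ℝ} (hb : 0 < b) (x : Rn n) : MemLp (gaussianAt b x) 2 := by
  rw [memLp_two_iff_integrable_sq (continuous_gaussianAt b x).aestronglyMeasurable]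
  simp only [sq, gaussianAt_mul_self]
  exact integrable_gaussianAt (by positivity) x

theorem integral_gaussianAt_sq {c q : ℝ} (hc : 0 < c) (hq : 0 < q) (x : Rn n) :
    q ^ n * ∫ z, gaussianAt (c * q ^ 2) x z ^ 2 = (Real.pi / (2 * c)) ^ ((n : ℝ) / 2) := by
  rw [← integral_scaled_gaussian (n := n) (c := 2 * c) (q := q) (by positivity) hq,
    integral_const_mul]
  have e : ∀ z, gaussianAt (c * q ^ 2) x z ^ 2 = Real.exp (-(2 * c) * q ^ 2 * ‖x - z‖ ^ 2) := by
    intro z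
    rw [sq, gaussianAt_mul_self, gaussianAt]
    congr 1
    ring
  simp only [e]
  rw [integral_sub_left_eq_self (fun z : Rn n => Real.exp (-(2 * c) * q ^ 2 * ‖z‖ ^ 2)) volume x]

/-- The difference of the two sides is `(cs - 1)² / (2c)`. -/
theorem neg_mul_sq_add_le {c : ℝ} (hc : 0 < c) (s : ℝ) :
    -c * s ^ 2 + s ≤ 1 / (2 * c) + -(c / 2) * s ^ 2 := by
  have h : 0 ≤ (c * s - 1) ^ 2 / (2 * c) := by positivity
  have e : (c * s - 1) ^ 2 / (2 * c) = c / 2 * s ^ 2 - s + 1 / (2 * c) := by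
    field_simp
    ring
  linarith

/-- An exponential factor is absorbed by a Gaussian. -/
theorem gaussianAt_mul_exp_le {c q : ℝ} (hc : 0 < c) (x z : Rn n) :
    gaussianAt (c * q ^ 2) x z * Real.exp (q * ‖x - z‖)
      ≤ Real.exp (1 / (2 * c)) * gaussianAt (c / 2 * q ^ 2) x z := by
  simp only [gaussianAt, ← Real.exp_add]
  refine Real.exp_le_exp.2 ?_
  have := neg_mul_sq_add_le hc (q * ‖x - z‖)
  linarith

/-- Compares with the term of order `N` in the exponential series at `(1 + d) / 2`. -/
theorem one_add_pow_le_exp_half {d : ℝ} (hd : 0 ≤ d) (N : ℕ) :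
    (1 + d) ^ N ≤ (2 ^ N * N.factorial * Real.exp (1 / 2)) * Real.exp (d / 2) := by
  have h := Real.pow_div_factorial_le_exp (x := (1 + d) / 2) (by positivity) N
  rw [div_pow, div_div, div_le_iff₀ (by positivity)] at h
  calc _ ≤ _ := h
    _ = _ := by
      rw [add_div, Real.exp_add]
      ring

theorem one_add_pow_le_exp {d : ℝ} (hd : 0 ≤ d) (N : ℕ) :
    (1 + d) ^ N ≤ (2 ^ N * N.factorial * Real.exp (1 / 2)) * Real.exp d := by
  refine (one_add_pow_le_exp_half hd N).trans ?_
  gcongr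
  linarith

/-- Splitting at `d = 2 D ρ`. -/
theorem one_add_pow_le_split {D ρ d : ℝ} (hD : 0 ≤ D) (hρ : 0 ≤ ρ) (hd : 0 ≤ d) (N : ℕ) :
    (1 + d) ^ N ≤ (1 + 2 * D) ^ N * (1 + ρ) ^ N
      + (2 ^ N * N.factorial * Real.exp (1 / 2)) * Real.exp (-(D * ρ)) * Real.exp d := by
  rcases le_total d (2 * D * ρ) with h | h
  · have h1 : (1 + d) ^ N ≤ (1 + 2 * D) ^ N * (1 + ρ) ^ N := by
      rw [← mul_pow]
      gcongr
      nlinarith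
    have h2 : 0 ≤ (2 ^ N * N.factorial * Real.exp (1 / 2)) * Real.exp (-(D * ρ)) * Real.exp d := by
      positivity
    linarith
  -- For `d ≥ 2Dρ` one has `d/2 ≤ d - Dρ`: half of the exponent pays for the factor `exp(-Dρ)`.
  · have h1 : (1 + d) ^ N
        ≤ (2 ^ N * N.factorial * Real.exp (1 / 2)) * Real.exp (-(D * ρ)) * Real.exp d := by
      refine (one_add_pow_le_exp_half hd N).trans ?_
      rw [mul_assoc _ (Real.exp _) (Real.exp d), ← Real.exp_add]
      gcongr
      linarith
    have h2 : 0 ≤ (1 + 2 * D) ^ N * (1 + ρ) ^ N := by positivity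
    linarith

theorem integral_norm_sq_L2 (f : L2 n) : ∫ x, ‖f x‖ ^ 2 = ‖f‖ ^ 2 := by
  have h := inner_self_eq_norm_sq_to_K (𝕜 := ℂ) f
  rw [L2.inner_def] at h
  have e : ∀ x, inner ℂ (f x) (f x) = ((‖f x‖ ^ 2 : ℝ) : ℂ) := fun x => by
    rw [inner_self_eq_norm_sq_to_K]; push_cast; rfl
  simp only [e] at h
  rw [integral_complex_ofReal] at h
  apply Complex.ofReal_injective
  rw [h]
  push_cast
  rfl

theorem integral_mul_norm_le {g : Rn n → ℝ} (hg0 : ∀ x, 0 ≤ g x) (hg : MemLp g 2) (f : L2 n) :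
    ∫ x, g x * ‖f x‖ ≤ Real.sqrt (∫ x, g x ^ 2) * ‖f‖ := by
  have h := integral_mul_le_Lp_mul_Lq_of_nonneg (μ := (volume : Measure (Rn n)))
    (p := 2) (q := 2) (by constructor <;> norm_num) (f := g) (g := fun x => ‖f x‖)
    (.of_forall hg0) (.of_forall fun x => norm_nonneg _) (by simpa using hg)
    (by simpa using (Lp.memLp f).norm)
  simp only [Real.rpow_two, integral_norm_sq_L2, ← Real.sqrt_eq_rpow] at h
  rwa [Real.sqrt_sq (norm_nonneg _)] at h

theorem norm_le_sqrt_of_ae_le {g : Rn n → ℝ} (hg : MemLp g 2) (f : L2 n)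
    (hfg : ∀ᵐ x, ‖f x‖ ≤ g x) : ‖f‖ ≤ Real.sqrt (∫ x, g x ^ 2) := by
  rw [← Real.sqrt_sq (norm_nonneg f), ← integral_norm_sq_L2]
  refine Real.sqrt_le_sqrt (integral_mono_ae (Lp.memLp f).norm.integrable_sq hg.integrable_sq ?_)
  filter_upwards [hfg] with x hx
  gcongr

end GaussianIntegrals

/-! ### Weighted `L²` estimates for `e^{irT}` and its Fourier integrals. -/

section Weighted

variable {n : ℕ}

/-- The Gaussian bound `|p(x, y)| ≤ A qⁿ e^{-c q² |x-y|²}` for a measurable kernel. -/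
structure GaussianKernel (A c q : ℝ) (p : Rn n → Rn n → ℂ) : Prop where
  A_nonneg : 0 ≤ A
  c_pos : 0 < c
  q_pos : 0 < q
  meas : Measurable (Function.uncurry p)
  le : ∀ x y, ‖p x y‖ ≤ A * q ^ n * gaussianAt (c * q ^ 2) x y

theorem GaussianKernel.of_le {A c q : ℝ} {p : Rn n → Rn n → ℂ} {g : Rn n → Rn n → ℂ}
    (h : GaussianKernel A c q p) (hg : Measurable (Function.uncurry g))
    {A' : ℝ} (hA' : 0 ≤ A') {c' : ℝ} (hc' : 0 < c')
    (hle : ∀ x y, ‖g x y‖ ≤ A' * q ^ n * gaussianAt (c' * q ^ 2) x y) :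
    GaussianKernel A' c' q g := ⟨hA', hc', h.q_pos, hg, hle⟩

theorem GaussianKernel.isDominated {A c q : ℝ} {p : Rn n → Rn n → ℂ}
    (h : GaussianKernel A c q p) :
    IsDominated p fun z => A * (q ^ n * Real.exp (-c * q ^ 2 * ‖z‖ ^ 2)) where
  meas := h.meas
  integrable := by
    have := integrable_gaussian_Rn (n := n) (b := c * q ^ 2)
      (mul_pos h.c_pos (pow_pos h.q_pos 2))
    simpa only [neg_mul] using (this.const_mul _).const_mul _
  measurable := by fun_prop
  le x y := by
    refine (h.le x y).trans (le_of_eq ?_)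
    simp only [gaussianAt, neg_mul, mul_assoc]

theorem GaussianKernel.opNorm_le {A c q : ℝ} {p : Rn n → Rn n → ℂ}
    (h : GaussianKernel A c q p) {T : L2 n →L[ℂ] L2 n} (hT : IsIntegralKernel T p) :
    ‖T‖ ≤ A * (Real.pi / c) ^ ((n : ℝ) / 2) := by
  have := h.isDominated.opNorm_le hT
  rwa [integral_const_mul, integral_scaled_gaussian h.c_pos h.q_pos] at this

theorem GaussianKernel.memLp_right {A c q : ℝ} {p : Rn n → Rn n → ℂ}
    (h : GaussianKernel A c q p) (y : Rn n) : MemLp (fun z => p z y) 2 :=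
  (memLp_gaussianAt (mul_pos h.c_pos (pow_pos h.q_pos 2)) y).of_le_mul
    (h.isDominated.measurable_right y).aestronglyMeasurable (.of_forall fun z => by
      rw [Real.norm_of_nonneg (gaussianAt_pos _ _ _).le, gaussianAt_comm]
      exact h.le z y)

theorem GaussianKernel.memLp_left {A c q : ℝ} {p : Rn n → Rn n → ℂ}
    (h : GaussianKernel A c q p) (x : Rn n) : MemLp (fun z => p x z) 2 :=
  (memLp_gaussianAt (mul_pos h.c_pos (pow_pos h.q_pos 2)) x).of_le_mul
    (h.isDominated.measurable_left x).aestronglyMeasurable (.of_forall fun z => by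
      rw [Real.norm_of_nonneg (gaussianAt_pos _ _ _).le]
      exact h.le x z)

theorem norm_exp_le_exp_norm {𝓗 : Type*} [NormedAddCommGroup 𝓗] [InnerProductSpace ℂ 𝓗]
    [CompleteSpace 𝓗] (a : 𝓗 →L[ℂ] 𝓗) : ‖NormedSpace.exp a‖ ≤ Real.exp ‖a‖ := by
  have h1 := NormedSpace.exp_series_hasSum_exp' (𝕂 := ℂ) a
  have h2 := NormedSpace.exp_series_hasSum_exp' (𝕂 := ℝ) ‖a‖
  rw [← Real.exp_eq_exp_ℝ] at h2
  refine tsum_of_norm_bounded (f := fun k : ℕ => ((k.factorial : ℂ)⁻¹) • a ^ k) h2 (fun k => ?_)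
    |> (h1.tsum_eq ▸ ·)
  rw [norm_smul, norm_inv, Complex.norm_natCast, smul_eq_mul]
  gcongr
  rcases Nat.eq_zero_or_pos k with rfl | hk
  · rw [pow_zero, pow_zero]
    exact ContinuousLinearMap.norm_id_le
  · exact norm_pow_le' a hk

/-- A truncated distance keeps the triangle inequality, while its weights are bounded and so define
bounded multiplication operators. -/
theorem min_norm_sub_le (x z y : Rn n) (R : ℝ) :
    min ‖x - y‖ R ≤ ‖x - z‖ + min ‖z - y‖ R := by
  have h1 : ‖x - y‖ ≤ ‖x - z‖ + ‖z - y‖ := norm_sub_le_norm_sub_add_norm_sub _ _ _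
  rcases le_total ‖z - y‖ R with h | h
  · rw [min_eq_left h]
    exact (min_le_left _ _).trans h1
  · rw [min_eq_right h]
    exact (min_le_right _ _).trans (by linarith [norm_nonneg (x - z)])

/-- The truncated distance `q min(|z - y|, R)`. -/
def truncDist (q R : ℝ) (y z : Rn n) : ℝ := q * min ‖z - y‖ R

theorem continuous_truncDist (q R : ℝ) (y : Rn n) : Continuous (truncDist q R y) := by
  unfold truncDist; fun_prop

theorem truncDist_nonneg {q R : ℝ} (hq : 0 < q) (hR : 0 ≤ R) (y z : Rn n) :
    0 ≤ truncDist q R y z := mul_nonneg hq.le (le_min (norm_nonneg _) hR)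

theorem truncDist_le {q R : ℝ} (hq : 0 < q) (y z : Rn n) : truncDist q R y z ≤ q * R :=
  mul_le_mul_of_nonneg_left (min_le_right _ _) hq.le

theorem truncDist_triangle {q : ℝ} (hq : 0 < q) (R : ℝ) (y x z : Rn n) :
    truncDist q R y x ≤ q * ‖x - z‖ + truncDist q R y z := by
  rw [truncDist, truncDist, ← mul_add]
  exact mul_le_mul_of_nonneg_left (min_norm_sub_le x z y R) hq.le

/-- The bound for the exponentially conjugated operator. -/
def conjBound (n : ℕ) (A c : ℝ) : ℝ :=
  A * Real.exp (1 / (2 * c)) * (Real.pi / (c / 2)) ^ ((n : ℝ) / 2)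

theorem conjBound_nonneg {A c : ℝ} (hA : 0 ≤ A) (hc : 0 < c) : 0 ≤ conjBound n A c := by
  unfold conjBound; positivity

/-- With `w` the exponential weight, `B = w T w⁻¹` has the kernel `w(x) p(x,z) / w(z)`. The triangle
inequality bounds the quotient of weights by `e^{q|x-z|}`, which the Gaussian absorbs, so `‖B‖` is
bounded independently of `q`, `R` and `y`. Since `B` need not be self-adjoint, the series bound
`e^{|r| ‖B‖}` is used for its group. -/
theorem GaussianKernel.norm_wave_exp_le {A c q : ℝ} {p : Rn n → Rn n → ℂ}
    (h : GaussianKernel A c q p) {T : L2 n →L[ℂ] L2 n} (hT : IsIntegralKernel T p)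
    {R : ℝ} (y : Rn n) {M : L2 n →L[ℂ] L2 n}
    (hM : ∀ f, M f =ᵐ[volume] fun z => (Real.exp (truncDist q R y z) : ℂ) * f z)
    (r : ℝ) (v : L2 n) :
    ‖M (wave T r v)‖ ≤ Real.exp (conjBound n A c * |r|) * ‖M v‖ := by
  set w : Rn n → ℝ := fun z => Real.exp (truncDist q R y z) with hw
  have hwc : Continuous w := Real.continuous_exp.comp (continuous_truncDist q R y)
  set b : Rn n → Rn n → ℂ := fun x z => (w x : ℂ) * p x z * ((w z)⁻¹ : ℝ) with hb
  have hbm : Measurable (Function.uncurry b) := by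
    have h1 : Measurable fun z : Rn n × Rn n => (w z.1 : ℂ) :=
      (Complex.continuous_ofReal.comp (hwc.comp continuous_fst)).measurable
    have h2 : Measurable fun z : Rn n × Rn n => (((w z.2)⁻¹ : ℝ) : ℂ) :=
      Complex.measurable_ofReal.comp (hwc.measurable.comp measurable_snd).inv
    exact (h1.mul h.meas).mul h2
  have hbG : GaussianKernel (A * Real.exp (1 / (2 * c))) (c / 2) q b := by
    refine h.of_le hbm (mul_nonneg h.A_nonneg (Real.exp_pos _).le) (half_pos h.c_pos)
      fun x z => ?_
    have h1 : w x * (w z)⁻¹ ≤ Real.exp (q * ‖x - z‖) := by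
      rw [hw, ← Real.exp_neg, ← Real.exp_add]
      exact Real.exp_le_exp.2 (by linarith [truncDist_triangle h.q_pos R y x z])
    have hA := h.A_nonneg
    have hq := h.q_pos
    calc ‖b x z‖ = ‖p x z‖ * (w x * (w z)⁻¹) := by
          simp only [hb, norm_mul, Complex.norm_real, Real.norm_eq_abs, abs_inv, hw, Real.abs_exp]
          ring
      _ ≤ (A * q ^ n * gaussianAt (c * q ^ 2) x z) * Real.exp (q * ‖x - z‖) :=
          mul_le_mul (h.le x z) h1 (by positivity)
            ((norm_nonneg _).trans (h.le x z))
      _ = A * q ^ n * (gaussianAt (c * q ^ 2) x z * Real.exp (q * ‖x - z‖)) := by ring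
      _ ≤ A * q ^ n * (Real.exp (1 / (2 * c)) * gaussianAt (c / 2 * q ^ 2) x z) := by
          exact mul_le_mul_of_nonneg_left (gaussianAt_mul_exp_le h.c_pos x z) (by positivity)
      _ = _ := by ring
  obtain ⟨B, hB⟩ := hbG.isDominated.exists_isIntegralKernel
  have hBn : ‖B‖ ≤ conjBound n A c := hbG.opNorm_le hB
  -- In the form `M T = B M` the operator of division by the weight is not needed.
  have hsemi : SemiconjBy M T B := by
    refine ContinuousLinearMap.ext fun f => Lp.ext ?_
    rw [mul_apply_eq_comp, mul_apply_eq_comp]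
    filter_upwards [hM (T f), hT.2 f, hB.2 (M f)] with x h1 h2 h3
    rw [h1, h2.2, h3.2, ← integral_const_mul]
    refine integral_congr_ae ?_
    filter_upwards [hM f] with z hz
    have : ((w z : ℝ) : ℂ) ≠ 0 := by
      rw [Complex.ofReal_ne_zero]
      exact (Real.exp_pos _).ne'
    rw [hz]
    simp only [hb, Complex.ofReal_inv]
    change (w x : ℂ) * (p x z * f z) = (w x : ℂ) * p x z * ((w z : ℂ))⁻¹ * ((w z : ℂ) * f z)
    field_simp
  have hw2 : M * wave T r = wave B r * M := by
    let +nondep : NormedAlgebra ℚ (L2 n →L[ℂ] L2 n) := .restrictScalars ℚ ℂ _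
    exact SemiconjBy.exp_right (hsemi.smul_right _)
  have h1 : M (wave T r v) = wave B r (M v) :=
    congrArg (fun S : L2 n →L[ℂ] L2 n => S v) hw2
  rw [h1]
  refine ContinuousLinearMap.le_of_opNorm_le _ ?_ _
  refine (norm_exp_le_exp_norm _).trans (Real.exp_le_exp.2 ?_)
  rw [norm_smul, norm_mul, Complex.norm_I, mul_one, Complex.norm_real, Real.norm_eq_abs, mul_comm]
  gcongr

/-- The constant in the polynomially weighted estimate. -/
def polyBound (n : ℕ) (A c : ℝ) (N : ℕ) : ℝ :=
  (1 + 2 * conjBound n A c) ^ N + 2 ^ N * N.factorial * Real.exp (1 / 2)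

/-- Two bounds are combined: `e^{irT}` is unitary without weight, and grows at most like `e^{D|r|}`
with the exponential weight. Where the distance is at most `2D|r|` the polynomial weight is below
`(1 + 2D)^N (1 + |r|)^N` and unitarity suffices; farther out the exponential weight has a factor
`e^{D|r|}` to spare, which cancels the growth. The outcome is polynomial in `r`, hence integrable
against a rapidly decreasing function. -/
theorem GaussianKernel.norm_wave_poly_le {A c q : ℝ} {p : Rn n → Rn n → ℂ}
    (h : GaussianKernel A c q p) {T : L2 n →L[ℂ] L2 n} (hT : IsIntegralKernel T p)
    (hTs : IsSelfAdjoint T) {R : ℝ} (hR : 0 ≤ R) (y : Rn n) {M U : L2 n →L[ℂ] L2 n} {N : ℕ}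
    (hM : ∀ f, M f =ᵐ[volume] fun z => (Real.exp (truncDist q R y z) : ℂ) * f z)
    (hU : ∀ f, U f =ᵐ[volume] fun z => (((1 + truncDist q R y z) ^ N : ℝ) : ℂ) * f z)
    (r : ℝ) (v : L2 n) :
    ‖U (wave T r v)‖ ≤ polyBound n A c N * (1 + |r|) ^ N * ‖M v‖ := by
  set D := conjBound n A c with hD
  have hD0 : 0 ≤ D := conjBound_nonneg h.A_nonneg h.c_pos
  set a := (1 + 2 * D) ^ N * (1 + |r|) ^ N with ha
  set C := (2 ^ N * N.factorial * Real.exp (1 / 2)) with hC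
  set b := C * Real.exp (-(D * |r|)) with hb
  have ha0 : 0 ≤ a := by positivity
  have hC0 : 0 ≤ C := by positivity
  have hb0 : 0 ≤ b := by positivity
  have hv : ‖v‖ ≤ ‖M v‖ := by
    refine Lp.norm_le_norm_of_ae_le ?_
    filter_upwards [hM v] with z hz
    rw [hz, norm_mul, Complex.norm_real, Real.norm_eq_abs, Real.abs_exp]
    exact le_mul_of_one_le_left (norm_nonneg _)
      (Real.one_le_exp (truncDist_nonneg h.q_pos hR y z))
  have hUf : ∀ f, ‖U f‖ ≤ a * ‖f‖ + b * ‖M f‖ := by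
    intro f
    have h1 : ‖U f‖ ≤ ‖(a : ℂ) • f + (b : ℂ) • M f‖ := by
      refine Lp.norm_le_norm_of_ae_le ?_
      filter_upwards [hU f, hM f, Lp.coeFn_add ((a : ℂ) • f) ((b : ℂ) • M f),
        Lp.coeFn_smul (a : ℂ) f, Lp.coeFn_smul (b : ℂ) (M f)] with z h1 h2 h3 h4 h5
      rw [h1, h3, Pi.add_apply, h4, h5, Pi.smul_apply, Pi.smul_apply, h2, smul_eq_mul,
        smul_eq_mul, ← mul_assoc, ← add_mul, norm_mul, norm_mul, ← Complex.ofReal_mul,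
        ← Complex.ofReal_add, Complex.norm_real, Complex.norm_real, Real.norm_eq_abs,
        Real.norm_eq_abs]
      have hd := truncDist_nonneg h.q_pos hR y z
      rw [abs_of_nonneg (by positivity), abs_of_nonneg (by positivity)]
      gcongr
      exact one_add_pow_le_split hD0 (abs_nonneg r) hd N
    refine h1.trans ((norm_add_le _ _).trans ?_)
    rw [norm_smul, norm_smul, Complex.norm_real, Complex.norm_real, Real.norm_of_nonneg ha0,
      Real.norm_of_nonneg hb0]
  have h1 : ‖wave T r v‖ ≤ ‖M v‖ := by
    refine (ContinuousLinearMap.le_of_opNorm_le _ (norm_wave_le hTs r) v).trans ?_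
    rwa [one_mul]
  have h2 := h.norm_wave_exp_le hT y hM r v
  have h3 : b * Real.exp (D * |r|) = C := by
    rw [hb, mul_assoc, ← Real.exp_add, neg_add_cancel, Real.exp_zero, mul_one]
  have h4 : (1 : ℝ) ≤ (1 + |r|) ^ N := one_le_pow₀ (by linarith [abs_nonneg r])
  calc _ ≤ a * ‖wave T r v‖ + b * ‖M (wave T r v)‖ := hUf _
    _ ≤ a * ‖M v‖ + b * (Real.exp (D * |r|) * ‖M v‖) := by gcongr
    _ = (a + C) * ‖M v‖ := by rw [← mul_assoc, h3]; ring
    _ ≤ (a + C * (1 + |r|) ^ N) * ‖M v‖ := by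
        gcongr
        exact le_mul_of_one_le_right hC0 h4
    _ = _ := by rw [polyBound, ha]; ring

theorem GaussianKernel.norm_fourierOp_poly_le {A c q : ℝ} {p : Rn n → Rn n → ℂ}
    (h : GaussianKernel A c q p) {T : L2 n →L[ℂ] L2 n} (hT : IsIntegralKernel T p)
    (hTs : IsSelfAdjoint T) {R : ℝ} (hR : 0 ≤ R) (y : Rn n) {M U : L2 n →L[ℂ] L2 n} {N : ℕ}
    (hM : ∀ f, M f =ᵐ[volume] fun z => (Real.exp (truncDist q R y z) : ℂ) * f z)
    (hU : ∀ f, U f =ᵐ[volume] fun z => (((1 + truncDist q R y z) ^ N : ℝ) : ℂ) * f z)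
    {g : ℝ → ℂ} (hg : Integrable g)
    (hgN : Integrable fun s => ‖g s‖ * (1 + |2 * Real.pi * s|) ^ N) (v : L2 n) :
    ‖U (fourierOp g T v)‖
      ≤ polyBound n A c N * (∫ s, ‖g s‖ * (1 + |2 * Real.pi * s|) ^ N) * ‖M v‖ := by
  have hi := integrable_smul_wave hTs hg
  have hi2 : Integrable fun s => (g s • wave T (2 * Real.pi * s)) v :=
    hi.apply_continuousLinearMap v
  have e : U (fourierOp g T v) = ∫ s, g s • U (wave T (2 * Real.pi * s) v) := by
    have e0 : fourierOp g T v = ∫ s, (g s • wave T (2 * Real.pi * s)) v :=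
      ((ContinuousLinearMap.apply ℂ (L2 n) v).integral_comp_comm hi).symm
    rw [e0, ← U.integral_comp_comm hi2]
    simp
  rw [e, ← integral_const_mul, ← integral_mul_const]
  refine norm_integral_le_of_norm_le ((hgN.const_mul _).mul_const _) (.of_forall fun s => ?_)
  rw [norm_smul]
  calc _ ≤ ‖g s‖ * (polyBound n A c N * (1 + |2 * Real.pi * s|) ^ N * ‖M v‖) := by
        gcongr
        exact h.norm_wave_poly_le hT hTs hR y hM hU _ v
    _ = _ := by ring

/-- The constant in the off-diagonal estimate. -/
def rowBound (n : ℕ) (A c : ℝ) (N : ℕ) (B : ℝ) : ℝ :=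
  (2 ^ N * N.factorial * Real.exp (1 / 2)) * Real.exp (1 / (2 * c)) * (polyBound n A c N * B) *
    (A * Real.exp (1 / (2 * c))) * (Real.pi / c) ^ ((n : ℝ) / 2)

/-- The factor `1 + q|x-y|` is split into `1 + q|x-z|`, which the Gaussian absorbs, and a weight
centred at `y`, for which the `L²` estimate of `fourierOp g T v` applies. Cauchy–Schwarz in `z`
joins the two. The constant depends on none of `q`, `x`, `y`. -/
theorem GaussianKernel.integral_gaussianAt_mul_le {A c q : ℝ} {p : Rn n → Rn n → ℂ}
    (h : GaussianKernel A c q p) {T : L2 n →L[ℂ] L2 n} (hT : IsIntegralKernel T p)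
    (hTs : IsSelfAdjoint T) {g : ℝ → ℂ} (hg : Integrable g) {N : ℕ} {B : ℝ}
    (hgN : Integrable fun s => ‖g s‖ * (1 + |2 * Real.pi * s|) ^ N)
    (hB : ∫ s, ‖g s‖ * (1 + |2 * Real.pi * s|) ^ N ≤ B) (x y : Rn n) {v : L2 n}
    (hv : v =ᵐ[volume] fun z => p z y) :
    (∫ z, gaussianAt (c * q ^ 2) x z * ‖fourierOp g T v z‖) * (1 + q * ‖x - y‖) ^ N
      ≤ rowBound n A c N B := by
  have hq := h.q_pos
  have hc := h.c_pos
  have hA := h.A_nonneg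
  -- Truncation at `|x - y|` loses nothing: the weight is only required to have the value `q|x - y|`
  -- at `x`, so no limit `R → ∞` is needed.
  set R := ‖x - y‖ with hRdef
  have hR : 0 ≤ R := norm_nonneg _
  obtain ⟨M, hM⟩ := exists_mulOp (n := n) (w := fun z => Real.exp (truncDist q R y z))
    (Real.continuous_exp.comp (continuous_truncDist q R y)).measurable
    (C := Real.exp (q * R)) fun z => by
      rw [Real.abs_exp]
      exact Real.exp_le_exp.2 (truncDist_le hq y z)
  obtain ⟨U, hU⟩ := exists_mulOp (n := n) (w := fun z => (1 + truncDist q R y z) ^ N)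
    ((continuous_const.add (continuous_truncDist q R y)).pow N).measurable
    (C := (1 + q * R) ^ N) fun z => by
      have := truncDist_nonneg hq hR y z
      rw [abs_of_nonneg (by positivity)]
      gcongr
      exact truncDist_le hq y z
  set k := fourierOp g T v with hk
  set E : ℝ := Real.sqrt (∫ z, gaussianAt (c / 2 * q ^ 2) (0 : Rn n) z ^ 2) with hE
  have hEx : ∀ x : Rn n, Real.sqrt (∫ z, gaussianAt (c / 2 * q ^ 2) x z ^ 2) = E := by
    intro x
    rw [hE]
    congr 1
    have h1 := integral_gaussianAt_sq (half_pos hc) hq x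
    have h2 := integral_gaussianAt_sq (half_pos hc) hq (0 : Rn n)
    exact mul_left_cancel₀ (pow_pos hq n).ne' (h1.trans h2.symm)
  -- One `E` comes from Cauchy–Schwarz and one from the column `p(·, y)`; together they cancel the
  -- factor `q ^ n` of that column.
  have hEE : q ^ n * (E * E) = (Real.pi / c) ^ ((n : ℝ) / 2) := by
    rw [hE, Real.mul_self_sqrt (MeasureTheory.integral_nonneg fun z => sq_nonneg _),
      integral_gaussianAt_sq (half_pos hc) hq]
    congr 2
    ring
  have hMv : ‖M v‖ ≤ A * Real.exp (1 / (2 * c)) * q ^ n * E := by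
    have hmem := (memLp_gaussianAt (b := c / 2 * q ^ 2) (by positivity) y).const_mul
      (A * Real.exp (1 / (2 * c)) * q ^ n)
    refine (norm_le_sqrt_of_ae_le hmem (M v) ?_).trans (le_of_eq ?_)
    · filter_upwards [hM v, hv] with z h1 h2
      rw [h1, h2, norm_mul, Complex.norm_real, Real.norm_eq_abs, Real.abs_exp, mul_comm]
      calc ‖p z y‖ * Real.exp (truncDist q R y z)
          ≤ (A * q ^ n * gaussianAt (c * q ^ 2) z y) * Real.exp (q * ‖z - y‖) := by
            refine mul_le_mul (h.le z y) (Real.exp_le_exp.2 ?_) (Real.exp_pos _).le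
              ((norm_nonneg _).trans (h.le z y))
            exact mul_le_mul_of_nonneg_left (min_le_left _ _) hq.le
        _ = A * q ^ n * (gaussianAt (c * q ^ 2) z y * Real.exp (q * ‖z - y‖)) := by ring
        _ ≤ A * q ^ n * (Real.exp (1 / (2 * c)) * gaussianAt (c / 2 * q ^ 2) z y) := by
            exact mul_le_mul_of_nonneg_left (gaussianAt_mul_exp_le hc z y) (by positivity)
        _ = _ := by rw [gaussianAt_comm]; ring
    · simp only [mul_pow]
      rw [integral_const_mul, ← mul_pow, ← mul_pow, Real.sqrt_mul (sq_nonneg _), hEx,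
        Real.sqrt_sq (by positivity)]
  have hUk := h.norm_fourierOp_poly_le hT hTs hR y hM hU hg hgN v
  have hpoly : 0 ≤ polyBound n A c N := by
    have := conjBound_nonneg (n := n) hA hc
    unfold polyBound
    positivity
  have hI0 : 0 ≤ ∫ s, ‖g s‖ * (1 + |2 * Real.pi * s|) ^ N :=
    MeasureTheory.integral_nonneg fun s => by positivity
  set C₁ := (2 ^ N * N.factorial * Real.exp (1 / 2)) * Real.exp (1 / (2 * c)) with hC₁
  have hmain : (∫ z, gaussianAt (c * q ^ 2) x z * ‖k z‖) * (1 + q * R) ^ N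
      ≤ ∫ z, C₁ * gaussianAt (c / 2 * q ^ 2) x z * ‖U k z‖ := by
    rw [← integral_mul_const]
    refine integral_mono_of_nonneg (.of_forall fun z => ?_) ?_ ?_
    · have := gaussianAt_pos (c * q ^ 2) x z
      positivity
    · have := ((memLp_gaussianAt (b := c / 2 * q ^ 2) (by positivity) x).const_mul
        C₁).integrable_mul (Lp.memLp (U k)).norm
      exact this
    · filter_upwards [hU k] with z hz
      have hd := truncDist_nonneg hq hR y z
      have h1 : 1 + q * R ≤ (1 + q * ‖x - z‖) * (1 + truncDist q R y z) := by
        have h2 := truncDist_triangle hq R y x z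
        rw [truncDist, ← hRdef, min_self] at h2
        nlinarith [mul_nonneg (mul_nonneg hq.le (norm_nonneg (x - z))) hd]
      have h3 := one_add_pow_le_exp (d := q * ‖x - z‖) (by positivity) N
      have h4 := gaussianAt_mul_exp_le (q := q) hc x z
      have hg0 := gaussianAt_pos (c * q ^ 2) x z
      rw [hz, norm_mul, Complex.norm_real, Real.norm_of_nonneg (by positivity)]
      calc gaussianAt (c * q ^ 2) x z * ‖k z‖ * (1 + q * R) ^ N
          ≤ gaussianAt (c * q ^ 2) x z * ‖k z‖ *
            ((1 + q * ‖x - z‖) * (1 + truncDist q R y z)) ^ N := by gcongr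
        _ = gaussianAt (c * q ^ 2) x z * (1 + q * ‖x - z‖) ^ N *
            ((1 + truncDist q R y z) ^ N * ‖k z‖) := by rw [mul_pow]; ring
        _ ≤ gaussianAt (c * q ^ 2) x z *
            ((2 ^ N * N.factorial * Real.exp (1 / 2)) * Real.exp (q * ‖x - z‖)) *
            ((1 + truncDist q R y z) ^ N * ‖k z‖) := by gcongr
        _ = (2 ^ N * N.factorial * Real.exp (1 / 2)) *
            (gaussianAt (c * q ^ 2) x z * Real.exp (q * ‖x - z‖)) *
            ((1 + truncDist q R y z) ^ N * ‖k z‖) := by ring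
        _ ≤ (2 ^ N * N.factorial * Real.exp (1 / 2)) *
            (Real.exp (1 / (2 * c)) * gaussianAt (c / 2 * q ^ 2) x z) *
            ((1 + truncDist q R y z) ^ N * ‖k z‖) := by gcongr
        _ = _ := by rw [hC₁]; ring
  refine hmain.trans ?_
  simp only [mul_assoc C₁]
  rw [integral_const_mul]
  have hH := integral_mul_norm_le (fun z => (gaussianAt_pos (c / 2 * q ^ 2) x z).le)
    (memLp_gaussianAt (by positivity) x) (U k)
  rw [hEx] at hH
  have hE0 : 0 ≤ E := Real.sqrt_nonneg _
  calc _ ≤ C₁ * (E * (polyBound n A c N * B * (A * Real.exp (1 / (2 * c)) * q ^ n * E))) := by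
        refine mul_le_mul_of_nonneg_left (hH.trans ?_) (by positivity)
        refine mul_le_mul_of_nonneg_left (hUk.trans ?_) hE0
        have hB0 := hI0.trans hB
        gcongr
    _ = C₁ * (polyBound n A c N * B) * (A * Real.exp (1 / (2 * c))) * (q ^ n * (E * E)) := by ring
    _ = _ := by rw [hEE, rowBound]

end Weighted

/-! ### The kernel of `T G T` and its gradient. -/

section CompositeKernel

variable {n : ℕ}

theorem inner_toLp_eq {u : Rn n → ℂ} (hu : MemLp (fun z => star (u z)) 2) (f : L2 n) :
    inner ℂ (hu.toLp _) f = ∫ z, u z * f z := by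
  rw [L2.inner_def]
  refine integral_congr_ae ?_
  filter_upwards [hu.coeFn_toLp] with z hz
  rw [hz, RCLike.inner_apply, mul_comm]
  simp

theorem inner_toLp_eq' {u : Rn n → ℂ} (hu : MemLp u 2) (f : L2 n) :
    inner ℂ f (hu.toLp _) = ∫ z, star (f z) * u z := by
  rw [L2.inner_def]
  refine integral_congr_ae ?_
  filter_upwards [hu.coeFn_toLp] with z hz
  rw [hz, RCLike.inner_apply, mul_comm]
  rfl

theorem measurable_of_hasSum {α ι : Type*} [MeasurableSpace α] [Countable ι] {f : ι → α → ℂ}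
    {g : α → ℂ} (hf : ∀ i, Measurable (f i)) (hg : ∀ a, HasSum (fun i => f i a) (g a)) :
    Measurable g := by
  refine measurable_of_tendsto_metrizable' (f := fun (s : Finset ι) a => ∑ i ∈ s, f i a)
    Filter.atTop (fun s => Finset.measurable_sum s fun i _ => hf i) ?_
  rw [tendsto_pi_nhds]
  exact hg

/-- Orthonormal vectors have distance `√2`, so the balls of radius `1/2` about them are disjoint,
and a separable space has only countably many disjoint nonempty open sets. -/
theorem countable_of_orthonormal {𝓗 ι : Type*} [NormedAddCommGroup 𝓗] [InnerProductSpace ℂ 𝓗]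
    [TopologicalSpace.SeparableSpace 𝓗] {b : ι → 𝓗} (hb : Orthonormal ℂ b) : Countable ι := by
  have h : (Set.univ : Set ι).PairwiseDisjoint fun i => Metric.ball (b i) (1 / 2) := by
    intro i _ j _ hij
    refine Metric.ball_disjoint_ball ?_
    have h1 := norm_sub_sq (𝕜 := ℂ) (b i) (b j)
    rw [hb.2 hij, hb.1 i, hb.1 j] at h1
    simp at h1
    rw [dist_eq_norm]
    nlinarith [norm_nonneg (b i - b j)]
  have := h.countable_of_isOpen (fun i _ => Metric.isOpen_ball)
    fun i _ => ⟨b i, Metric.mem_ball_self (by norm_num)⟩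
  exact Set.countable_univ_iff.1 this

namespace GaussianKernel

variable {A c q : ℝ} {p : Rn n → Rn n → ℂ}

theorem memLp_star_left (h : GaussianKernel A c q p) (x : Rn n) :
    MemLp (fun z => star (p x z)) 2 := (h.memLp_left x).star

/-- `G p(·, y)`. -/
def column (h : GaussianKernel A c q p) (G : L2 n →L[ℂ] L2 n) (y : Rn n) : L2 n :=
  G ((h.memLp_right y).toLp _)

/-- The kernel of `T G T`, where `T` is the operator with kernel `p`. -/
def composite (h : GaussianKernel A c q p) (G : L2 n →L[ℂ] L2 n) (x y : Rn n) : ℂ :=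
  ∫ z, p x z * h.column G y z

theorem composite_eq_inner (h : GaussianKernel A c q p) (G : L2 n →L[ℂ] L2 n) (x y : Rn n) :
    h.composite G x y = inner ℂ ((h.memLp_star_left x).toLp _) (G ((h.memLp_right y).toLp _)) := by
  rw [inner_toLp_eq]; rfl

/-- Moving `G` to the left factor exhibits the dependence on `y` through an ordinary integral of
`p(z, y)`, to which Fubini applies. -/
theorem composite_eq_integral (h : GaussianKernel A c q p) (G : L2 n →L[ℂ] L2 n) (x y : Rn n) :
    h.composite G x y
      = ∫ z, star (star G ((h.memLp_star_left x).toLp _) z) * p z y := by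
  rw [composite_eq_inner, ← inner_toLp_eq' (h.memLp_right y), ContinuousLinearMap.star_eq_adjoint,
    ContinuousLinearMap.adjoint_inner_left]

/-- `G` acts on classes in `L²`, so joint measurability cannot be read off the definition. Expanding
the inner product in a Hilbert basis gives a countable sum of products of a function of `x` and a
function of `y`, each an integral with a measurable parameter. -/
theorem measurable_composite (h : GaussianKernel A c q p) (G : L2 n →L[ℂ] L2 n) :
    Measurable (Function.uncurry (h.composite G)) := by
  obtain ⟨w, b, -⟩ := exists_hilbertBasis ℂ (L2 n)
  have : Fact ((2 : ENNReal) ≠ ⊤) := ⟨ENNReal.ofNat_ne_top⟩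
  have hw : Countable w := countable_of_orthonormal b.orthonormal
  refine measurable_of_hasSum
    (f := fun (i : w) (a : Rn n × Rn n) => (∫ z, p a.1 z * b i z) *
      ∫ z, star (star G (b i) z) * p z a.2) (fun i => ?_) fun a => ?_
  · refine Measurable.mul ?_ ?_
    · have hm : StronglyMeasurable fun t : Rn n × Rn n => p t.1 t.2 * b i t.2 :=
        h.meas.stronglyMeasurable.mul
          ((Lp.stronglyMeasurable (b i)).comp_measurable measurable_snd)
      exact hm.integral_prod_right'.measurable.comp measurable_fst
    · have hm : StronglyMeasurable fun t : Rn n × Rn n => star (star G (b i) t.1) * p t.1 t.2 :=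
        ((Lp.stronglyMeasurable (star G (b i))).comp_measurable measurable_fst).star.mul
          h.meas.stronglyMeasurable
      exact hm.integral_prod_left'.measurable.comp measurable_snd
  · have hs := b.hasSum_inner_mul_inner ((h.memLp_star_left a.1).toLp _)
      (G ((h.memLp_right a.2).toLp _))
    rw [← h.composite_eq_inner] at hs
    refine hs.congr_fun fun i => ?_
    rw [inner_toLp_eq, ← ContinuousLinearMap.adjoint_inner_left,
      ← ContinuousLinearMap.star_eq_adjoint, inner_toLp_eq']

/-- With `u = G* p̄(x, ·)` in `L²`, Fubini applies to `ū(z) p(z,y) f(y)`. One order of integration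
gives the integral against the kernel, the other `⟨u, T f⟩ = (T G T f)(x)`. -/
theorem isIntegralKernel_composite (h : GaussianKernel A c q p) {T : L2 n →L[ℂ] L2 n}
    (hT : IsIntegralKernel T p) (G : L2 n →L[ℂ] L2 n) :
    IsIntegralKernel (T * G * T) (h.composite G) := by
  refine ⟨h.measurable_composite G, fun f => ?_⟩
  filter_upwards [hT.2 (G (T f))] with x hx
  set u : L2 n := star G ((h.memLp_star_left x).toLp _) with hu
  have hus : MemLp (fun z => star (u z)) 2 := (Lp.memLp u).star
  have e : ∀ y, h.composite G x y * f y = ∫ z, star (u z) * (p z y * f y) := by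
    intro y
    rw [composite_eq_integral, ← integral_mul_const]
    simp only [mul_assoc, hu]
  have hi := h.isDominated.integrable_prod hus (Lp.memLp f)
  refine ⟨?_, ?_⟩
  · simp only [e]
    exact hi.integral_prod_right
  · simp only [e]
    rw [← integral_integral_swap hi]
    change (T (G (T f))) x = _
    rw [hx.2, ← inner_toLp_eq (h.memLp_star_left x), ← ContinuousLinearMap.adjoint_inner_left,
      ← ContinuousLinearMap.star_eq_adjoint, ← hu, L2.inner_def]
    refine integral_congr_ae ?_
    filter_upwards [hT.2 f] with z hz
    rw [RCLike.inner_apply, hz.2, integral_const_mul, mul_comm]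
    rfl

theorem integrable_gaussianAt_mul_norm {b : ℝ} (hb : 0 < b) (x : Rn n) (k : L2 n) :
    Integrable fun z => gaussianAt b x z * ‖k z‖ :=
  (memLp_gaussianAt hb x).integrable_mul (Lp.memLp k).norm

theorem norm_composite_le (h : GaussianKernel A c q p) (G : L2 n →L[ℂ] L2 n) (x y : Rn n) :
    ‖h.composite G x y‖
      ≤ A * q ^ n * ∫ z, gaussianAt (c * q ^ 2) x z * ‖h.column G y z‖ := by
  have hb : 0 < c * q ^ 2 := mul_pos h.c_pos (pow_pos h.q_pos 2)
  rw [← integral_const_mul]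
  refine norm_integral_le_of_norm_le
    ((integrable_gaussianAt_mul_norm hb x _).const_mul _) (.of_forall fun z => ?_)
  rw [norm_mul, ← mul_assoc]
  gcongr
  exact h.le x z

end GaussianKernel

/-- Directional derivatives are limits of difference quotients that are measurable in `z`, and the
derivative is a finite combination of those along a basis. -/
theorem measurable_fderiv_left {p : Rn n → Rn n → ℂ} (hp : Measurable (Function.uncurry p))
    (hd : ∀ z, Differentiable ℝ fun x => p x z) (x : Rn n) :
    Measurable fun z => fderiv ℝ (fun x' => p x' z) x := by
  have h1 : ∀ v : Rn n, Measurable fun z => fderiv ℝ (fun x' => p x' z) x v := by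
    intro v
    have hlim : ∀ z, Filter.Tendsto (fun m : ℕ => (m : ℝ) • (p (x + (m : ℝ)⁻¹ • v) z - p x z))
        Filter.atTop (nhds (fderiv ℝ (fun x' => p x' z) x v)) := by
      intro z
      refine (hd z x).hasFDerivAt.lim v (c := fun m : ℕ => (m : ℝ)) ?_
      simpa using tendsto_natCast_atTop_atTop
    refine measurable_of_tendsto_metrizable
      (f := fun (m : ℕ) z => (m : ℝ) • (p (x + (m : ℝ)⁻¹ • v) z - p x z)) (fun m => ?_)
      (tendsto_pi_nhds.2 hlim)
    have hx : ∀ a, Measurable fun z => p a z := fun a => hp.comp measurable_prodMk_left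
    exact ((hx _).sub (hx _)).const_smul (m : ℝ)
  have e : ∀ z, fderiv ℝ (fun x' => p x' z) x = ∑ i,
      (EuclideanSpace.proj i : Rn n →L[ℝ] ℝ).smulRight
        (fderiv ℝ (fun x' => p x' z) x (EuclideanSpace.basisFun (Fin n) ℝ i)) := by
    intro z
    refine ContinuousLinearMap.ext fun v => ?_
    conv_lhs => rw [← (EuclideanSpace.basisFun (Fin n) ℝ).sum_repr v]
    rw [map_sum, sum_apply]
    refine Finset.sum_congr rfl fun i _ => ?_
    rw [map_smul]
    rfl
  rw [funext e]
  refine Finset.measurable_sum _ fun i _ => ?_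
  have hc : Continuous fun a : ℂ => (EuclideanSpace.proj i : Rn n →L[ℝ] ℝ).smulRight a :=
    (ContinuousLinearMap.smulRightL ℝ (Rn n) ℂ (EuclideanSpace.proj i)).continuous
  exact hc.measurable.comp (h1 _)

/-- Supplies a majorant uniform for `x` in a ball, for differentiation under the integral. The
argument is `|x₀ - z|² ≤ 2 + 2|x - z|²`. -/
theorem gaussianAt_le_of_dist_le_one {b : ℝ} (hb : 0 < b) {x x₀ : Rn n} (hx : dist x x₀ ≤ 1)
    (z : Rn n) : gaussianAt b x z ≤ Real.exp b * gaussianAt (b / 2) x₀ z := by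
  rw [gaussianAt, gaussianAt, ← Real.exp_add]
  refine Real.exp_le_exp.2 ?_
  have h1 : ‖x₀ - z‖ ≤ ‖x₀ - x‖ + ‖x - z‖ := norm_sub_le_norm_sub_add_norm_sub _ _ _
  rw [dist_comm, dist_eq_norm] at hx
  have h2 : ‖x₀ - z‖ ≤ 1 + ‖x - z‖ := h1.trans (by linarith)
  have h3 : ‖x₀ - z‖ ^ 2 ≤ 2 + 2 * ‖x - z‖ ^ 2 := by
    nlinarith [norm_nonneg (x₀ - z), norm_nonneg (x - z), sq_nonneg (‖x - z‖ - 1)]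
  nlinarith

/-- Differentiation of `x ↦ ∫ p(x, z) k(z) dz` for a kernel with Gaussian gradient bounds. -/
theorem GaussianKernel.hasFDerivAt_integral_mul {A c q : ℝ} {p : Rn n → Rn n → ℂ}
    (h : GaussianKernel A c q p) (hd : ∀ z, Differentiable ℝ fun x => p x z) {A₁ : ℝ}
    (hA₁ : ∀ x z, ‖fderiv ℝ (fun x' => p x' z) x‖ ≤ A₁ * gaussianAt (c * q ^ 2) x z)
    (k : L2 n) (x : Rn n) :
    HasFDerivAt (fun x => ∫ z, p x z * k z) (∫ z, k z • fderiv ℝ (fun x' => p x' z) x) x ∧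
      ‖∫ z, k z • fderiv ℝ (fun x' => p x' z) x‖
        ≤ A₁ * ∫ z, gaussianAt (c * q ^ 2) x z * ‖k z‖ := by
  have hb : 0 < c * q ^ 2 := mul_pos h.c_pos (pow_pos h.q_pos 2)
  have hA₁0 : 0 ≤ A₁ := by
    by_contra hneg
    have h1 := (norm_nonneg _).trans (hA₁ x x)
    have h2 := mul_neg_of_neg_of_pos (not_le.1 hneg) (gaussianAt_pos (c * q ^ 2) x x)
    linarith
  have hkm : AEStronglyMeasurable (fun z => k z) volume := Lp.aestronglyMeasurable k
  refine ⟨?_, ?_⟩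
  · refine hasFDerivAt_integral_of_dominated_of_fderiv_le (𝕜 := ℝ)
      (F' := fun x z => k z • fderiv ℝ (fun x' => p x' z) x)
      (bound := fun z => A₁ * Real.exp (c * q ^ 2) * (gaussianAt (c * q ^ 2 / 2) x z * ‖k z‖))
      (Metric.ball_mem_nhds x one_pos) ?_ ?_ ?_ ?_ ?_ ?_
    · exact .of_forall fun x' =>
        (h.isDominated.measurable_left x').aestronglyMeasurable.mul hkm
    · exact (h.memLp_left x).integrable_mul (Lp.memLp k)
    · exact hkm.smul (measurable_fderiv_left h.meas hd x).aestronglyMeasurable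
    · refine .of_forall fun z x' hx' => ?_
      rw [norm_smul, mul_comm]
      calc _ ≤ (A₁ * (Real.exp (c * q ^ 2) * gaussianAt (c * q ^ 2 / 2) x z)) * ‖k z‖ := by
            gcongr
            refine (hA₁ x' z).trans ?_
            gcongr
            exact gaussianAt_le_of_dist_le_one hb (Metric.mem_ball.1 hx').le z
        _ = _ := by ring
    · exact (GaussianKernel.integrable_gaussianAt_mul_norm (half_pos hb) x k).const_mul _
    · refine .of_forall fun z x' _ => ?_
      have := ((hd z) x').hasFDerivAt.mul_const (k z)
      exact this
  · rw [← integral_const_mul]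
    refine norm_integral_le_of_norm_le
      ((GaussianKernel.integrable_gaussianAt_mul_norm hb x k).const_mul _)
      (.of_forall fun z => ?_)
    rw [norm_smul, mul_comm, ← mul_assoc]
    gcongr
    exact hA₁ x z

end CompositeKernel

/-! ### The symbol in the variable `u = e^{-tλ}` and its Fourier transform. -/

section Symbols

open scoped FourierTransform

/-- Smooth functions supported in `1/4 ≤ |l| ≤ 1` with bounds that are uniform in `j`. -/
structure UniformBump (Φ : ℤ → ℝ → ℂ) : Prop where
  smooth : ∀ j, ContDiff ℝ ∞ (Φ j)
  supp : ∀ j l, Φ j l ≠ 0 → 1 / 4 ≤ |l| ∧ |l| ≤ 1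
  bound : ∀ k : ℕ, ∃ C : ℝ, ∀ j l, ‖iteratedDeriv k (Φ j) l‖ ≤ C

/-- `u ↦ Φ(-log u) u⁻ᵐ`. -/
def logPull (m : ℕ) (Φ : ℝ → ℂ) (u : ℝ) : ℂ := ((u ^ m)⁻¹ : ℝ) • Φ (-Real.log u)

/-- The bump whose `logPull` is the derivative of the `logPull` of `Φ`. -/
def logDeriv' (m : ℕ) (Φ : ℤ → ℝ → ℂ) (j : ℤ) (l : ℝ) : ℂ := -(deriv (Φ j) l + (m : ℂ) * Φ j l)

/-- Differentiating `Φ(-log u) u^{-m}` gives `-(Φ' + mΦ)(-log u) u^{-m-1}`. Uniform bumps are stable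
under this operation, so all derivatives of `logPull` keep bounds uniform in `j`. -/
theorem UniformBump.logDeriv' {Φ : ℤ → ℝ → ℂ} (h : UniformBump Φ) (m : ℕ) :
    UniformBump (logDeriv' m Φ) where
  smooth j := by
    have h1 : ContDiff ℝ ∞ (deriv (Φ j)) := (contDiff_infty_iff_deriv.1 (h.smooth j)).2
    exact (h1.add (contDiff_const.mul (h.smooth j))).neg
  supp j l hl := by
    have hs : tsupport (Φ j) ⊆ {l | 1 / 4 ≤ |l| ∧ |l| ≤ 1} := by
      refine closure_minimal (fun l hl => h.supp j l hl) ?_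
      exact (isClosed_le continuous_const continuous_abs).inter
        (isClosed_le continuous_abs continuous_const)
    by_contra hne
    have h1 : l ∉ tsupport (Φ j) := fun hl => hne (hs hl)
    have h2 : Φ j l = 0 := image_eq_zero_of_notMem_tsupport h1
    have h3 : deriv (Φ j) l = 0 := by
      by_contra h4
      exact h1 (support_deriv_subset h4)
    exact hl (by simp [SchrodingerKernel.logDeriv', h2, h3])
  bound k := by
    obtain ⟨C₁, hC₁⟩ := h.bound (k + 1)
    obtain ⟨C₂, hC₂⟩ := h.bound k
    refine ⟨C₁ + m * C₂, fun j l => ?_⟩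
    have h1 : ContDiff ℝ ∞ (deriv (Φ j)) := (contDiff_infty_iff_deriv.1 (h.smooth j)).2
    have hk : ((k : ℕ∞) : WithTop ℕ∞) ≤ ∞ := by exact_mod_cast le_top
    have e : SchrodingerKernel.logDeriv' m Φ j = fun l => -(deriv (Φ j) l + (m : ℂ) * Φ j l) := rfl
    rw [e, iteratedDeriv_fun_neg, norm_neg, iteratedDeriv_fun_add
      ((h1.of_le hk).contDiffAt) ((contDiff_const.mul ((h.smooth j).of_le hk)).contDiffAt),
      iteratedDeriv_const_mul_field, ← iteratedDeriv_succ']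
    refine (norm_add_le _ _).trans (add_le_add (hC₁ j l) ?_)
    rw [norm_mul, Complex.norm_natCast]
    exact mul_le_mul_of_nonneg_left (hC₂ j l) (Nat.cast_nonneg m)

/-- `Real.log` is even, so `logPull` also lives on negative `u`, and the bounds concern `|u|`. The
point `u = 0` is excluded because `Real.log 0 = 0` and bumps vanish at `0`. -/
theorem UniformBump.logPull_supp {Φ : ℤ → ℝ → ℂ} (h : UniformBump Φ) {m : ℕ} {j : ℤ} {u : ℝ}
    (hu : logPull m (Φ j) u ≠ 0) : Real.exp (-1) ≤ |u| ∧ |u| ≤ Real.exp 1 := by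
  have h1 : Φ j (-Real.log u) ≠ 0 := fun h0 => hu (by rw [logPull, h0, smul_zero])
  have h2 := h.supp j _ h1
  rw [abs_neg] at h2
  have hu0 : u ≠ 0 := by
    rintro rfl
    rw [Real.log_zero, abs_zero] at h2
    linarith [h2.1]
  have h3 := abs_le.1 h2.2
  have hpos : 0 < |u| := abs_pos.2 hu0
  rw [← Real.log_abs] at h3
  rw [Real.le_log_iff_exp_le hpos, Real.log_le_iff_le_exp hpos] at h3
  exact h3

theorem UniformBump.hasDerivAt_logPull {Φ : ℤ → ℝ → ℂ} (h : UniformBump Φ) (m : ℕ) (j : ℤ)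
    (u : ℝ) : HasDerivAt (logPull m (Φ j)) (logPull (m + 1) (SchrodingerKernel.logDeriv' m Φ j) u)
      u := by
  have hexp : (0 : ℝ) < Real.exp (-1) := Real.exp_pos _
  -- Near `u = 0` both functions vanish identically; elsewhere the formula is the product and chain
  -- rule.
  by_cases hu : u = 0
  · subst hu
    have h1 : logPull (m + 1) (SchrodingerKernel.logDeriv' m Φ j) 0 = 0 := by
      by_contra hne
      have := ((h.logDeriv' m).logPull_supp hne).1
      rw [abs_zero] at this
      linarith
    rw [h1]
    refine (hasDerivAt_const (0 : ℝ) (0 : ℂ)).congr_of_eventuallyEq ?_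
    filter_upwards [Metric.ball_mem_nhds (0 : ℝ) hexp] with w hw
    by_contra hne
    have := (h.logPull_supp hne).1
    rw [Metric.mem_ball, dist_zero_right, Real.norm_eq_abs] at hw
    linarith
  · have h1 : HasDerivAt (fun u : ℝ => -Real.log u) (-u⁻¹) u := (Real.hasDerivAt_log hu).neg
    have hd : HasDerivAt (Φ j) (deriv (Φ j) (-Real.log u)) (-Real.log u) :=
      ((h.smooth j).differentiable (by simp) _).hasDerivAt
    have h2 := hd.scomp u h1
    have h3 : HasDerivAt (fun u : ℝ => (u ^ m)⁻¹) (-(m : ℝ) * (u ^ (m + 1))⁻¹) u := by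
      have := (hasDerivAt_pow m u).inv (pow_ne_zero m hu)
      refine this.congr_deriv ?_
      rcases m with _ | m
      · simp
      · simp only [Nat.add_sub_cancel]
        field_simp
        ring
    refine (h3.smul h2).congr_deriv ?_
    simp only [logPull, SchrodingerKernel.logDeriv', Complex.real_smul, Function.comp]
    push_cast
    have huc : (u : ℂ) ≠ 0 := Complex.ofReal_ne_zero.2 hu
    field_simp
    ring

/-- The successive derivatives of `logPull 2 Φ`. -/
def logDerivIter (Φ : ℤ → ℝ → ℂ) : ℕ → ℤ → ℝ → ℂ
  | 0 => Φ
  | k + 1 => logDeriv' (2 + k) (logDerivIter Φ k)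

theorem UniformBump.logDerivIter {Φ : ℤ → ℝ → ℂ} (h : UniformBump Φ) (k : ℕ) :
    UniformBump (logDerivIter Φ k) := by
  induction k with
  | zero => exact h
  | succ k ih => exact ih.logDeriv' _

theorem UniformBump.iteratedDeriv_logPull {Φ : ℤ → ℝ → ℂ} (h : UniformBump Φ) (k : ℕ) (j : ℤ) :
    iteratedDeriv k (logPull 2 (Φ j))
      = logPull (2 + k) (SchrodingerKernel.logDerivIter Φ k j) := by
  induction k with
  | zero => rw [iteratedDeriv_zero]; rfl
  | succ k ih =>
    rw [iteratedDeriv_succ, ih]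
    funext u
    exact ((h.logDerivIter k).hasDerivAt_logPull (2 + k) j u).deriv

theorem UniformBump.contDiff_logPull {Φ : ℤ → ℝ → ℂ} (h : UniformBump Φ) (j : ℤ) :
    ContDiff ℝ ∞ (logPull 2 (Φ j)) := by
  refine contDiff_of_differentiable_iteratedDeriv (n := ⊤) fun k _ => ?_
  rw [h.iteratedDeriv_logPull]
  exact fun u => ((h.logDerivIter k).hasDerivAt_logPull (2 + k) j u).differentiableAt

/-- On the support `|u|^{-m} ≤ e^m`, so a constant on `[-e, e]` is a common majorant for all `j`. -/
theorem UniformBump.exists_integral_logPull_le {Φ : ℤ → ℝ → ℂ} (h : UniformBump Φ) (m : ℕ) :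
    ∃ C, 0 ≤ C ∧ ∀ j, Integrable (logPull m (Φ j)) ∧ ∫ u, ‖logPull m (Φ j) u‖ ≤ C := by
  obtain ⟨B, hB⟩ := h.bound 0
  simp only [iteratedDeriv_zero] at hB
  have hB0 : 0 ≤ B := (norm_nonneg _).trans (hB 0 0)
  set S := Set.Icc (-Real.exp 1) (Real.exp 1) with hS
  have hbd : ∀ j u, ‖logPull m (Φ j) u‖ ≤ S.indicator (fun _ => Real.exp 1 ^ m * B) u := by
    intro j u
    by_cases h0 : logPull m (Φ j) u = 0
    · rw [h0, norm_zero]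
      exact Set.indicator_nonneg (fun _ _ => by positivity) _
    · obtain ⟨h1, h2⟩ := h.logPull_supp h0
      rw [Set.indicator_of_mem (show u ∈ S from abs_le.1 h2), logPull, norm_smul]
      refine mul_le_mul ?_ (hB _ _) (norm_nonneg _) (by positivity)
      rw [norm_inv, norm_pow, Real.norm_eq_abs, ← inv_pow]
      gcongr
      rw [inv_le_comm₀ ((Real.exp_pos _).trans_le h1) (Real.exp_pos _), ← Real.exp_neg]
      exact h1
  have hi : Integrable (S.indicator fun _ : ℝ => Real.exp 1 ^ m * B) :=
    (integrable_indicator_iff measurableSet_Icc).2 (integrableOn_const (by simp))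
  refine ⟨∫ u, S.indicator (fun _ => Real.exp 1 ^ m * B) u,
    integral_nonneg fun u => Set.indicator_nonneg (fun _ _ => by positivity) _, fun j => ?_⟩
  have hint : Integrable (logPull m (Φ j)) := by
    refine hi.mono' ?_ (.of_forall (hbd j))
    have : Continuous (logPull m (Φ j)) :=
      continuous_iff_continuousAt.2 fun u => (h.hasDerivAt_logPull m j u).continuousAt
    exact this.aestronglyMeasurable
  exact ⟨hint, integral_mono hint.norm hi (hbd j)⟩

/-- The Fourier transform is bounded by the `L¹` norm of the function, and `|2πs|^N` times it by
that of the `N`-th derivative. Both norms are bounded uniformly in `j`. -/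
theorem UniformBump.exists_fourier_bound {Φ : ℤ → ℝ → ℂ} (h : UniformBump Φ) (N : ℕ) :
    ∃ C, 0 ≤ C ∧ ∀ j (s : ℝ),
      ‖𝓕 (logPull 2 (Φ j)) s‖ * (1 + |2 * Real.pi * s|) ^ N ≤ C := by
  obtain ⟨C₀, hC₀, h₀⟩ := h.exists_integral_logPull_le 2
  obtain ⟨C₁, hC₁, h₁⟩ := (h.logDerivIter N).exists_integral_logPull_le (2 + N)
  refine ⟨2 ^ N * (C₀ + C₁), by positivity, fun j s => ?_⟩
  have hF : ∀ f : ℝ → ℂ, ‖𝓕 f s‖ ≤ ∫ u, ‖f u‖ := fun f =>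
    VectorFourier.norm_fourierIntegral_le_integral_norm _ _ _ _ _
  have e1 := (hF (logPull 2 (Φ j))).trans (h₀ j).2
  have e2 := (hF (iteratedDeriv N (logPull 2 (Φ j)))).trans
    ((le_of_eq (by rw [h.iteratedDeriv_logPull])).trans (h₁ j).2)
  have hint : ∀ k : ℕ, ((k : ℕ∞) : ℕ∞) ≤ (⊤ : ℕ∞) →
      Integrable (iteratedDeriv k (logPull 2 (Φ j))) := fun k _ => by
    rw [h.iteratedDeriv_logPull]
    obtain ⟨_, _, h'⟩ := (h.logDerivIter k).exists_integral_logPull_le (2 + k)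
    exact (h' j).1
  rw [Real.fourier_iteratedDeriv (N := ⊤) (h.contDiff_logPull j) hint le_top] at e2
  simp only [norm_smul, norm_pow, norm_mul, Complex.norm_real, Complex.norm_I, mul_one,
    Complex.norm_ofNat, Real.norm_eq_abs] at e2
  have e3 : |2 * Real.pi * s| ^ N * ‖𝓕 (logPull 2 (Φ j)) s‖ ≤ C₁ := by
    refine le_trans (le_of_eq ?_) e2
    rw [abs_mul, abs_mul, abs_of_nonneg (zero_le_two (α := ℝ))]
  set r := |2 * Real.pi * s|
  have hr : 0 ≤ r := abs_nonneg _
  have h2 : (1 + r) ^ N ≤ 2 ^ N * (1 + r ^ N) := by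
    have h3 : 1 + r ≤ 2 * max 1 r := by linarith [le_max_left 1 r, le_max_right 1 r]
    calc (1 + r) ^ N ≤ (2 * max 1 r) ^ N := by gcongr
      _ = 2 ^ N * (max 1 r) ^ N := mul_pow _ _ _
      _ ≤ _ := by
        gcongr
        rcases le_total 1 r with h | h
        · rw [max_eq_right h]; linarith
        · rw [max_eq_left h, one_pow]
          linarith [pow_nonneg hr N]
  calc _ ≤ ‖𝓕 (logPull 2 (Φ j)) s‖ * (2 ^ N * (1 + r ^ N)) := by gcongr
    _ = 2 ^ N * (‖𝓕 (logPull 2 (Φ j)) s‖ + r ^ N * ‖𝓕 (logPull 2 (Φ j)) s‖) := by ring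
    _ ≤ _ := by gcongr

theorem continuous_fourier_real {f : ℝ → ℂ} (hf : Integrable f) : Continuous (𝓕 f) :=
  VectorFourier.fourierIntegral_continuous Real.continuous_fourierChar
    (innerSL ℝ).continuous₂ hf

theorem UniformBump.exists_weighted_integral_le {Φ : ℤ → ℝ → ℂ} (h : UniformBump Φ) (N : ℕ) :
    ∃ B, ∀ j, Integrable (fun s => ‖𝓕 (logPull 2 (Φ j)) s‖ * (1 + |2 * Real.pi * s|) ^ N) ∧
      ∫ s, ‖𝓕 (logPull 2 (Φ j)) s‖ * (1 + |2 * Real.pi * s|) ^ N ≤ B := by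
  -- The two extra powers leave the integrable factor `(1 + s²)⁻¹`.
  obtain ⟨C, hC, hb⟩ := h.exists_fourier_bound (N + 2)
  refine ⟨∫ s : ℝ, C * (1 + s ^ 2)⁻¹, fun j => ?_⟩
  have hi : Integrable fun s : ℝ => C * (1 + s ^ 2)⁻¹ := integrable_inv_one_add_sq.const_mul C
  have hle : ∀ s, ‖𝓕 (logPull 2 (Φ j)) s‖ * (1 + |2 * Real.pi * s|) ^ N
      ≤ C * (1 + s ^ 2)⁻¹ := by
    intro s
    rw [← div_eq_mul_inv, le_div_iff₀ (by positivity)]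
    refine le_trans ?_ (hb j s)
    rw [pow_add, ← mul_assoc]
    gcongr
    have h1 : |s| ≤ |2 * Real.pi * s| := by
      rw [abs_mul]
      refine le_mul_of_one_le_left (abs_nonneg _) ?_
      rw [abs_of_pos (by positivity)]
      nlinarith [Real.pi_gt_three]
    nlinarith [sq_abs s, abs_nonneg s]
  have hint : Integrable (logPull 2 (Φ j)) := by
    obtain ⟨_, _, h'⟩ := h.exists_integral_logPull_le 2
    exact (h' j).1
  have hm : Integrable fun s => ‖𝓕 (logPull 2 (Φ j)) s‖ * (1 + |2 * Real.pi * s|) ^ N := by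
    refine hi.mono' ?_ (.of_forall fun s => ?_)
    · have := continuous_fourier_real hint
      exact Continuous.aestronglyMeasurable (by fun_prop)
    · rw [Real.norm_of_nonneg (by positivity)]
      exact hle s
  exact ⟨hm, integral_mono hm hi hle⟩

theorem UniformBump.fourier_inversion {Φ : ℤ → ℝ → ℂ} (h : UniformBump Φ) (j : ℤ) :
    Integrable (𝓕 (logPull 2 (Φ j))) ∧ ∀ u : ℝ, logPull 2 (Φ j) u
      = ∫ s, 𝓕 (logPull 2 (Φ j)) s * Complex.exp ((2 * Real.pi * s : ℝ) * Complex.I * u) := by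
  have hint : Integrable (logPull 2 (Φ j)) := by
    obtain ⟨_, _, h'⟩ := h.exists_integral_logPull_le 2
    exact (h' j).1
  have hF : Integrable (𝓕 (logPull 2 (Φ j))) := by
    obtain ⟨_, h'⟩ := h.exists_weighted_integral_le 0
    have := (h' j).1
    simp only [pow_zero, mul_one] at this
    exact (integrable_norm_iff (continuous_fourier_real hint).aestronglyMeasurable).1 this
  refine ⟨hF, fun u => ?_⟩
  have h1 := congrFun ((h.contDiff_logPull j).continuous.fourierInv_fourier_eq hint hF) u
  rw [Real.fourierInv_eq'] at h1
  rw [← h1]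
  refine integral_congr_ae (.of_forall fun s => ?_)
  simp only [smul_eq_mul, RCLike.inner_apply, conj_trivial]
  rw [mul_comm]
  congr 2
  push_cast
  ring

/-- The rescaled functions `l ↦ φ_j(2ʲ l)`. -/
theorem IsDyadicSystem.uniformBump {φ : ℤ → ℝ → ℂ} (h : IsDyadicSystem φ) :
    UniformBump fun j l => φ j ((2 : ℝ) ^ j * l) where
  smooth j := (h.smooth j).comp (contDiff_const.mul contDiff_id)
  supp j l hl := by
    have h1 := h.supp j (subset_tsupport _ hl)
    have h2 : (0 : ℝ) < 2 ^ j := by positivity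
    simp only [Set.mem_ofPred_eq, abs_mul, abs_of_pos h2] at h1
    refine ⟨?_, ?_⟩
    · have h3 : (2 : ℝ) ^ (j - 2) = 2 ^ j * (1 / 4) := by
        rw [zpow_sub₀ two_ne_zero]
        norm_num
        ring
      rw [h3] at h1
      exact le_of_mul_le_mul_left h1.1 h2
    · exact le_of_mul_le_mul_left (by simpa using h1.2) h2
  bound k := by
    obtain ⟨C, hC⟩ := h.bound k
    refine ⟨C, fun j l => ?_⟩
    have hk : ((k : ℕ∞) : WithTop ℕ∞) ≤ ∞ := by exact_mod_cast le_top
    have h2 : (0 : ℝ) < 2 ^ j := by positivity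
    have e := congrFun (iteratedDeriv_comp_const_smul (n := k) ((h.smooth j).of_le hk)
      ((2 : ℝ) ^ j)) l
    refine (le_of_eq (congrArg norm e)).trans ?_
    rw [norm_smul, norm_pow, Real.norm_of_nonneg h2.le]
    calc ((2 : ℝ) ^ j) ^ k * ‖iteratedDeriv k (φ j) ((2 : ℝ) ^ j * l)‖
        ≤ ((2 : ℝ) ^ j) ^ k * (C * (2 : ℝ) ^ (-((k : ℤ) * j))) := by
          gcongr
          exact hC _ _
      _ = C := by
        rw [mul_left_comm, ← zpow_natCast, ← zpow_mul, ← zpow_add₀ two_ne_zero, mul_comm j]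
        simp

/-- For `u = e^{-2^{-j} l}` one has `-log u = 2^{-j} l`, and the factor `u^{-2}` in `logPull 2` is
cancelled by the two outer `u`. These become the two heat operators around `G`. -/
theorem dyadic_eq_logPull (φ : ℤ → ℝ → ℂ) (j : ℤ) (l : ℝ) :
    φ j l = (Real.exp (-(2 : ℝ) ^ (-j) * l) : ℂ) *
      logPull 2 (fun l => φ j ((2 : ℝ) ^ j * l)) (Real.exp (-(2 : ℝ) ^ (-j) * l)) *
      (Real.exp (-(2 : ℝ) ^ (-j) * l) : ℂ) := by
  have h1 : (2 : ℝ) ^ j * -(-(2 : ℝ) ^ (-j) * l) = l := by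
    rw [neg_mul, neg_neg, ← mul_assoc, ← zpow_add₀ two_ne_zero]
    simp
  have h2 : (Real.exp (-(2 : ℝ) ^ (-j) * l) : ℂ) ≠ 0 :=
    Complex.ofReal_ne_zero.2 (Real.exp_pos _).ne'
  rw [logPull, Real.log_exp, h1, Complex.real_smul]
  push_cast at h2 ⊢
  field_simp

end Symbols

/-! ### A Gaussian gradient bound implies a Gaussian bound for the kernel. -/

section GradientBound

open Filter Topology

variable {n : ℕ}

/-- On a ray leading away from `y`, `|x + se - y|² ≥ |x - y|² + s²`, so the Gaussian at the starting
point factors out of the gradient bound. The rest is integrated with `e^{-κs²} ≤ e^{1/4} e^{-√κ s}`,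
which gives `e^{1/4} / √κ ≤ 2 / √κ`. -/
theorem norm_sub_le_of_ray {f : Rn n → ℂ} (hf : Differentiable ℝ f) {B κ : ℝ} (hκ : 0 < κ)
    {y : Rn n} (hb : ∀ x, ‖fderiv ℝ f x‖ ≤ B * gaussianAt κ x y) {e : Rn n} (he : ‖e‖ = 1)
    {x : Rn n} (hx : 0 ≤ inner ℝ (x - y) e) {s : ℝ} (hs : 0 ≤ s) :
    ‖f (x + s • e) - f x‖ ≤ 2 * B / Real.sqrt κ * gaussianAt κ x y := by
  have hB0 : 0 ≤ B := by
    by_contra hneg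
    have h1 := (norm_nonneg _).trans (hb x)
    have h2 := mul_neg_of_neg_of_pos (not_le.1 hneg) (gaussianAt_pos κ x y)
    linarith
  have hr : 0 < Real.sqrt κ := Real.sqrt_pos.2 hκ
  have hr2 : Real.sqrt κ ^ 2 = κ := Real.sq_sqrt hκ.le
  set r := Real.sqrt κ
  set D := B * gaussianAt κ x y with hD
  have hD0 : 0 ≤ D := mul_nonneg hB0 (gaussianAt_pos _ _ _).le
  have hder : ∀ s : ℝ, HasDerivAt (fun s : ℝ => f (x + s • e) - f x)
      (fderiv ℝ f (x + s • e) e) s := by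
    intro s
    have h1 : HasDerivAt (fun s : ℝ => x + s • e) e s := by
      simpa using ((hasDerivAt_id s).smul_const e).const_add x
    exact ((hf _).hasFDerivAt.comp_hasDerivAt s h1).sub_const _
  have key := image_norm_le_of_norm_deriv_right_le_deriv_boundary (a := 0) (b := s)
    (f := fun s : ℝ => f (x + s • e) - f x) (f' := fun s => fderiv ℝ f (x + s • e) e)
    (B := fun s => D * Real.exp (1 / 4) / r * (1 - Real.exp (-(r * s))))
    (B' := fun s => D * Real.exp (1 / 4) * Real.exp (-(r * s)))
    (fun s _ => (hder s).continuousAt.continuousWithinAt)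
    (fun s _ => (hder s).hasDerivWithinAt) (by simp) ?_ ?_ ⟨hs, le_rfl⟩
  · refine key.trans ?_
    have h1 : Real.exp (1 / 4) ≤ 2 := by
      have h2 := Real.exp_one_lt_d9
      have h3 : Real.exp (1 / 4) ^ 4 = Real.exp 1 := by
        rw [← Real.exp_nat_mul]; norm_num
      by_contra h4
      have : (2 : ℝ) ^ 4 ≤ Real.exp (1 / 4) ^ 4 := by gcongr; exact (not_le.1 h4).le
      rw [h3] at this
      linarith
    have h5 : 1 - Real.exp (-(r * s)) ≤ 1 := by linarith [Real.exp_pos (-(r * s))]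
    calc D * Real.exp (1 / 4) / r * (1 - Real.exp (-(r * s))) ≤ D * Real.exp (1 / 4) / r * 1 := by
          gcongr
      _ ≤ D * 2 / r := by rw [mul_one]; gcongr
      _ = _ := by rw [hD]; ring
  · intro s
    have h1 : HasDerivAt (fun s : ℝ => Real.exp (-(r * s))) (Real.exp (-(r * s)) * (-r)) s := by
      have : HasDerivAt (fun s : ℝ => -(r * s)) (-r) s := by
        simpa [neg_mul] using (hasDerivAt_id s).const_mul (-r)
      exact this.exp
    refine ((h1.const_sub 1).const_mul (D * Real.exp (1 / 4) / r)).congr_deriv ?_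
    field_simp
  · intro s hs
    have h1 : ‖fderiv ℝ f (x + s • e) e‖ ≤ B * gaussianAt κ (x + s • e) y := by
      refine ((fderiv ℝ f (x + s • e)).le_opNorm e).trans ?_
      rw [he, mul_one]
      exact hb _
    refine h1.trans ?_
    rw [hD, mul_assoc B, mul_assoc B]
    refine mul_le_mul_of_nonneg_left ?_ hB0
    simp only [gaussianAt, ← Real.exp_add]
    refine Real.exp_le_exp.2 ?_
    have h2 : ‖x + s • e - y‖ ^ 2 = ‖x - y‖ ^ 2 + 2 * (s * inner ℝ (x - y) e) + s ^ 2 := by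
      rw [add_sub_right_comm, norm_add_sq_real, norm_smul, he, inner_smul_right, mul_one,
        Real.norm_eq_abs, sq_abs]
    rw [h2, ← hr2]
    have h3 := mul_nonneg hs.1 hx
    nlinarith [sq_nonneg (r * s - 1 / 2), mul_nonneg (sq_nonneg r) h3]

/-- The mean value inequality on the ball of radius `r` about `m • e`, whose points have distance at
least `m - r - ‖y‖` from `y`. -/
theorem norm_sub_le_near {f : Rn n → ℂ} (hf : Differentiable ℝ f) {B κ : ℝ} (hκ : 0 < κ)
    (hB : 0 ≤ B)
    {y : Rn n} (hb : ∀ x, ‖fderiv ℝ f x‖ ≤ B * gaussianAt κ x y) {e : Rn n} (he : ‖e‖ = 1)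
    {x : Rn n} {m r : ℝ} (hx : ‖x - m • e‖ ≤ r) (hm : ‖y‖ + r ≤ m) :
    ‖f x - f (m • e)‖ ≤ B * Real.exp (-κ * (m - r - ‖y‖) ^ 2) * r := by
  have hr : 0 ≤ r := (norm_nonneg _).trans hx
  have hm0 : 0 ≤ m := by linarith [norm_nonneg y]
  have h := (convex_closedBall (m • e) r).norm_image_sub_le_of_norm_fderiv_le (𝕜 := ℝ) (f := f)
    (C := B * Real.exp (-κ * (m - r - ‖y‖) ^ 2)) (fun z _ => hf z) (fun z hz => ?_)
    (Metric.mem_closedBall_self hr) (show x ∈ _ by rwa [Metric.mem_closedBall, dist_eq_norm])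
  · refine h.trans ?_
    gcongr
  · refine (hb z).trans ?_
    rw [gaussianAt]
    gcongr B * Real.exp ?_
    rw [Metric.mem_closedBall, dist_eq_norm] at hz
    have h1 : ‖m • e‖ = m := by rw [norm_smul, he, mul_one, Real.norm_of_nonneg hm0]
    have h2 : ‖m • e‖ ≤ ‖m • e - z‖ + ‖z - y‖ + ‖y‖ := by
      have := norm_add₃_le (a := m • e - z) (b := z - y) (c := y)
      simpa using this
    rw [norm_sub_rev] at hz
    have h3 : m - r - ‖y‖ ≤ ‖z - y‖ := by linarith
    have h4 : 0 ≤ m - r - ‖y‖ := by linarith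
    have h5 : (m - r - ‖y‖) ^ 2 ≤ ‖z - y‖ ^ 2 := by gcongr
    nlinarith

theorem tendsto_gaussian_shift {κ : ℝ} (hκ : 0 < κ) (a : ℝ) :
    Tendsto (fun m : ℕ => Real.exp (-κ * ((m : ℝ) - a) ^ 2)) atTop (𝓝 0) := by
  refine Real.tendsto_exp_atBot.comp ?_
  have h1 : Tendsto (fun m : ℕ => ((m : ℝ) - a)) atTop atTop :=
    tendsto_atTop_add_const_right _ _ tendsto_natCast_atTop_atTop
  exact ((tendsto_pow_atTop two_ne_zero).comp h1).const_mul_atTop_of_neg (by linarith)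

/-- The balls leave every point eventually, and `‖F‖²` is an integrable majorant. -/
theorem integral_ball_tendsto_zero (F : L2 n) {e : Rn n} (he : ‖e‖ = 1) :
    Tendsto (fun m : ℕ => ∫ x in Metric.ball ((m : ℝ) • e) 1, ‖F x‖ ^ 2) atTop (𝓝 0) := by
  have h : ∀ m : ℕ, ∫ x in Metric.ball ((m : ℝ) • e) 1, ‖F x‖ ^ 2
      = ∫ x, (Metric.ball ((m : ℝ) • e) 1).indicator (fun x => ‖F x‖ ^ 2) x := fun m =>
    (integral_indicator measurableSet_ball).symm
  simp only [h]
  have hi := (Lp.memLp F).norm.integrable_sq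
  have := tendsto_integral_of_dominated_convergence (f := fun _ : Rn n => (0 : ℝ))
    (F := fun (m : ℕ) x => (Metric.ball ((m : ℝ) • e) 1).indicator (fun x => ‖F x‖ ^ 2) x)
    (fun x => ‖F x‖ ^ 2) (fun m => (hi.indicator measurableSet_ball).aestronglyMeasurable) hi
    (fun m => .of_forall fun x => ?_) (.of_forall fun x => ?_)
  · simpa using this
  · rw [Real.norm_of_nonneg (Set.indicator_nonneg (fun _ _ => by positivity) _)]
    exact Set.indicator_le_self' (fun _ _ => by positivity) x
  · refine tendsto_const_nhds.congr' ?_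
    filter_upwards [eventually_ge_atTop (Nat.ceil (‖x‖ + 1))] with m hm
    rw [Set.indicator_of_notMem]
    intro hx
    rw [Metric.mem_ball, dist_eq_norm] at hx
    have h1 : ‖(m : ℝ) • e‖ = m := by rw [norm_smul, he, mul_one, Real.norm_natCast]
    have h2 : ‖(m : ℝ) • e‖ ≤ ‖x - (m : ℝ) • e‖ + ‖x‖ := by
      rw [norm_sub_rev]
      exact norm_le_norm_sub_add _ _
    have h3 : ‖x‖ + 1 ≤ m := (Nat.le_ceil _).trans (by exact_mod_cast hm)
    linarith

/-- The ray estimate makes the values along the ray a Cauchy sequence. The limit is unknown at this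
stage, since a gradient does not see constants. -/
theorem exists_tendsto_of_gradient_bound {p : Rn n → Rn n → ℂ}
    (hd : ∀ y, Differentiable ℝ fun x => p x y)
    {B κ : ℝ} (hκ : 0 < κ) (hB : 0 ≤ B)
    (hb : ∀ x y, ‖fderiv ℝ (fun x' => p x' y) x‖ ≤ B * gaussianAt κ x y) {e : Rn n}
    (he : ‖e‖ = 1) (y : Rn n) :
    ∃ l, Tendsto (fun m : ℕ => p ((m : ℝ) • e) y) atTop (𝓝 l) ∧
      ∀ m : ℕ, ‖y‖ + 1 ≤ m → ‖p ((m : ℝ) • e) y - l‖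
        ≤ 2 * B / Real.sqrt κ * Real.exp (-κ * (m - 1 - ‖y‖) ^ 2) := by
  have hstep : ∀ m k : ℕ, m ≤ k → ‖y‖ + 1 ≤ m → ‖p ((k : ℝ) • e) y - p ((m : ℝ) • e) y‖
      ≤ 2 * B / Real.sqrt κ * Real.exp (-κ * (m - 1 - ‖y‖) ^ 2) := by
    intro m k hmk hm
    have h1 : 0 ≤ inner ℝ ((m : ℝ) • e - y) e := by
      rw [inner_sub_left, inner_smul_left, real_inner_self_eq_norm_sq, he]
      have := real_inner_le_norm y e
      rw [he, mul_one] at this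
      simp
      linarith
    have hmk' : (m : ℝ) ≤ k := by exact_mod_cast hmk
    have h2 := norm_sub_le_of_ray (hd y) hκ (fun x => hb x y) he h1 (s := (k : ℝ) - m)
      (by linarith)
    rw [← add_smul, add_sub_cancel] at h2
    refine h2.trans ?_
    rw [gaussianAt]
    gcongr 2 * B / Real.sqrt κ * Real.exp ?_
    have h3 : ‖(m : ℝ) • e‖ = m := by rw [norm_smul, he, mul_one, Real.norm_natCast]
    have h4 := norm_sub_norm_le ((m : ℝ) • e) y
    rw [h3] at h4
    have h6 : ((m : ℝ) - 1 - ‖y‖) ^ 2 ≤ ‖(m : ℝ) • e - y‖ ^ 2 := by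
      apply pow_le_pow_left₀ <;> linarith
    nlinarith
  have hc : CauchySeq fun m : ℕ => p ((m : ℝ) • e) y := by
    obtain ⟨m₀, hm₀⟩ := exists_nat_ge (‖y‖ + 1)
    have hlim : Tendsto (fun m : ℕ => 2 * B / Real.sqrt κ * Real.exp (-κ * (m - (1 + ‖y‖)) ^ 2))
        atTop (𝓝 0) := by
      simpa using (tendsto_gaussian_shift hκ (1 + ‖y‖)).const_mul (2 * B / Real.sqrt κ)
    rw [Metric.cauchySeq_iff']
    intro ε hε
    obtain ⟨m, hm1, hm2⟩ := ((hlim.eventually (gt_mem_nhds hε)).and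
      (eventually_ge_atTop m₀)).exists
    refine ⟨m, fun k hk => ?_⟩
    rw [dist_eq_norm]
    refine (hstep m k hk (hm₀.trans (by exact_mod_cast hm2))).trans_lt ?_
    rwa [sub_sub]
  obtain ⟨l, hl⟩ := cauchySeq_tendsto_of_complete hc
  refine ⟨l, hl, fun m hm => ?_⟩
  rw [norm_sub_rev]
  refine le_of_tendsto ((hl.sub_const _).norm) ?_
  filter_upwards [eventually_ge_atTop m] with k hk using hstep m k hk hm

/-- A kernel with Gaussian gradient bound that represents a bounded operator vanishes at infinity
in a given direction, for almost every `y`. -/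
theorem ae_tendsto_zero_of_gradient_bound {p : Rn n → Rn n → ℂ} {T : L2 n →L[ℂ] L2 n}
    (hT : IsIntegralKernel T p) (hd : ∀ y, Differentiable ℝ fun x => p x y)
    {B κ : ℝ} (hκ : 0 < κ) (hB : 0 ≤ B)
    (hb : ∀ x y, ‖fderiv ℝ (fun x' => p x' y) x‖ ≤ B * gaussianAt κ x y) {e : Rn n}
    (he : ‖e‖ = 1) :
    ∀ᵐ y, Tendsto (fun m : ℕ => p ((m : ℝ) • e) y) atTop (𝓝 0) := by
  choose l hl hle using exists_tendsto_of_gradient_bound hd hκ hB hb he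
  have hlm : Measurable l := measurable_of_tendsto_metrizable
    (f := fun (m : ℕ) y => p ((m : ℝ) • e) y) (fun m => hT.1.comp measurable_prodMk_left)
    (tendsto_pi_nhds.2 hl)
  set C := 2 * B / Real.sqrt κ + B with hC
  have hC0 : 0 ≤ C := by positivity
  have hnear : ∀ (ρ : ℝ) (m : ℕ) (x y : Rn n), ‖x - (m : ℝ) • e‖ ≤ 1 → ‖y‖ ≤ ρ → ρ + 1 ≤ m →
      ‖p x y - l y‖ ≤ C * Real.exp (-κ * (m - (1 + ρ)) ^ 2) := by
    intro ρ m x y hx hy hm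
    have h1 := norm_sub_le_near (hd y) hκ hB (fun x => hb x y) he hx (by linarith)
    have h2 := hle y m (by linarith)
    have h3 : Real.exp (-κ * (m - 1 - ‖y‖) ^ 2) ≤ Real.exp (-κ * (m - (1 + ρ)) ^ 2) := by
      refine Real.exp_le_exp.2 ?_
      have h5 : ((m : ℝ) - (1 + ρ)) ^ 2 ≤ (m - 1 - ‖y‖) ^ 2 := by
        apply pow_le_pow_left₀ <;> linarith
      nlinarith
    calc ‖p x y - l y‖ ≤ ‖p x y - p ((m : ℝ) • e) y‖ + ‖p ((m : ℝ) • e) y - l y‖ :=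
          norm_sub_le_norm_sub_add_norm_sub _ _ _
      _ ≤ C * Real.exp (-κ * (m - 1 - ‖y‖) ^ 2) := by rw [hC, add_mul]; linarith
      _ ≤ _ := by gcongr
  -- If `∫_s l ≠ 0`, then `T 1_s` stays away from `0` on balls of fixed volume that move to
  -- infinity, which no `L²` function does. So `l` has integral zero over every bounded measurable
  -- set.
  have hzero : ∀ ρ : ℕ, ∀ s : Set (Rn n), MeasurableSet s → s ⊆ Metric.closedBall 0 ρ →
      IntegrableOn l s ∧ ∫ y in s, l y = 0 := by
    intro ρ s hs hsρ
    have hsfin : volume s ≠ ⊤ :=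
      ((measure_mono hsρ).trans_lt (isCompact_closedBall (0 : Rn n) ρ).measure_lt_top).ne
    have hsy : ∀ y ∈ s, ‖y‖ ≤ ρ := fun y hy => by simpa using hsρ hy
    set h : L2 n := indicatorConstLp 2 hs hsfin (1 : ℂ) with hh
    have hTh : ∀ᵐ x, IntegrableOn (fun y => p x y) s ∧ T h x = ∫ y in s, p x y := by
      filter_upwards [hT.2 h] with x hx
      have e1 : (fun y => p x y * h y) =ᵐ[volume] s.indicator fun y => p x y := by
        filter_upwards [indicatorConstLp_coeFn (p := 2) (hs := hs) (hμs := hsfin) (c := (1 : ℂ))]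
          with y hy
        rw [hh, hy]
        by_cases hys : y ∈ s <;> simp [hys]
      refine ⟨(integrable_indicator_iff hs).1 (hx.1.congr e1), ?_⟩
      rw [hx.2, integral_congr_ae e1, integral_indicator hs]
    have hvol : ∀ m : ℕ, volume (Metric.ball ((m : ℝ) • e) 1)
        = volume (Metric.ball (0 : Rn n) 1) := fun m => Measure.addHaar_ball_center _ _ _
    have hvpos : 0 < volume.real (Metric.ball (0 : Rn n) 1) :=
      ENNReal.toReal_pos (Metric.measure_ball_pos _ _ one_pos).ne' measure_ball_lt_top.ne
    -- A single point `x` at which `p(x, ·)` is integrable over `s` suffices, provided it lies far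
    -- enough out that `p(x, ·) - l` is bounded on `s`.
    have hli : IntegrableOn l s := by
      obtain ⟨m, hm⟩ := exists_nat_ge ((ρ : ℝ) + 1)
      have hpos : 0 < volume (Metric.ball ((m : ℝ) • e) 1) := Metric.measure_ball_pos _ _ one_pos
      obtain ⟨x, hxb, hx⟩ := (frequently_ae_mem_iff.2 hpos.ne').and_eventually hTh |>.exists
      have h1 : IntegrableOn (fun y => p x y - l y) s := by
        refine Measure.integrableOn_of_bounded (M := C * Real.exp (-κ * (m - (1 + ρ)) ^ 2)) hsfin
          ((hT.1.comp measurable_prodMk_left).sub hlm).aestronglyMeasurable ?_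
        refine (ae_restrict_iff' hs).2 (.of_forall fun y hy => ?_)
        refine hnear ρ m x y ?_ (hsy y hy) hm
        rw [Metric.mem_ball, dist_eq_norm] at hxb
        exact hxb.le
      have := hx.1.sub h1
      refine this.congr (.of_forall fun y => ?_)
      simp
    refine ⟨hli, ?_⟩
    by_contra hne
    set a := ‖∫ y in s, l y‖ with ha
    have ha0 : 0 < a := norm_pos_iff.2 hne
    have hlim1 : Tendsto (fun m : ℕ => C * Real.exp (-κ * (m - (1 + ρ)) ^ 2) * volume.real s)
        atTop (𝓝 0) := by
      simpa using ((tendsto_gaussian_shift hκ (1 + ρ)).const_mul C).mul_const (volume.real s)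
    have hlim2 := integral_ball_tendsto_zero (T h) he
    have hc0 : 0 < (a / 2) ^ 2 * volume.real (Metric.ball (0 : Rn n) 1) := by positivity
    obtain ⟨m₀, hm₀⟩ := exists_nat_ge ((ρ : ℝ) + 1)
    obtain ⟨m, ⟨hm1, hm2⟩, hm3⟩ := ((hlim1.eventually (gt_mem_nhds (half_pos ha0))).and
      (hlim2.eventually (gt_mem_nhds hc0))).and (eventually_ge_atTop m₀) |>.exists
    have hm4 : (ρ : ℝ) + 1 ≤ m := hm₀.trans (by exact_mod_cast hm3)
    have hlow : ∀ᵐ x ∂(volume.restrict (Metric.ball ((m : ℝ) • e) 1)),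
        (a / 2) ^ 2 ≤ ‖T h x‖ ^ 2 := by
      refine (ae_restrict_iff' measurableSet_ball).2 ?_
      filter_upwards [hTh] with x hx hxb
      rw [Metric.mem_ball, dist_eq_norm] at hxb
      have h1 : ‖T h x - ∫ y in s, l y‖ ≤ a / 2 := by
        rw [hx.2, ← integral_sub hx.1 hli]
        refine (norm_setIntegral_le_of_norm_le_const hsfin.lt_top fun y hy =>
          hnear ρ m x y hxb.le (hsy y hy) hm4).trans hm1.le
      have h2 : a ≤ ‖T h x‖ + ‖T h x - ∫ y in s, l y‖ := by
        rw [norm_sub_rev, add_comm]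
        exact norm_le_norm_sub_add _ _
      gcongr
      linarith
    have h3 : ∫ x in Metric.ball ((m : ℝ) • e) 1, (a / 2) ^ 2
        ≤ ∫ x in Metric.ball ((m : ℝ) • e) 1, ‖T h x‖ ^ 2 :=
      integral_mono_ae (integrableOn_const measure_ball_lt_top.ne)
        (Lp.memLp (T h)).norm.integrable_sq.integrableOn hlow
    rw [setIntegral_const, smul_eq_mul, measureReal_def, hvol, ← measureReal_def] at h3
    linarith
  have hall : ∀ ρ : ℕ, ∀ᵐ y, y ∈ Metric.closedBall (0 : Rn n) ρ → l y = 0 := by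
    intro ρ
    refine (ae_restrict_iff' measurableSet_closedBall).1 ?_
    refine Integrable.ae_eq_zero_of_forall_setIntegral_eq_zero
      (hzero ρ _ measurableSet_closedBall subset_rfl).1 fun s hs _ => ?_
    rw [Measure.restrict_restrict hs]
    exact (hzero ρ _ (hs.inter measurableSet_closedBall) Set.inter_subset_right).2
  filter_upwards [ae_all_iff.2 hall] with y hy
  obtain ⟨ρ, hρ⟩ := exists_nat_ge ‖y‖
  have := hl y
  rwa [hy ρ (by simpa using hρ)] at this

/-- Far out, `f (x + m • e)` and `f (m • e)` differ little, so `f` also tends to `0` along the ray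
from `x`. The ray estimate then bounds `f x` itself. -/
theorem norm_le_of_tendsto_zero {f : Rn n → ℂ} (hf : Differentiable ℝ f) {B κ : ℝ} (hκ : 0 < κ)
    (hB : 0 ≤ B) {y : Rn n} (hb : ∀ x, ‖fderiv ℝ f x‖ ≤ B * gaussianAt κ x y) {e : Rn n}
    (he : ‖e‖ = 1) {x : Rn n} (hx : 0 ≤ inner ℝ (x - y) e)
    (hlim : Tendsto (fun m : ℕ => f ((m : ℝ) • e)) atTop (𝓝 0)) :
    ‖f x‖ ≤ 2 * B / Real.sqrt κ * gaussianAt κ x y := by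
  have h1 : Tendsto (fun m : ℕ => f (x + (m : ℝ) • e) - f ((m : ℝ) • e)) atTop (𝓝 0) := by
    have h2 : Tendsto (fun m : ℕ => B * Real.exp (-κ * (m - (‖x‖ + ‖y‖)) ^ 2) * ‖x‖)
        atTop (𝓝 0) := by
      simpa using ((tendsto_gaussian_shift hκ (‖x‖ + ‖y‖)).const_mul B).mul_const ‖x‖
    refine squeeze_zero_norm' ?_ h2
    filter_upwards [eventually_ge_atTop (Nat.ceil (‖y‖ + ‖x‖))] with m hm
    have h3 : ‖y‖ + ‖x‖ ≤ m := (Nat.le_ceil _).trans (by exact_mod_cast hm)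
    have := norm_sub_le_near hf hκ hB hb he (x := x + (m : ℝ) • e) (r := ‖x‖) (by simp) h3
    rwa [sub_sub] at this
  have h4 : Tendsto (fun m : ℕ => f (x + (m : ℝ) • e) - f x) atTop (𝓝 (0 + 0 - f x)) := by
    refine Tendsto.sub_const ?_ _
    refine (h1.add hlim).congr fun m => ?_
    ring
  rw [add_zero, zero_sub] at h4
  have h5 := le_of_tendsto h4.norm (.of_forall fun m =>
    norm_sub_le_of_ray hf hκ hb he hx (Nat.cast_nonneg m))
  rwa [norm_neg] at h5

/-- A kernel with Gaussian gradient bound can be modified on a null set of `y` so that it has a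
Gaussian bound itself. -/
theorem exists_kernel_of_gradient_bound (hn : 1 ≤ n) {p : Rn n → Rn n → ℂ}
    {T : L2 n →L[ℂ] L2 n}
    (hT : IsIntegralKernel T p) (hd : ∀ y, Differentiable ℝ fun x => p x y)
    {B κ : ℝ} (hκ : 0 < κ)
    (hb : ∀ x y, ‖fderiv ℝ (fun x' => p x' y) x‖ ≤ B * gaussianAt κ x y) :
    ∃ p' : Rn n → Rn n → ℂ, IsIntegralKernel T p' ∧ (∀ y, Differentiable ℝ fun x => p' x y) ∧
      (∀ x y, ‖fderiv ℝ (fun x' => p' x' y) x‖ ≤ B * gaussianAt κ x y) ∧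
      ∀ x y, ‖p' x y‖ ≤ 2 * B / Real.sqrt κ * gaussianAt κ x y := by
  have hB : 0 ≤ B := by
    by_contra hneg
    have h1 := (norm_nonneg _).trans (hb 0 0)
    have h2 := mul_neg_of_neg_of_pos (not_le.1 hneg) (gaussianAt_pos κ (0 : Rn n) 0)
    linarith
  -- The directions `±e` are enough: for all `x` and `y` one of them leads away from `y`. Having
  -- only two directions keeps the exceptional set of `y` null.
  set e : Rn n := EuclideanSpace.single ⟨0, hn⟩ 1 with he
  have he1 : ‖e‖ = 1 := by simp [he]
  have he2 : ‖-e‖ = 1 := by rw [norm_neg, he1]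
  have hae := (ae_tendsto_zero_of_gradient_bound hT hd hκ hB hb he1).and
    (ae_tendsto_zero_of_gradient_bound hT hd hκ hB hb he2)
  -- A measurable null set keeps the modified kernel jointly measurable.
  obtain ⟨S, hS, hSm, hS0⟩ := exists_measurable_superset_of_null (ae_iff.1 hae)
  have hgood : ∀ y, y ∉ S → Tendsto (fun m : ℕ => p ((m : ℝ) • e) y) atTop (𝓝 0) ∧
      Tendsto (fun m : ℕ => p ((m : ℝ) • -e) y) atTop (𝓝 0) := by
    intro y hy
    by_contra hne
    exact hy (hS hne)
  refine ⟨fun x y => Sᶜ.indicator (fun y => p x y) y, ⟨?_, fun f => ?_⟩, fun y => ?_,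
    fun x y => ?_, fun x y => ?_⟩
  · have : Function.uncurry (fun x y => Sᶜ.indicator (fun y => p x y) y)
        = (Prod.snd ⁻¹' Sᶜ).indicator (Function.uncurry p) := by
      funext z
      by_cases hz : z.2 ∈ S <;> simp [Function.uncurry, hz]
    rw [this]
    exact hT.1.indicator (measurable_snd hSm.compl)
  · have hSae : ∀ᵐ y, y ∉ S := measure_eq_zero_iff_ae_notMem.1 hS0
    filter_upwards [hT.2 f] with x hx
    have e1 : (fun y => Sᶜ.indicator (fun y => p x y) y * f y) =ᵐ[volume] fun y => p x y * f y := by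
      filter_upwards [hSae] with y hy
      rw [Set.indicator_of_mem (show y ∈ Sᶜ from hy)]
    exact ⟨hx.1.congr e1.symm, hx.2.trans (integral_congr_ae e1).symm⟩
  · by_cases hy : y ∈ S
    · simp [hy]
    · simpa [hy] using hd y
  · by_cases hy : y ∈ S
    · have := mul_nonneg hB (gaussianAt_pos κ x y).le
      simpa [hy] using this
    · simpa [hy] using hb x y
  · by_cases hy : y ∈ S
    · have : 0 ≤ 2 * B / Real.sqrt κ * gaussianAt κ x y :=
        mul_nonneg (by positivity) (gaussianAt_pos κ x y).le
      simpa [hy] using this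
    · simp only [Set.indicator_of_mem (show y ∈ Sᶜ from hy)]
      rcases le_total 0 (inner ℝ (x - y) e) with h | h
      · exact norm_le_of_tendsto_zero (hd y) hκ hB (fun x => hb x y) he1 h (hgood y hy).1
      · refine norm_le_of_tendsto_zero (hd y) hκ hB (fun x => hb x y) he2 ?_ (hgood y hy).2
        rw [inner_neg_right]
        linarith

end GradientBound

/-! ### Dyadic kernel estimates from heat kernel bounds. -/

section DyadicDecay

open scoped FourierTransform

variable {n : ℕ}

theorem two_zpow_neg_rpow (j : ℤ) (s : ℝ) :
    ((2 : ℝ) ^ (-j)) ^ (-s / 2) = (2 : ℝ) ^ ((j : ℝ) * s / 2) := by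
  rw [← Real.rpow_intCast, ← Real.rpow_mul two_pos.le]
  congr 1
  push_cast
  ring

theorem two_zpow_neg_eq (j : ℤ) : (2 : ℝ) ^ (-j) = (((2 : ℝ) ^ ((j : ℝ) / 2)) ^ 2)⁻¹ := by
  rw [← Real.rpow_natCast, ← Real.rpow_mul two_pos.le, zpow_neg, ← Real.rpow_intCast]
  congr 2
  push_cast
  ring

theorem two_rpow_half_pow (j : ℤ) (k : ℕ) :
    ((2 : ℝ) ^ ((j : ℝ) / 2)) ^ k = (2 : ℝ) ^ ((j : ℝ) * k / 2) := by
  rw [← Real.rpow_natCast, ← Real.rpow_mul two_pos.le]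
  congr 1
  ring

theorem exp_heat_eq_gaussianAt (c : ℝ) (j : ℤ) (x y : Rn n) :
    Real.exp (-c * ‖x - y‖ ^ 2 / (2 : ℝ) ^ (-j))
      = gaussianAt (c * ((2 : ℝ) ^ ((j : ℝ) / 2)) ^ 2) x y := by
  rw [two_zpow_neg_eq, gaussianAt, div_inv_eq_mul]
  congr 1
  ring

theorem nonneg_of_heat_bound {A c s t b : ℝ} (ht : 0 < t) (hb : 0 ≤ b) {r : ℝ}
    (h : b ≤ A * t ^ s * Real.exp (-c * r / t)) : 0 ≤ A := by
  by_contra hA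
  have := mul_neg_of_neg_of_pos (mul_neg_of_neg_of_pos (not_le.1 hA) (Real.rpow_pos_of_pos ht s))
    (Real.exp_pos (-c * r / t))
  linarith

/-- The kernels of `φ_j(H) = e^{-tH} G_j e^{-tH}`, `t = 2^{-j}`, decay if the heat kernel has
Gaussian bounds, and so do their gradients if that of the heat kernel has Gaussian bounds. -/
theorem exists_kernel_uniformDecay {H : L2 n →ₗ.[ℂ] L2 n} (hH : IsSelfAdjoint H)
    {φ : ℤ → ℝ → ℂ} (hφ : IsDyadicSystem φ) {p : ℝ → Rn n → Rn n → ℂ} {A c : ℝ} (hc : 0 < c)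
    (hp : ∀ t > 0, IsKernelOf H (fun l => (Real.exp (-t * l) : ℂ)) (p t))
    (h0 : ∀ t > 0, ∀ x y, ‖p t x y‖
      ≤ A * t ^ (-((n : ℝ) + 0) / 2) * Real.exp (-c * ‖x - y‖ ^ 2 / t)) :
    ∃ K : ℤ → Rn n → Rn n → ℂ, (∀ j, IsKernelOf H (φ j) (K j)) ∧ UniformDecay 0 K ∧
      ∀ A₁ : ℝ, (∀ t > 0, (∀ y, Differentiable ℝ fun x => p t x y) ∧
        ∀ x y, ‖fderiv ℝ (fun x' => p t x' y) x‖
          ≤ A₁ * t ^ (-((n : ℝ) + 1) / 2) * Real.exp (-c * ‖x - y‖ ^ 2 / t)) →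
        UniformDecay 1 K := by
  have hA : 0 ≤ A := nonneg_of_heat_bound one_pos (norm_nonneg _) (h0 1 one_pos 0 0)
  set q : ℤ → ℝ := fun j => (2 : ℝ) ^ ((j : ℝ) / 2) with hqdef
  have hq : ∀ j, 0 < q j := fun j => Real.rpow_pos_of_pos two_pos _
  have ht : ∀ j : ℤ, (0 : ℝ) < 2 ^ (-j) := fun j => zpow_pos two_pos _
  choose T hTf hTk using fun j => hp _ (ht j)
  have hG : ∀ j, GaussianKernel A c (q j) (p (2 ^ (-j))) := fun j =>
    { A_nonneg := hA
      c_pos := hc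
      q_pos := hq j
      meas := (hTk j).1
      le := fun x y => by
        have h := h0 _ (ht j) x y
        rw [exp_heat_eq_gaussianAt, two_zpow_neg_rpow, add_zero, ← two_rpow_half_pow] at h
        exact h }
  have hexp : ∀ t : ℝ, Continuous fun l => Real.exp (-t * l) := fun t => by fun_prop
  have hTs : ∀ j, IsSelfAdjoint (T j) := fun j => (hTf j).isSelfAdjoint hH (hexp _)
  set Φ : ℤ → ℝ → ℂ := fun j l => φ j ((2 : ℝ) ^ j * l) with hΦ
  have hU : UniformBump Φ := hφ.uniformBump
  set g : ℤ → ℝ → ℂ := fun j => 𝓕 (logPull 2 (Φ j)) with hg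
  have hgi : ∀ j, Integrable (g j) := fun j => (hU.fourier_inversion j).1
  have hlp : ∀ j, Integrable (logPull 2 (Φ j)) := fun j => by
    obtain ⟨_, _, h'⟩ := hU.exists_integral_logPull_le 2
    exact (h' j).1
  have hGf : ∀ j, IsFunctionOf H (φ j) (T j * fourierOp (g j) (T j) * T j) := by
    intro j
    have h := IsFunctionOf.mul_fourierOp_mul hH (hexp _) (hTf j) (hU.contDiff_logPull j).continuous
      (continuous_fourier_real (hlp j)) (hgi j) (hU.fourier_inversion j).2
    convert h using 1
    funext l
    exact dyadic_eq_logPull φ j l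
  set K : ℤ → Rn n → Rn n → ℂ := fun j => (hG j).composite (fourierOp (g j) (T j)) with hK
  -- All the decay is contained in this estimate. It serves the kernel and its gradient alike,
  -- because differentiation in `x` only replaces the Gaussian bound of the left factor.
  have hrow : ∀ N : ℕ, ∃ R : ℝ, 0 ≤ R ∧ ∀ j x y,
      ∫ z, gaussianAt (c * q j ^ 2) x z * ‖(hG j).column (fourierOp (g j) (T j)) y z‖
        ≤ R / (1 + q j * ‖x - y‖) ^ N := by
    intro N
    obtain ⟨B, hB⟩ := hU.exists_weighted_integral_le N
    have key : ∀ j x y,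
      (∫ z, gaussianAt (c * q j ^ 2) x z * ‖(hG j).column (fourierOp (g j) (T j)) y z‖)
        * (1 + q j * ‖x - y‖) ^ N ≤ rowBound n A c N B := fun j x y =>
      (hG j).integral_gaussianAt_mul_le (hTk j) (hTs j) (hgi j) (hB j).1 (hB j).2 x y
        (MemLp.coeFn_toLp _)
    refine ⟨rowBound n A c N B, ?_, fun j x y => ?_⟩
    · refine le_trans ?_ (key 0 0 0)
      have := hq 0
      exact mul_nonneg (integral_nonneg fun z =>
        mul_nonneg (gaussianAt_pos _ _ _).le (norm_nonneg _)) (by positivity)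
    · have := hq j
      rw [le_div_iff₀ (by positivity)]
      exact key j x y
  refine ⟨K, fun j => ⟨_, hGf j, (hG j).isIntegralKernel_composite (hTk j) _⟩, ⟨?_, ?_⟩, ?_⟩
  · intro j h
    exact absurd h (by decide)
  · intro N
    obtain ⟨R, hR0, hR⟩ := hrow N
    -- The summand `1` makes the constant positive even if `A * R = 0`.
    refine ⟨A * R + 1, by positivity, fun j x y => ?_⟩
    have h1 := (hG j).norm_composite_le (fourierOp (g j) (T j)) x y
    have h2 := mul_le_mul_of_nonneg_left (hR j x y) (mul_nonneg hA (pow_nonneg (hq j).le n))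
    rw [xGradNorm, if_pos rfl]
    have h3 : (2 : ℝ) ^ ((j : ℝ) * ((n : ℝ) + ((0 : Fin 2) : ℕ)) / 2) = q j ^ n := by
      rw [two_rpow_half_pow]; simp
    rw [h3]
    refine (h1.trans h2).trans ?_
    have := hq j
    calc A * q j ^ n * (R / (1 + q j * ‖x - y‖) ^ N)
        = A * R * (q j ^ n / (1 + q j * ‖x - y‖) ^ N) := by ring
      _ ≤ (A * R + 1) * (q j ^ n / (1 + q j * ‖x - y‖) ^ N) := by gcongr; linarith
  · intro A₁ h1
    have hA₁ : 0 ≤ A₁ := nonneg_of_heat_bound one_pos (norm_nonneg _) ((h1 1 one_pos).2 0 0)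
    have hb : ∀ j x z, ‖fderiv ℝ (fun x' => p (2 ^ (-j)) x' z) x‖
        ≤ A₁ * q j ^ (n + 1) * gaussianAt (c * q j ^ 2) x z := by
      intro j x z
      have h := (h1 _ (ht j)).2 x z
      rw [exp_heat_eq_gaussianAt, two_zpow_neg_rpow, ← Nat.cast_add_one, ← two_rpow_half_pow] at h
      exact h
    have hder := fun j x y => (hG j).hasFDerivAt_integral_mul (h1 _ (ht j)).1 (hb j)
      ((hG j).column (fourierOp (g j) (T j)) y) x
    refine ⟨fun j _ y x => (hder j x y).1.differentiableAt, fun N => ?_⟩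
    obtain ⟨R, hR0, hR⟩ := hrow N
    refine ⟨A₁ * R + 1, by positivity, fun j x y => ?_⟩
    have h2 := mul_le_mul_of_nonneg_left (hR j x y) (mul_nonneg hA₁ (pow_nonneg (hq j).le (n + 1)))
    rw [xGradNorm, if_neg (by decide)]
    have h3 : (2 : ℝ) ^ ((j : ℝ) * ((n : ℝ) + ((1 : Fin 2) : ℕ)) / 2) = q j ^ (n + 1) := by
      rw [two_rpow_half_pow]; simp
    rw [h3]
    have h4 : fderiv ℝ (fun x' => K j x' y) x = _ := (hder j x y).1.fderiv
    rw [h4]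
    refine ((hder j x y).2.trans h2).trans ?_
    have := hq j
    calc A₁ * q j ^ (n + 1) * (R / (1 + q j * ‖x - y‖) ^ N)
        = A₁ * R * (q j ^ (n + 1) / (1 + q j * ‖x - y‖) ^ N) := by ring
      _ ≤ (A₁ * R + 1) * (q j ^ (n + 1) / (1 + q j * ‖x - y‖) ^ N) := by gcongr; linarith

theorem HeatGaussianBound.exists_kernel_zero {H : L2 n →ₗ.[ℂ] L2 n} (hH : IsSelfAdjoint H)
    (h : HeatGaussianBound H 0) {φ : ℤ → ℝ → ℂ} (hφ : IsDyadicSystem φ) :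
    ∃ K : ℤ → Rn n → Rn n → ℂ, (∀ j, IsKernelOf H (φ j) (K j)) ∧ UniformDecay 0 K := by
  obtain ⟨p, hp, A, c, hc, hb⟩ := h
  obtain ⟨K, h1, h2, -⟩ := exists_kernel_uniformDecay hH hφ (p := p) (A := A) hc
    (fun t ht => (hp t ht).1) fun t ht x y => by simpa [xGradNorm] using hb t ht x y
  exact ⟨K, h1, h2⟩

/-- The gradient bound alone suffices, because the heat kernel can be replaced by a version that
satisfies both bounds. The orders fit: `t^{-(n+1)/2} / √(c/t) = t^{-n/2} / √c`. -/
theorem HeatGaussianBound.dyadicKernelDecay (hn : 1 ≤ n) {H : L2 n →ₗ.[ℂ] L2 n}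
    (hH : IsSelfAdjoint H) (h : HeatGaussianBound H 1) : DyadicKernelDecay H := by
  intro φ hφ
  obtain ⟨p, hp, A, c, hc, hb⟩ := h
  have hb' : ∀ t > 0, ∀ x y, ‖fderiv ℝ (fun x' => p t x' y) x‖
      ≤ A * t ^ (-((n : ℝ) + 1) / 2) * gaussianAt (c / t) x y := by
    intro t ht x y
    have := hb t ht x y
    rw [xGradNorm, if_neg (by decide)] at this
    convert this using 2
    · simp
    · rw [gaussianAt]
      congr 1
      ring
  have hex : ∀ t : ℝ, ∃ p' : Rn n → Rn n → ℂ, 0 < t →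
      IsKernelOf H (fun l => (Real.exp (-t * l) : ℂ)) p' ∧
      (∀ y, Differentiable ℝ fun x => p' x y) ∧
      (∀ x y, ‖fderiv ℝ (fun x' => p' x' y) x‖
        ≤ A * t ^ (-((n : ℝ) + 1) / 2) * gaussianAt (c / t) x y) ∧
      ∀ x y, ‖p' x y‖
        ≤ 2 * (A * t ^ (-((n : ℝ) + 1) / 2)) / Real.sqrt (c / t) * gaussianAt (c / t) x y := by
    intro t
    by_cases ht : 0 < t
    · obtain ⟨T, hT, hTk⟩ := (hp t ht).1
      obtain ⟨p', h1, h2, h3, h4⟩ := exists_kernel_of_gradient_bound hn hTk ((hp t ht).2 rfl)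
        (κ := c / t) (by positivity) (hb' t ht)
      exact ⟨p', fun _ => ⟨⟨T, hT, h1⟩, h2, h3, h4⟩⟩
    · exact ⟨0, fun h => absurd h ht⟩
  choose p' hp' using hex
  have hga : ∀ t x y, gaussianAt (n := n) (c / t) x y = Real.exp (-c * ‖x - y‖ ^ 2 / t) := by
    intro t x y
    rw [gaussianAt]
    congr 1
    ring
  obtain ⟨K, h1, h2, h3⟩ := exists_kernel_uniformDecay hH hφ (p := p')
    (A := 2 * A / Real.sqrt c) hc (fun t ht => (hp' t ht).1) fun t ht x y => by
      have h := (hp' t ht).2.2.2 x y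
      rw [← hga]
      convert h using 2
      rw [Real.sqrt_div hc.le, show (-((n : ℝ) + 1) / 2) = -((n : ℝ) + 0) / 2 - 1 / 2 by ring,
        Real.rpow_sub ht, ← Real.sqrt_eq_rpow]
      have : 0 < Real.sqrt t := Real.sqrt_pos.2 ht
      have : 0 < Real.sqrt c := Real.sqrt_pos.2 hc
      field_simp
  refine ⟨K, h1, h2, h3 A fun t ht => ⟨(hp' t ht).2.1, fun x y => ?_⟩⟩
  rw [← hga]
  exact (hp' t ht).2.2.1 x y

end DyadicDecay

/-! ### Symmetry of a generator, and its semigroup, from explicit orbits. -/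

section Semigroup

open Filter Topology

variable {𝓗 : Type*} [NormedAddCommGroup 𝓗] [InnerProductSpace ℂ 𝓗]

theorem tendsto_inner_zero_of_dense {S : Submodule ℂ 𝓗} (hS : Dense (S : Set 𝓗)) {ι : Type*}
    {w : ι → 𝓗} {l : Filter ι} {C : ℝ} (hC : ∀ᶠ t in l, ‖w t‖ ≤ C)
    (h : ∀ d ∈ S, Tendsto (fun t => inner ℂ d (w t)) l (𝓝 0)) (v : 𝓗) :
    Tendsto (fun t => inner ℂ v (w t)) l (𝓝 0) := by
  rw [Metric.tendsto_nhds]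
  intro ε hε
  obtain ⟨d, hd, hvd⟩ := Metric.mem_closure_iff.1 (hS v) (ε / (2 * (|C| + 1))) (by positivity)
  filter_upwards [hC, (Metric.tendsto_nhds.1 (h d hd)) (ε / 2) (by positivity)] with t h1 h2
  rw [dist_zero_right] at h2 ⊢
  rw [dist_eq_norm, lt_div_iff₀ (by positivity)] at hvd
  have h3 : inner ℂ v (w t) = inner ℂ (v - d) (w t) + inner ℂ d (w t) := by
    rw [inner_sub_left]; ring
  have h4 := norm_inner_le_norm (𝕜 := ℂ) (v - d) (w t)
  have h5 : ‖v - d‖ * ‖w t‖ ≤ ‖v - d‖ * (|C| + 1) := by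
    gcongr
    exact h1.trans ((le_abs_self C).trans (by linarith))
  rw [h3]
  refine (norm_add_le _ _).trans_lt ?_
  linarith

variable [CompleteSpace 𝓗]

/-- A family of curves `E ξ` that start from a total set and satisfy `E' = -H E` weakly, together
with bounded self-adjoint operators `P t` that map `E ξ 0` to `E ξ t`. -/
structure IsHeatFlow {X : Type*} (H : 𝓗 →ₗ.[ℂ] 𝓗) (E h : X → ℝ → 𝓗) (P : ℝ → 𝓗 →L[ℂ] 𝓗) :
    Prop where
  deriv : ∀ ξ t, HasDerivAt (E ξ) (-h ξ t) t
  weak : ∀ ξ t u g, (u, g) ∈ H.graph → inner ℂ (E ξ t) g = inner ℂ (h ξ t) u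
  bound : ∃ M, 0 ≤ M ∧ ∀ t, 0 ≤ t → ‖P t‖ ≤ M
  symm : ∀ t, 0 ≤ t → IsSelfAdjoint (P t)
  flow : ∀ ξ t, 0 ≤ t → P t (E ξ 0) = E ξ t
  total : Dense (Submodule.span ℂ (Set.range fun ξ => E ξ 0) : Set 𝓗)

variable {X : Type*} {H : 𝓗 →ₗ.[ℂ] 𝓗} {E h : X → ℝ → 𝓗} {P : ℝ → 𝓗 →L[ℂ] 𝓗}

/-- Orbits are explicit only for vectors of the span, and `P` is controlled only for `t ≥ 0`; hence
the choice of `d` and the one-sided derivative. Other vectors are reached by density. -/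
theorem IsHeatFlow.hasDerivWithinAt (hP : IsHeatFlow H E h P) {u g : 𝓗} (hu : (u, g) ∈ H.graph)
    {d : 𝓗} (hd : d ∈ Submodule.span ℂ (Set.range fun ξ => E ξ 0)) {t : ℝ} (ht : 0 ≤ t) :
    HasDerivWithinAt (fun s => inner ℂ (P s d) u) (-inner ℂ (P t d) g) (Set.Ici 0) t := by
  induction hd using Submodule.span_induction with
  | mem d hd =>
    obtain ⟨ξ, rfl⟩ := hd
    have h1 : HasDerivAt (fun s => inner ℂ (E ξ s) u) (inner ℂ (-h ξ t) u) t := by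
      simpa using (hP.deriv ξ t).inner ℂ (hasDerivAt_const t u)
    rw [inner_neg_left, ← hP.weak ξ t u g hu] at h1
    simp only
    rw [hP.flow ξ t ht]
    exact h1.hasDerivWithinAt.congr (fun s hs => by rw [hP.flow ξ s hs]) (by rw [hP.flow ξ t ht])
  | zero => simpa using hasDerivWithinAt_const t (Set.Ici 0) (0 : ℂ)
  | add a b _ _ iha ihb =>
    simp only [map_add, inner_add_left, neg_add]
    exact iha.add ihb
  | smul c a _ iha =>
    simp only [map_smul, inner_smul_left, ← mul_neg]
    exact iha.const_mul _

theorem IsHeatFlow.apply_zero (hP : IsHeatFlow H E h P) : P 0 = 1 := by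
  refine ContinuousLinearMap.ext_on hP.total ?_
  rintro _ ⟨ξ, rfl⟩
  exact hP.flow ξ 0 le_rfl

/-- Symmetry moves `P t` onto a vector `d` of the span, where the mean value inequality applies. By
density the bound holds for all `d`, and `d = P t u - u` gives the norm. -/
theorem IsHeatFlow.norm_sub_le (hP : IsHeatFlow H E h P) {u g : 𝓗} (hu : (u, g) ∈ H.graph) :
    ∃ C, ∀ t, 0 ≤ t → ‖P t u - u‖ ≤ C * t := by
  obtain ⟨M, hM, hb⟩ := hP.bound
  refine ⟨M * ‖g‖, fun t ht => ?_⟩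
  have key : ∀ d ∈ Submodule.span ℂ (Set.range fun ξ => E ξ 0),
      ‖inner ℂ d (P t u - u)‖ ≤ ‖d‖ * (M * ‖g‖ * t) := by
    intro d hd
    have h1 := norm_image_sub_le_of_norm_deriv_le_segment' (f := fun s => inner ℂ (P s d) u)
      (f' := fun s => -inner ℂ (P s d) g) (C := M * ‖d‖ * ‖g‖) (a := 0) (b := t)
      (fun s hs => (hP.hasDerivWithinAt hu hd hs.1).mono Set.Icc_subset_Ici_self)
      (fun s hs => by
        rw [norm_neg]
        refine (norm_inner_le_norm _ _).trans ?_
        gcongr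
        exact (P s).le_of_opNorm_le (hb s hs.1) d) t ⟨ht, le_rfl⟩
    rw [hP.apply_zero, sub_zero, one_apply_eq_self] at h1
    have h2 : inner ℂ d (P t u - u) = inner ℂ (P t d) u - inner ℂ d u := by
      rw [inner_sub_right, ← ContinuousLinearMap.adjoint_inner_left,
        ← ContinuousLinearMap.star_eq_adjoint, (hP.symm t ht).star_eq]
    rw [h2]
    exact h1.trans_eq (by ring)
  have hcl : IsClosed {d : 𝓗 | ‖inner ℂ d (P t u - u)‖ ≤ ‖d‖ * (M * ‖g‖ * t)} :=
    isClosed_le (by fun_prop) (by fun_prop)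
  have hall : P t u - u ∈ {d : 𝓗 | ‖inner ℂ d (P t u - u)‖ ≤ ‖d‖ * (M * ‖g‖ * t)} :=
    closure_minimal key hcl (hP.total _)
  have h3 : ‖inner ℂ (P t u - u) (P t u - u)‖ ≤ ‖P t u - u‖ * (M * ‖g‖ * t) := hall
  rw [inner_self_eq_norm_sq_to_K, norm_pow, RCLike.norm_ofReal, abs_norm, sq] at h3
  by_cases h0 : ‖P t u - u‖ = 0
  · rw [h0]; positivity
  · exact le_of_mul_le_mul_left h3 (lt_of_le_of_ne (norm_nonneg _) (Ne.symm h0))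

/-- `t⁻¹ (P t u - u) → -H u` weakly. -/
theorem IsHeatFlow.tendsto_inner (hP : IsHeatFlow H E h P) {u g : 𝓗} (hu : (u, g) ∈ H.graph)
    (v : 𝓗) : Tendsto (fun t : ℝ => inner ℂ v (((t⁻¹ : ℝ) : ℂ) • (P t u - u) + g)) (𝓝[>] 0)
      (𝓝 0) := by
  obtain ⟨C, hC⟩ := hP.norm_sub_le hu
  refine tendsto_inner_zero_of_dense hP.total (C := C + ‖g‖) ?_ ?_ v
  · filter_upwards [self_mem_nhdsWithin] with t ht
    have ht' : 0 < t := ht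
    refine (norm_add_le _ _).trans ?_
    gcongr
    rw [norm_smul, Complex.norm_real, Real.norm_of_nonneg (by positivity), inv_mul_le_iff₀ ht',
      mul_comm]
    exact hC t ht'.le
  · intro d hd
    have h1 := (hP.hasDerivWithinAt hu hd le_rfl).mono Set.Ioi_subset_Ici_self
    rw [hasDerivWithinAt_iff_tendsto_slope' (by simp)] at h1
    have h2 := h1.add_const (inner ℂ d g)
    rw [hP.apply_zero, one_apply_eq_self, neg_add_cancel] at h2
    refine h2.congr' ?_
    filter_upwards [self_mem_nhdsWithin] with t ht
    have ht' : (0 : ℝ) < t := ht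
    rw [slope_def_module, hP.apply_zero, one_apply_eq_self, sub_zero,
      inner_add_right, inner_smul_right, inner_sub_right,
      ← ContinuousLinearMap.adjoint_inner_left, ← ContinuousLinearMap.star_eq_adjoint,
      (hP.symm t ht'.le).star_eq, Complex.real_smul]

/-- The pairing `⟨u, t⁻¹ (P_t v - v)⟩` can be moved to the other side because `P_t` is self-adjoint,
and `t ↓ 0` yields the claim. Thus symmetry on the maximal domain needs no integration by parts for
its elements, whose regularity is unknown. -/
theorem IsHeatFlow.graph_symm (hP : IsHeatFlow H E h P) {u g v k : 𝓗} (hu : (u, g) ∈ H.graph)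
    (hv : (v, k) ∈ H.graph) : inner ℂ u k = inner ℂ g v := by
  have h1 := hP.tendsto_inner hu v
  have h2 := hP.tendsto_inner hv u
  have h3 := h2.sub (Complex.continuous_conj.tendsto 0 |>.comp h1)
  rw [map_zero, sub_zero] at h3
  have h4 : (fun t : ℝ => inner ℂ u (((t⁻¹ : ℝ) : ℂ) • (P t v - v) + k)
      - (starRingEnd ℂ) (inner ℂ v (((t⁻¹ : ℝ) : ℂ) • (P t u - u) + g)))
      =ᶠ[𝓝[>] 0] fun _ => inner ℂ u k - inner ℂ g v := by
    filter_upwards [self_mem_nhdsWithin] with t ht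
    have ht' : (0 : ℝ) < t := ht
    have e : inner ℂ u (P t v) = inner ℂ (P t u) v := by
      rw [← ContinuousLinearMap.adjoint_inner_left, ← ContinuousLinearMap.star_eq_adjoint,
        (hP.symm t ht'.le).star_eq]
    rw [inner_conj_symm]
    simp only [inner_add_right, inner_add_left, inner_smul_left, inner_smul_right,
      inner_sub_left, inner_sub_right, e, Complex.conj_ofReal]
    ring
  have h5 := tendsto_nhds_unique tendsto_const_nhds (h3.congr' h4)
  exact sub_eq_zero.1 h5

/-- The operators `P t` of the flow are `e^{-tH}` if `H` is self-adjoint. -/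
theorem IsHeatFlow.isFunctionOf (hP : IsHeatFlow H E h P) (hH : IsSelfAdjoint H) {t : ℝ}
    (ht : 0 ≤ t) : IsFunctionOf H (fun l => (Real.exp (-t * l) : ℂ)) (P t) := by
  intro ψ hψ hψc
  have hn := isStarNormal_resolventAtI hH
  obtain ⟨m, hm⟩ := hψc.isCompact.isBounded.subset_closedBall (0 : ℝ)
  have hm' : ∀ l, ψ l ≠ 0 → plateau m l = 1 := by
    intro l hl
    have := hm (subset_tsupport _ hl)
    rw [Metric.mem_closedBall, dist_zero_right, Real.norm_eq_abs] at this
    exact plateau_eq_one this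
  set χ : ℝ → ℂ := fun l => plateau m l * (l : ℂ) with hχ
  have hχc : Continuous χ := (continuous_plateau m).mul Complex.continuous_ofReal
  have hχs : HasCompactSupport χ := (hasCompactSupport_plateau m).mul_right
  set σ := resolventSymbol χ with hσ
  have hσc := continuousOn_resolventSymbol hH hχc hχs
  set A := compactCalculus H χ with hA
  set B := compactCalculus H ψ with hB
  let +nondep : NormedAlgebra ℚ (𝓗 →L[ℂ] 𝓗) := .restrictScalars ℚ ℂ _
  have hAB : A * B = compactCalculus H (fun l => ψ l * l) := by
    rw [hA, hB, ← compactCalculus_mul hH hχc hχs hψ hψc]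
    congr 1
    funext l
    by_cases h : ψ l = 0
    · simp [h]
    · simp only [hχ, hm' l h, one_mul, mul_comm (ψ l)]
  have hexp : ∀ r : ℝ, NormedSpace.exp ((r : ℂ) • A)
      = cfc (fun z => Complex.exp (r * σ z)) (resolventAtI H) := by
    intro r
    rw [hA, compactCalculus_eq, ← cfc_const_mul _ _ _ hσc, ← CFC.complex_exp_eq_normedSpace_exp,
      ← cfc_comp' Complex.exp (fun z => r * σ z) (resolventAtI H)
        Complex.continuous_exp.continuousOn (hσc.const_mul _)]
  have hfun : NormedSpace.exp (((-t : ℝ) : ℂ) • A) * B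
      = compactCalculus H (fun l => ψ l * (Real.exp (-t * l) : ℂ)) := by
    rw [hexp, hB, compactCalculus_eq, compactCalculus_eq,
      ← cfc_mul (fun z => Complex.exp (((-t : ℝ) : ℂ) * σ z)) _ _
        (Complex.continuous_exp.comp_continuousOn (hσc.const_mul _))
        (continuousOn_resolventSymbol hH hψ hψc)]
    refine cfc_congr fun z _ => ?_
    by_cases h0 : z = 0
    · simp [h0, resolventSymbol_zero]
    · simp only [hσ, resolventSymbol_of_ne _ h0, hχ]
      by_cases h : ψ (z⁻¹).re = 0
      · rw [h, mul_zero, zero_mul]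
      · rw [hm' _ h, one_mul, mul_comm]
        push_cast
        rfl
  rw [← hfun]
  refine ContinuousLinearMap.ext_on hP.total ?_
  rintro _ ⟨ξ, rfl⟩
  -- Self-adjointness turns the weak equation into membership of the domain.
  have hgr : ∀ s, (E ξ s, h ξ s) ∈ H.graph := fun s =>
    IsSelfAdjoint.mem_graph_of_forall hH fun a b hab => (hP.weak ξ s a b hab).symm
  have hBh : ∀ s, B (h ξ s) = A (B (E ξ s)) := by
    intro s
    rw [← compactCalculus_apply_graph hH hψ hψc (hgr s), ← hAB]
    rfl
  -- On the range of `ψ(H)` the bounded operator `A` acts as `H`, so `E' = -HE` makes `e^{sA} ψ(H)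
  -- E(s)` constant.
  have hderiv : ∀ s, HasDerivAt (fun s : ℝ => NormedSpace.exp ((s : ℂ) • A) (B (E ξ s))) 0 s := by
    intro s
    have h1 : HasDerivAt (fun s : ℝ => NormedSpace.exp ((s : ℂ) • A))
        (NormedSpace.exp ((s : ℂ) • A) * A) s := by
      have := hasDerivAt_exp_smul_const (𝕂 := ℝ) A s
      simpa only [Complex.coe_smul] using this
    have h2 : HasDerivAt (fun s => B (E ξ s)) (B (-h ξ s)) s :=
      B.restrictScalars ℝ |>.hasFDerivAt.comp_hasDerivAt s (hP.deriv ξ s)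
    have h3 := HasDerivAt.clm_apply (𝕜 := ℝ)
      (c := fun s : ℝ => (NormedSpace.exp ((s : ℂ) • A)).restrictScalars ℝ)
      (c' := (NormedSpace.exp ((s : ℂ) • A) * A).restrictScalars ℝ) ?_ h2
    · refine h3.congr_deriv ?_
      rw [map_neg, hBh]
      simp
    · exact (ContinuousLinearMap.restrictScalarsL ℂ 𝓗 𝓗 ℝ ℝ).hasFDerivAt.comp_hasDerivAt s h1
  have hconst := is_const_of_deriv_eq_zero (fun s => (hderiv s).differentiableAt)
    (fun s => (hderiv s).deriv) t 0
  have hinv : NormedSpace.exp (((-t : ℝ) : ℂ) • A) * NormedSpace.exp ((t : ℂ) • A) = 1 := by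
    rw [← NormedSpace.exp_add_of_commute (((Commute.refl A).smul_left _).smul_right _), ← add_smul]
    simp
  have h4 := congrArg (fun f => NormedSpace.exp (((-t : ℝ) : ℂ) • A) f) hconst
  simp only [Complex.ofReal_zero, zero_smul, NormedSpace.exp_zero] at h4
  rw [← mul_apply_eq_comp, hinv] at h4
  change B (P t (E ξ 0)) = _
  rw [hP.flow ξ t ht]
  exact h4

end Semigroup

/-! ### Coherent states and the Laplacian of their cut-offs. -/

section Coherent

open Filter Topology

variable {n : ℕ}

/-- Reduces the Laplacian to derivatives along coordinate lines, where the one-variable rules apply.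
-/
theorem laplacian_eq_sum_of_hasDerivAt {f : Rn n → ℂ} (hf : ContDiff ℝ 2 f)
    {D D2 : Fin n → Rn n → ℂ}
    (h1 : ∀ i x, HasDerivAt (fun s : ℝ => f (x + s • EuclideanSpace.single i 1)) (D i x) 0)
    (h2 : ∀ i x, HasDerivAt (fun s : ℝ => D i (x + s • EuclideanSpace.single i 1)) (D2 i x) 0)
    (x : Rn n) : Laplacian.laplacian f x = ∑ i, D2 i x := by
  rw [InnerProductSpace.laplacian_eq_iteratedFDeriv_orthonormalBasis f
    (EuclideanSpace.basisFun (Fin n) ℝ)]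
  refine Finset.sum_congr rfl fun i _ => ?_
  rw [iteratedFDeriv_two_apply]
  simp only [EuclideanSpace.basisFun_apply, Matrix.cons_val_zero, Matrix.cons_val_one]
  set e : Rn n := EuclideanSpace.single i 1
  have hline : ∀ y : Rn n, HasDerivAt (fun s : ℝ => y + s • e) e 0 := fun y => by
    simpa using ((hasDerivAt_id (0 : ℝ)).smul_const e).const_add y
  have hD : D i = fun y => fderiv ℝ f y e := by
    funext y
    have h3 : HasFDerivAt f (fderiv ℝ f (y + (0 : ℝ) • e)) (y + (0 : ℝ) • e) :=
      (hf.differentiable (by norm_num) _).hasFDerivAt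
    have h4 := h3.comp_hasDerivAt (0 : ℝ) (hline y)
    rw [zero_smul, add_zero] at h4
    exact (h1 i y).unique h4
  have hf' : Differentiable ℝ (fderiv ℝ f) :=
    (hf.fderiv_right (m := 1) (by norm_num)).differentiable (by norm_num)
  have h5 : HasFDerivAt (fderiv ℝ f) (fderiv ℝ (fderiv ℝ f) (x + (0 : ℝ) • e))
      (x + (0 : ℝ) • e) := (hf' _).hasFDerivAt
  have h6 := h5.comp_hasDerivAt (0 : ℝ) (hline x)
  rw [zero_smul, add_zero] at h6
  have h7 := h6.clm_apply (hasDerivAt_const (0 : ℝ) e)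
  simp only [map_zero, add_zero] at h7
  have h8 := h2 i x
  rw [hD] at h8
  exact (h7.unique h8)

/-- The function `e^{i ξ·x - |x|²/2}`. -/
def coherent (ξ x : Rn n) : ℂ :=
  Complex.exp ((inner ℝ ξ x : ℝ) * Complex.I - ((‖x‖ ^ 2 / 2 : ℝ) : ℂ))

theorem norm_coherent (ξ x : Rn n) : ‖coherent ξ x‖ = Real.exp (-(‖x‖ ^ 2 / 2)) := by
  rw [coherent, Complex.norm_exp]
  congr 1
  simp [-Complex.ofReal_pow, -Complex.ofReal_div]

theorem star_coherent (ξ x : Rn n) : star (coherent ξ x) = coherent (-ξ) x := by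
  rw [coherent, coherent, Complex.star_def, ← Complex.exp_conj]
  congr 1
  simp [-Complex.ofReal_pow, -Complex.ofReal_div]

theorem contDiff_coherent (ξ : Rn n) : ContDiff ℝ ∞ (coherent ξ) := by
  unfold coherent
  refine Complex.contDiff_exp.comp (ContDiff.sub (ContDiff.mul ?_ contDiff_const) ?_)
  · exact Complex.ofRealCLM.contDiff.comp (contDiff_const.inner ℝ contDiff_id)
  · exact Complex.ofRealCLM.contDiff.comp ((contDiff_norm_sq ℝ).div_const 2)

/-- The coefficients that occur below grow at most quadratically in `x`. This puts all of them under
one Gaussian in `L²`, the majorant for dominated convergence. -/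
theorem one_add_mul_norm_coherent_le (ξ x : Rn n) :
    (1 + ‖x‖ ^ 2) * ‖coherent ξ x‖ ≤ 4 * gaussianAt (1 / 4) 0 x := by
  rw [norm_coherent, gaussianAt, zero_sub, norm_neg]
  have h1 := Real.add_one_le_exp (‖x‖ ^ 2 / 4)
  have h2 : Real.exp (-(1 / 4) * ‖x‖ ^ 2)
      = Real.exp (‖x‖ ^ 2 / 4) * Real.exp (-(‖x‖ ^ 2 / 2)) := by
    rw [← Real.exp_add]
    congr 1
    ring
  rw [h2, ← mul_assoc]
  gcongr
  nlinarith [sq_nonneg ‖x‖]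

theorem hasDerivAt_norm_sq_line (i : Fin n) (x : Rn n) :
    HasDerivAt (fun s : ℝ => ‖x + s • EuclideanSpace.single i (1 : ℝ)‖ ^ 2) (2 * x i) 0 := by
  have h := (((hasDerivAt_id (0 : ℝ)).smul_const (EuclideanSpace.single i (1 : ℝ))).const_add
    x).norm_sq
  refine h.congr_deriv ?_
  simp [EuclideanSpace.inner_single_right]

theorem hasDerivAt_inner_line (ξ : Rn n) (i : Fin n) (x : Rn n) :
    HasDerivAt (fun s : ℝ => inner ℝ ξ (x + s • EuclideanSpace.single i (1 : ℝ))) (ξ i) 0 := by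
  have h := (((hasDerivAt_id (0 : ℝ)).mul_const (ξ i)).const_add (inner ℝ ξ x))
  refine (h.congr_deriv (by simp)).congr_of_eventuallyEq (.of_forall fun s => ?_)
  simp [inner_add_right, inner_smul_right, EuclideanSpace.inner_single_right]

theorem hasDerivAt_coord_line (i : Fin n) (x : Rn n) :
    HasDerivAt (fun s : ℝ => (x + s • EuclideanSpace.single i (1 : ℝ)) i) 1 0 := by
  have h := ((hasDerivAt_id (0 : ℝ)).const_add (x i))
  refine h.congr_of_eventuallyEq (.of_forall fun s => ?_)
  simp

theorem hasDerivAt_coherent_line (ξ : Rn n) (i : Fin n) (x : Rn n) :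
    HasDerivAt (fun s : ℝ => coherent ξ (x + s • EuclideanSpace.single i (1 : ℝ)))
      ((ξ i * Complex.I - x i) * coherent ξ x) 0 := by
  have h1 := (hasDerivAt_inner_line ξ i x).ofReal_comp.mul_const Complex.I
  have h2 := ((hasDerivAt_norm_sq_line i x).div_const 2).ofReal_comp
  refine (h1.sub h2).cexp.congr_deriv ?_
  simp only [Pi.sub_apply, zero_smul, add_zero]
  rw [coherent, mul_comm]
  congr 2
  push_cast
  ring

/-- The cut-off function `χ(ε|x|²) e^{i ξ·x - |x|²/2}`. -/
def cutCoherent (χ : ℝ → ℝ) (ε : ℝ) (ξ x : Rn n) : ℂ := (χ (ε * ‖x‖ ^ 2) : ℂ) * coherent ξ x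

theorem contDiff_cutCoherent {χ : ℝ → ℝ} (hχ : ContDiff ℝ ∞ χ) (ε : ℝ) (ξ : Rn n) :
    ContDiff ℝ ∞ (cutCoherent χ ε ξ) :=
  (Complex.ofRealCLM.contDiff.comp (hχ.comp (contDiff_const.mul (contDiff_norm_sq ℝ)))).mul
    (contDiff_coherent ξ)

theorem isTestFunction_cutCoherent {χ : ℝ → ℝ} (hχ : ContDiff ℝ ∞ χ) (hc : HasCompactSupport χ)
    {ε : ℝ} (hε : 0 < ε) (ξ : Rn n) : IsTestFunction (cutCoherent χ ε ξ) := by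
  refine ⟨contDiff_cutCoherent hχ ε ξ, ?_⟩
  obtain ⟨m, hm⟩ := hc.isCompact.isBounded.subset_closedBall (0 : ℝ)
  refine HasCompactSupport.intro (isCompact_closedBall (0 : Rn n) (1 + m / ε)) fun x hx => ?_
  rw [Metric.mem_closedBall, dist_zero_right, not_le] at hx
  have h0 : χ (ε * ‖x‖ ^ 2) = 0 := by
    by_contra hne
    have h1 := hm (subset_tsupport _ hne)
    rw [Metric.mem_closedBall, dist_zero_right, Real.norm_eq_abs] at h1
    have h2 := (le_abs_self _).trans h1
    have hm0 : 0 ≤ m := (abs_nonneg _).trans h1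
    have h3 : 0 ≤ m / ε := by positivity
    have h4 : ‖x‖ ^ 2 ≤ m / ε := by rw [le_div_iff₀ hε]; linarith
    nlinarith [norm_nonneg x]
  rw [cutCoherent, h0, Complex.ofReal_zero, zero_mul]

/-- Every term with a derivative of `χ` carries a factor `ε`; the last term is `χ` times the
Laplacian of the coherent state. -/
theorem laplacian_cutCoherent {χ : ℝ → ℝ} (hχ : ContDiff ℝ ∞ χ) (ε : ℝ) (ξ x : Rn n) :
    Laplacian.laplacian (cutCoherent χ ε ξ) x =
      ((4 * ε ^ 2 * ‖x‖ ^ 2 * deriv (deriv χ) (ε * ‖x‖ ^ 2) + 2 * n * ε * deriv χ (ε * ‖x‖ ^ 2)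
        + 4 * ε * deriv χ (ε * ‖x‖ ^ 2) * ((inner ℝ ξ x : ℝ) * Complex.I - ‖x‖ ^ 2)
        + χ (ε * ‖x‖ ^ 2)
          * (‖x‖ ^ 2 - ‖ξ‖ ^ 2 - 2 * ((inner ℝ ξ x : ℝ) * Complex.I) - n)) : ℂ)
        * coherent ξ x := by
  have hχ1 : ∀ s, HasDerivAt χ (deriv χ s) s := fun s =>
    (hχ.differentiable (by simp) s).hasDerivAt
  have hχ' : ContDiff ℝ ∞ (deriv χ) := (contDiff_infty_iff_deriv.1 hχ).2
  have hχ2 : ∀ s, HasDerivAt (deriv χ) (deriv (deriv χ) s) s := fun s =>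
    (hχ'.differentiable (by simp) s).hasDerivAt
  have hcomp : ∀ {η η' : ℝ → ℝ}, (∀ s, HasDerivAt η (η' s) s) → ∀ (i : Fin n) (x : Rn n),
      HasDerivAt (fun s : ℝ => ((η (ε * ‖x + s • EuclideanSpace.single i (1 : ℝ)‖ ^ 2) : ℝ) : ℂ))
        ((η' (ε * ‖x‖ ^ 2) * (ε * (2 * x i)) : ℝ) : ℂ) 0 := by
    intro η η' hη i x
    have h := (hη (ε * ‖x + (0 : ℝ) • EuclideanSpace.single i (1 : ℝ)‖ ^ 2)).comp (0 : ℝ)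
      ((hasDerivAt_norm_sq_line i x).const_mul ε)
    rw [zero_smul, add_zero] at h
    exact h.ofReal_comp
  rw [laplacian_eq_sum_of_hasDerivAt (f := cutCoherent χ ε ξ)
    (D := fun i x => (((deriv χ (ε * ‖x‖ ^ 2) : ℝ) : ℂ) * (2 * ε * (x i : ℝ))
      + ((χ (ε * ‖x‖ ^ 2) : ℝ) : ℂ) * (ξ i * Complex.I - (x i : ℝ))) * coherent ξ x)
    (D2 := fun i x => (4 * ε ^ 2 * (x i) ^ 2 * deriv (deriv χ) (ε * ‖x‖ ^ 2)
      + 2 * ε * deriv χ (ε * ‖x‖ ^ 2)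
      + 4 * ε * deriv χ (ε * ‖x‖ ^ 2) * (x i * (ξ i * Complex.I - x i))
      + χ (ε * ‖x‖ ^ 2) * ((ξ i * Complex.I - x i) ^ 2 - 1)) * coherent ξ x)
    (by exact_mod_cast contDiff_infty.1 (contDiff_cutCoherent hχ ε ξ) 2) ?_ ?_ x]
  · rw [← Finset.sum_mul]
    congr 1
    have hx : ((‖x‖ : ℂ)) ^ 2 = ∑ i, ((x i : ℝ) : ℂ) ^ 2 := by
      have := EuclideanSpace.real_norm_sq_eq x
      exact_mod_cast this
    have hξ : ((‖ξ‖ : ℂ)) ^ 2 = ∑ i, ((ξ i : ℝ) : ℂ) ^ 2 := by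
      have := EuclideanSpace.real_norm_sq_eq ξ
      exact_mod_cast this
    have hi : ((inner ℝ ξ x : ℝ) : ℂ) = ∑ i, ((ξ i : ℝ) : ℂ) * (x i : ℝ) := by
      rw [PiLp.inner_apply]
      push_cast
      refine Finset.sum_congr rfl fun i _ => ?_
      simp [mul_comm]
    have hone : (n : ℂ) = ∑ _i : Fin n, (1 : ℂ) := by simp
    rw [hx, hξ, hi, hone]
    simp only [Finset.mul_sum, Finset.sum_mul, ← Finset.sum_add_distrib, ← Finset.sum_sub_distrib]
    refine Finset.sum_congr rfl fun i _ => ?_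
    linear_combination (((χ (ε * ‖x‖ ^ 2) : ℝ) : ℂ) * (ξ i : ℂ) ^ 2) * Complex.I_sq
  · intro i x
    refine ((hcomp hχ1 i x).mul (hasDerivAt_coherent_line ξ i x)).congr_deriv ?_
    simp only [zero_smul, add_zero]
    push_cast
    ring
  · intro i x
    have hx := (hasDerivAt_coord_line i x).ofReal_comp
    have h1 := (hcomp hχ2 i x).mul (hx.const_mul (2 * (ε : ℂ)))
    have h2 := (hcomp hχ1 i x).mul ((hx.const_sub ((ξ i : ℂ) * Complex.I)))
    refine ((h1.add h2).mul (hasDerivAt_coherent_line ξ i x)).congr_deriv ?_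
    simp only [zero_smul, add_zero, Pi.add_apply, Pi.mul_apply]
    push_cast
    ring

end Coherent

/-! ### Coherent states as test functions for the Hermite operator. -/

section CoherentWeak

open Filter Topology

variable {n : ℕ}

theorem memLp_of_le_gaussianAt {F : Rn n → ℂ} (hF : Measurable F) {C : ℝ}
    (hC : ∀ x, ‖F x‖ ≤ C * gaussianAt (1 / 4) 0 x) : MemLp F 2 := by
  refine ((memLp_gaussianAt (n := n) (b := 1 / 4) (by norm_num) 0).const_mul C).mono
    hF.aestronglyMeasurable (.of_forall fun x => ?_)
  exact (hC x).trans (le_abs_self _)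

theorem tendsto_integral_mul_of_le_gaussianAt (u : L2 n) {ι : Type*} {l : Filter ι}
    [l.IsCountablyGenerated] {F : ι → Rn n → ℂ} {F₀ : Rn n → ℂ} {C : ℝ}
    (hF : ∀ᶠ ε in l, Measurable (F ε))
    (hC : ∀ᶠ ε in l, ∀ x, ‖F ε x‖ ≤ C * gaussianAt (1 / 4) 0 x)
    (hlim : ∀ x, Tendsto (fun ε => F ε x) l (𝓝 (F₀ x))) :
    Tendsto (fun ε => ∫ x, u x * F ε x) l (𝓝 (∫ x, u x * F₀ x)) := by
  refine tendsto_integral_filter_of_dominated_convergence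
    (fun x => ‖u x‖ * (C * gaussianAt (1 / 4) 0 x)) ?_ ?_ ?_ ?_
  · filter_upwards [hF] with ε hε
    exact (Lp.aestronglyMeasurable u).mul hε.aestronglyMeasurable
  · filter_upwards [hC] with ε hε
    refine .of_forall fun x => ?_
    rw [norm_mul]
    exact mul_le_mul_of_nonneg_left (hε x) (norm_nonneg _)
  · exact (Lp.memLp u).norm.integrable_mul
      ((memLp_gaussianAt (n := n) (b := 1 / 4) (by norm_num) 0).const_mul C)
  · exact .of_forall fun x => (hlim x).const_mul _

theorem exists_cutoff : ∃ χ : ℝ → ℝ, ContDiff ℝ ∞ χ ∧ HasCompactSupport χ ∧ χ 0 = 1 := by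
  obtain ⟨χ, -, h1, h2, -, h3⟩ := exists_contDiff_tsupport_subset (E := ℝ) (s := Set.univ)
    (x := 0) (n := ⊤) univ_mem
  exact ⟨χ, h2, h1, h3⟩

/-- `-Δ f + |x|² f = g` weakly implies the same identity against the coherent states, which
do not have compact support. -/
theorem integral_mul_coherent_eq {u g : L2 n}
    (h : (u, g) ∈ schrodingerGraph fun x : Rn n => ‖x‖ ^ 2) (ξ : Rn n) :
    ∫ x, g x * coherent ξ x = ∫ x, u x *
      ((n + ‖ξ‖ ^ 2 + 2 * ((inner ℝ ξ x : ℝ) * Complex.I) : ℂ) * coherent ξ x) := by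
  obtain ⟨χ, hχ, hc, h0⟩ := exists_cutoff
  have hχ' : ContDiff ℝ ∞ (deriv χ) := (contDiff_infty_iff_deriv.1 hχ).2
  have hχ'' : ContDiff ℝ ∞ (deriv (deriv χ)) := (contDiff_infty_iff_deriv.1 hχ').2
  obtain ⟨M₀, hM₀⟩ := hc.exists_bound_of_continuous hχ.continuous
  obtain ⟨M₁, hM₁⟩ := hc.deriv.exists_bound_of_continuous hχ'.continuous
  obtain ⟨M₂, hM₂⟩ := hc.deriv.deriv.exists_bound_of_continuous hχ''.continuous
  set M := max M₀ (max M₁ M₂)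
  have hb0 : ∀ s, ‖(χ s : ℂ)‖ ≤ M := fun s => by
    rw [Complex.norm_real]; exact (hM₀ s).trans (le_max_left _ _)
  have hb1 : ∀ s, ‖((deriv χ s : ℝ) : ℂ)‖ ≤ M := fun s => by
    rw [Complex.norm_real]; exact (hM₁ s).trans ((le_max_left _ _).trans (le_max_right _ _))
  have hb2 : ∀ s, ‖((deriv (deriv χ) s : ℝ) : ℂ)‖ ≤ M := fun s => by
    rw [Complex.norm_real]; exact (hM₂ s).trans ((le_max_right _ _).trans (le_max_right _ _))
  have hM : 0 ≤ M := (norm_nonneg _).trans (hb0 0)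
  have hε : ∀ᶠ ε : ℝ in 𝓝[>] 0, 0 < ε ∧ ε ≤ 1 := by
    filter_upwards [self_mem_nhdsWithin, nhdsWithin_le_nhds (Iic_mem_nhds one_pos)] with ε h1 h2
    exact ⟨h1, h2⟩
  have hlim0 : Tendsto (fun ε : ℝ => ε) (𝓝[>] 0) (𝓝 0) := nhdsWithin_le_nhds
  have harg : ∀ (η : ℝ → ℝ) (_ : Continuous η) (x : Rn n),
      Tendsto (fun ε : ℝ => ((η (ε * ‖x‖ ^ 2) : ℝ) : ℂ)) (𝓝[>] 0) (𝓝 (η 0 : ℂ)) := by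
    intro η hη x
    have : Continuous fun ε : ℝ => ((η (ε * ‖x‖ ^ 2) : ℝ) : ℂ) := by fun_prop
    simpa using (this.tendsto 0).mono_left nhdsWithin_le_nhds
  have hmc : Measurable (coherent (n := n) ξ) := (contDiff_coherent ξ).continuous.measurable
  have hcut : ∀ ε, Measurable (cutCoherent (n := n) χ ε ξ) := fun ε =>
    (contDiff_cutCoherent hχ ε ξ).continuous.measurable
  have hcoh : ∀ x : Rn n, ‖coherent ξ x‖ ≤ 4 * gaussianAt (1 / 4) 0 x := fun x =>
    (le_mul_of_one_le_left (norm_nonneg _) (by nlinarith [sq_nonneg ‖x‖])).trans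
      (one_add_mul_norm_coherent_le ξ x)
  have hcoh' : ∀ x : Rn n, ‖x‖ ^ 2 * ‖coherent ξ x‖ ≤ 4 * gaussianAt (1 / 4) 0 x := fun x => by
    refine le_trans ?_ (one_add_mul_norm_coherent_le ξ x)
    gcongr
    linarith
  have L1 : Tendsto (fun ε => ∫ x, g x * cutCoherent χ ε ξ x) (𝓝[>] 0)
      (𝓝 (∫ x, g x * coherent ξ x)) := by
    refine tendsto_integral_mul_of_le_gaussianAt g (C := M * 4) (.of_forall hcut)
      (.of_forall fun ε x => ?_) fun x => ?_
    · rw [cutCoherent, norm_mul, mul_assoc]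
      exact mul_le_mul (hb0 _) (hcoh x) (norm_nonneg _) hM
    · simpa [h0, cutCoherent] using (harg χ hχ.continuous x).mul_const (coherent ξ x)
  have L2' : Tendsto (fun ε => ∫ x, u x * ((‖x‖ ^ 2 : ℝ) * cutCoherent χ ε ξ x)) (𝓝[>] 0)
      (𝓝 (∫ x, u x * ((‖x‖ ^ 2 : ℝ) * coherent ξ x))) := by
    refine tendsto_integral_mul_of_le_gaussianAt u (C := M * 4)
      (.of_forall fun ε => Measurable.mul (by fun_prop) (hcut ε)) (.of_forall fun ε x => ?_)
      fun x => ?_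
    · rw [cutCoherent, norm_mul, norm_mul, Complex.norm_real, norm_pow, norm_norm, mul_left_comm,
        mul_assoc]
      exact mul_le_mul (hb0 _) (hcoh' x) (by positivity) hM
    · have := ((harg χ hχ.continuous x).mul_const (coherent ξ x)).const_mul ((‖x‖ ^ 2 : ℝ) : ℂ)
      simpa [h0, cutCoherent] using this
  have L3 : Tendsto (fun ε => ∫ x, u x * (-Laplacian.laplacian (cutCoherent χ ε ξ) x)) (𝓝[>] 0)
      (𝓝 (∫ x, u x * (-((‖x‖ ^ 2 - ‖ξ‖ ^ 2 - 2 * ((inner ℝ ξ x : ℝ) * Complex.I) - n : ℂ)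
        * coherent ξ x)))) := by
    -- With `|ξ·x| ≤ |ξ|² + |x|²` the four groups of terms add up to `M (15|x|² + 3n + 7|ξ|²)`; the
    -- factor `4` is that of `one_add_mul_norm_coherent_le`.
    refine tendsto_integral_mul_of_le_gaussianAt u (C := M * (15 + 3 * n + 7 * ‖ξ‖ ^ 2) * 4)
      ?_ ?_ fun x => ?_
    · filter_upwards [hε] with ε hε
      exact (isTestFunction_cutCoherent hχ hc hε.1 ξ).laplacian.1.continuous.measurable.neg
    · filter_upwards [hε] with ε hε x
      rw [norm_neg, laplacian_cutCoherent hχ, norm_mul]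
      set b := ‖x‖ ^ 2 with hbdef
      set a := ‖ξ‖ ^ 2 with hadef
      set L : ℝ := inner ℝ ξ x with hL
      have hb : 0 ≤ b := by positivity
      have ha : 0 ≤ a := by positivity
      have hLb : ‖(L : ℂ) * Complex.I‖ ≤ a + b := by
        rw [norm_mul, Complex.norm_I, mul_one, Complex.norm_real]
        refine (norm_inner_le_norm _ _).trans ?_
        nlinarith [sq_nonneg (‖ξ‖ - ‖x‖), sq_nonneg ‖ξ‖, sq_nonneg ‖x‖]
      have nε : ‖(ε : ℂ)‖ ≤ 1 := by
        rw [Complex.norm_real, Real.norm_of_nonneg hε.1.le]; exact hε.2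
      have nb : ‖((‖x‖ : ℝ) : ℂ) ^ 2‖ = b := by simp [hbdef]
      have na : ‖((‖ξ‖ : ℝ) : ℂ) ^ 2‖ = a := by simp [hadef]
      have n4 : ‖(4 : ℂ)‖ = 4 := by simp
      have n2 : ‖(2 : ℂ)‖ = 2 := by simp
      have nn : ‖(n : ℂ)‖ = n := by simp
      have t1 : ‖(4 : ℂ) * ε ^ 2 * ‖x‖ ^ 2 * deriv (deriv χ) (ε * b)‖ ≤ 4 * 1 ^ 2 * b * M := by
        rw [norm_mul, norm_mul, norm_mul, nb, n4, norm_pow]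
        have := hb2 (ε * b)
        gcongr
      have t2 : ‖(2 : ℂ) * n * ε * deriv χ (ε * b)‖ ≤ 2 * n * 1 * M := by
        rw [norm_mul, norm_mul, norm_mul, n2, nn]
        have := hb1 (ε * b)
        gcongr
      have t3 : ‖(4 : ℂ) * ε * deriv χ (ε * b) * (L * Complex.I - ‖x‖ ^ 2)‖
          ≤ 4 * 1 * M * ((a + b) + b) := by
        rw [norm_mul, norm_mul, norm_mul, n4]
        have h1 := hb1 (ε * b)
        have h2 := (norm_sub_le ((L : ℂ) * Complex.I) (((‖x‖ : ℝ) : ℂ) ^ 2)).trans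
          (add_le_add hLb nb.le)
        gcongr
      have t4 : ‖(χ (ε * b) : ℂ) * (‖x‖ ^ 2 - ‖ξ‖ ^ 2 - 2 * (L * Complex.I) - n)‖
          ≤ M * (b + a + 2 * (a + b) + n) := by
        rw [norm_mul]
        have h1 := hb0 (ε * b)
        have h2 : ‖((‖x‖ : ℝ) : ℂ) ^ 2 - ((‖ξ‖ : ℝ) : ℂ) ^ 2 - 2 * (L * Complex.I) - n‖
            ≤ b + a + 2 * (a + b) + n := by
          refine (norm_sub_le _ _).trans (add_le_add ((norm_sub_le _ _).trans (add_le_add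
            ((norm_sub_le _ _).trans (add_le_add nb.le na.le)) ?_)) nn.le)
          rw [norm_mul, n2]
          gcongr
        gcongr
      have htot := (norm_add_le _ _).trans (add_le_add ((norm_add_le _ _).trans (add_le_add
        ((norm_add_le _ _).trans (add_le_add t1 t2)) t3)) t4)
      have hn0 : (0 : ℝ) ≤ n := Nat.cast_nonneg n
      have hfin : 4 * 1 ^ 2 * b * M + 2 * n * 1 * M + 4 * 1 * M * ((a + b) + b)
          + M * (b + a + 2 * (a + b) + n) ≤ M * (15 + 3 * n + 7 * a) * (1 + b) := by
        have : 0 ≤ M * (15 + 3 * n * b + 7 * a * b) := by positivity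
        nlinarith
      calc _ ≤ M * (15 + 3 * n + 7 * a) * (1 + b) * ‖coherent ξ x‖ :=
            mul_le_mul_of_nonneg_right (htot.trans hfin) (norm_nonneg _)
        _ = M * (15 + 3 * n + 7 * a) * ((1 + b) * ‖coherent ξ x‖) := by ring
        _ ≤ M * (15 + 3 * n + 7 * a) * (4 * gaussianAt (1 / 4) 0 x) :=
            mul_le_mul_of_nonneg_left (one_add_mul_norm_coherent_le ξ x) (by positivity)
        _ = _ := by ring
    · simp only [laplacian_cutCoherent hχ]
      have e0 := harg χ hχ.continuous x
      have e1 := harg _ hχ'.continuous x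
      have e2 := harg _ hχ''.continuous x
      have eε : Tendsto (fun ε : ℝ => (ε : ℂ)) (𝓝[>] 0) (𝓝 0) := by
        simpa [Function.comp_def] using (Complex.continuous_ofReal.tendsto 0).comp hlim0
      have := (((((eε.pow 2).const_mul 4).mul_const (((‖x‖ : ℝ) : ℂ) ^ 2)).mul e2).add
        ((eε.const_mul (2 * (n : ℂ))).mul e1)).add
        (((eε.const_mul 4).mul e1).mul_const
          (((inner ℝ ξ x : ℝ) : ℂ) * Complex.I - ((‖x‖ : ℝ) : ℂ) ^ 2)) |>.add
        (e0.mul_const (((‖x‖ : ℝ) : ℂ) ^ 2 - ((‖ξ‖ : ℝ) : ℂ) ^ 2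
          - 2 * (((inner ℝ ξ x : ℝ) : ℂ) * Complex.I) - n))
      have := (this.mul_const (coherent ξ x)).neg
      simpa [h0] using this
  have hid : ∀ᶠ ε in 𝓝[>] (0 : ℝ), (∫ x, u x * (-Laplacian.laplacian (cutCoherent χ ε ξ) x))
      + (∫ x, u x * ((‖x‖ ^ 2 : ℝ) * cutCoherent χ ε ξ x)) = ∫ x, g x * cutCoherent χ ε ξ x := by
    filter_upwards [hε] with ε hε
    rw [← h.2 _ (isTestFunction_cutCoherent hχ hc hε.1 ξ)]
    congr 1
    refine integral_congr_ae (.of_forall fun x => ?_)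
    simp only
    ring
  have hfin := tendsto_nhds_unique L1 ((L3.add L2').congr' hid)
  have i1 : Integrable fun x => u x * (-((‖x‖ ^ 2 - ‖ξ‖ ^ 2
      - 2 * ((inner ℝ ξ x : ℝ) * Complex.I) - n : ℂ) * coherent ξ x)) := by
    refine (Lp.memLp u).integrable_mul (memLp_of_le_gaussianAt (C := (3 + n + 3 * ‖ξ‖ ^ 2) * 4)
      (Measurable.neg (Measurable.mul (Continuous.measurable (by fun_prop)) hmc)) fun x => ?_)
    have hLb : ‖((inner ℝ ξ x : ℝ) : ℂ) * Complex.I‖ ≤ ‖ξ‖ ^ 2 + ‖x‖ ^ 2 := by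
      rw [norm_mul, Complex.norm_I, mul_one, Complex.norm_real]
      refine (norm_inner_le_norm _ _).trans ?_
      nlinarith [sq_nonneg (‖ξ‖ - ‖x‖), sq_nonneg ‖ξ‖, sq_nonneg ‖x‖]
    have h2 : ‖((‖x‖ : ℝ) : ℂ) ^ 2 - ((‖ξ‖ : ℝ) : ℂ) ^ 2 - 2 * ((inner ℝ ξ x : ℝ) * Complex.I) - n‖
        ≤ ‖x‖ ^ 2 + ‖ξ‖ ^ 2 + 2 * (‖ξ‖ ^ 2 + ‖x‖ ^ 2) + n := by
      refine (norm_sub_le _ _).trans (add_le_add ((norm_sub_le _ _).trans (add_le_add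
        ((norm_sub_le _ _).trans (add_le_add (by simp) (by simp))) ?_)) (by simp))
      rw [norm_mul, Complex.norm_ofNat]
      gcongr
    rw [norm_neg, norm_mul]
    calc _ ≤ (3 + n + 3 * ‖ξ‖ ^ 2) * (1 + ‖x‖ ^ 2) * ‖coherent ξ x‖ := by
          refine mul_le_mul_of_nonneg_right (h2.trans ?_) (norm_nonneg _)
          have : 0 ≤ 3 + n * ‖x‖ ^ 2 + 3 * ‖ξ‖ ^ 2 * ‖x‖ ^ 2 := by positivity
          nlinarith
      _ = (3 + n + 3 * ‖ξ‖ ^ 2) * ((1 + ‖x‖ ^ 2) * ‖coherent ξ x‖) := by ring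
      _ ≤ (3 + n + 3 * ‖ξ‖ ^ 2) * (4 * gaussianAt (1 / 4) 0 x) :=
          mul_le_mul_of_nonneg_left (one_add_mul_norm_coherent_le ξ x) (by positivity)
      _ = _ := by ring
  have i2 : Integrable fun x => u x * ((‖x‖ ^ 2 : ℝ) * coherent ξ x) := by
    refine (Lp.memLp u).integrable_mul (memLp_of_le_gaussianAt (C := 4)
      (Measurable.mul (by fun_prop) hmc) fun x => ?_)
    rw [norm_mul, Complex.norm_real, norm_pow, norm_norm]
    exact hcoh' x
  -- The `|x|²` from `-Δ` cancels the potential, which leaves a coefficient that is affine in `x`.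
  rw [hfin, ← integral_add i1 i2]
  refine integral_congr_ae (.of_forall fun x => ?_)
  push_cast
  ring

end CoherentWeak

/-! ### The explicit heat evolution of coherent states. -/

section CoherentFlow

open Filter Topology

variable {n : ℕ}

theorem measurable_coherent (ξ : Rn n) : Measurable (coherent ξ) :=
  (contDiff_coherent ξ).continuous.measurable

theorem norm_coherent_le (ξ x : Rn n) : ‖coherent ξ x‖ ≤ 4 * gaussianAt (1 / 4) 0 x :=
  (le_mul_of_one_le_left (norm_nonneg _) (by nlinarith [sq_nonneg ‖x‖])).trans
    (one_add_mul_norm_coherent_le ξ x)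

theorem memLp_coherent (ξ : Rn n) : MemLp (coherent ξ) 2 :=
  memLp_of_le_gaussianAt (measurable_coherent ξ) (norm_coherent_le ξ)

/-- The derivative of `e^{i ξ·x - |x|²/2}` in `ξ` along `η`. -/
def coherentDeriv (ξ η x : Rn n) : ℂ := ((inner ℝ η x : ℝ) * Complex.I) * coherent ξ x

theorem memLp_coherentDeriv (ξ η : Rn n) : MemLp (coherentDeriv ξ η) 2 := by
  refine memLp_of_le_gaussianAt (C := (1 + ‖η‖ ^ 2) * 4)
    (Measurable.mul (by fun_prop) (measurable_coherent ξ)) fun x => ?_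
  rw [coherentDeriv, norm_mul, norm_mul, Complex.norm_I, mul_one, Complex.norm_real, mul_assoc]
  have h1 : ‖inner ℝ η x‖ ≤ (1 + ‖η‖ ^ 2) * (1 + ‖x‖ ^ 2) := by
    refine (norm_inner_le_norm _ _).trans ?_
    nlinarith [sq_nonneg (‖η‖ - ‖x‖), sq_nonneg (‖η‖ * ‖x‖)]
  calc ‖inner ℝ η x‖ * ‖coherent ξ x‖ ≤ (1 + ‖η‖ ^ 2) * (1 + ‖x‖ ^ 2) * ‖coherent ξ x‖ := by gcongr
    _ = (1 + ‖η‖ ^ 2) * ((1 + ‖x‖ ^ 2) * ‖coherent ξ x‖) := by ring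
    _ ≤ _ := mul_le_mul_of_nonneg_left (one_add_mul_norm_coherent_le ξ x) (by positivity)

/-- `coherent ξ` as an element of `L²`. -/
def coherentLp (ξ : Rn n) : L2 n := (memLp_coherent ξ).toLp _

/-- `coherentDeriv ξ η` as an element of `L²`. -/
def coherentDerivLp (ξ η : Rn n) : L2 n := (memLp_coherentDeriv ξ η).toLp _

theorem coeFn_coherentLp (ξ : Rn n) : coherentLp ξ =ᵐ[volume] coherent ξ := MemLp.coeFn_toLp _

theorem coeFn_coherentDerivLp (ξ η : Rn n) :
    coherentDerivLp ξ η =ᵐ[volume] coherentDeriv ξ η := MemLp.coeFn_toLp _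

theorem norm_exp_sub_one_sub_le (θ : ℝ) :
    ‖Complex.exp (θ * Complex.I) - 1 - θ * Complex.I‖ ≤ 3 * θ ^ 2 := by
  have hn : ‖(θ : ℂ) * Complex.I‖ = |θ| := by simp
  by_cases h : |θ| ≤ 1
  · refine (Complex.norm_exp_sub_one_sub_id_le (by rw [hn]; exact h)).trans ?_
    rw [hn, sq_abs]
    nlinarith [sq_nonneg θ]
  · have h1 := (norm_sub_le (Complex.exp (θ * Complex.I) - 1) (θ * Complex.I)).trans
      (add_le_add (norm_sub_le _ _) le_rfl)
    rw [Complex.norm_exp_ofReal_mul_I, norm_one, hn] at h1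
    rw [← sq_abs]
    nlinarith [not_le.1 h]

/-- With `θ = r ξ·x`, the Taylor remainder of `e^{iθ}` is at most `3θ²`. The Gaussian absorbs
`|x|²`, so the remainder is of order `r²` in `L²`. -/
theorem hasDerivAt_coherentLp (ξ : Rn n) (s : ℝ) :
    HasDerivAt (fun s : ℝ => coherentLp (s • ξ)) (coherentDerivLp (s • ξ) ξ) s := by
  have hg : MemLp (fun x : Rn n => gaussianAt (1 / 4) 0 x) 2 := memLp_gaussianAt (by norm_num) 0
  rw [hasDerivAt_iff_isLittleO_nhds_zero]
  have key : ∀ r : ℝ, ‖coherentLp ((s + r) • ξ) - coherentLp (s • ξ)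
      - r • coherentDerivLp (s • ξ) ξ‖ ≤ 12 * ‖ξ‖ ^ 2 * ‖hg.toLp _‖ * ‖r ^ 2‖ := by
    intro r
    have h : ‖coherentLp ((s + r) • ξ) - coherentLp (s • ξ) - r • coherentDerivLp (s • ξ) ξ‖
        ≤ 12 * ‖ξ‖ ^ 2 * r ^ 2 * ‖hg.toLp _‖ := by
      refine Lp.norm_le_mul_norm_of_ae_le_mul ?_
      filter_upwards [Lp.coeFn_sub (coherentLp ((s + r) • ξ) - coherentLp (s • ξ))
        (r • coherentDerivLp (s • ξ) ξ), Lp.coeFn_sub (coherentLp ((s + r) • ξ))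
        (coherentLp (s • ξ)), Lp.coeFn_smul r (coherentDerivLp (s • ξ) ξ),
        coeFn_coherentLp ((s + r) • ξ), coeFn_coherentLp (s • ξ),
        coeFn_coherentDerivLp (s • ξ) ξ, hg.coeFn_toLp] with x e1 e2 e3 e4 e5 e6 e7
      rw [e1, Pi.sub_apply, e2, Pi.sub_apply, e3, Pi.smul_apply, e4, e5, e6, e7,
        Real.norm_of_nonneg (gaussianAt_pos _ _ _).le]
      have e8 : coherent ((s + r) • ξ) x - coherent (s • ξ) x - r • coherentDeriv (s • ξ) ξ x
          = (Complex.exp ((r * inner ℝ ξ x : ℝ) * Complex.I) - 1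
            - (r * inner ℝ ξ x : ℝ) * Complex.I) * coherent (s • ξ) x := by
        have : coherent ((s + r) • ξ) x
            = Complex.exp ((r * inner ℝ ξ x : ℝ) * Complex.I) * coherent (s • ξ) x := by
          rw [coherent, coherent, ← Complex.exp_add, inner_smul_left, inner_smul_left]
          congr 1
          simp only [conj_trivial]
          push_cast
          ring
        rw [this, coherentDeriv, Complex.real_smul]
        push_cast
        ring
      rw [e8, norm_mul]
      have h2 : (inner ℝ ξ x) ^ 2 ≤ ‖ξ‖ ^ 2 * ‖x‖ ^ 2 := by
        rw [← mul_pow, ← sq_abs]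
        have := abs_real_inner_le_norm ξ x
        gcongr
      have h3 : 3 * (r * inner ℝ ξ x) ^ 2 ≤ 3 * ‖ξ‖ ^ 2 * r ^ 2 * (1 + ‖x‖ ^ 2) := by
        have h4 : r ^ 2 * (inner ℝ ξ x) ^ 2 ≤ r ^ 2 * (‖ξ‖ ^ 2 * ‖x‖ ^ 2) := by gcongr
        have h5 : 0 ≤ r ^ 2 * ‖ξ‖ ^ 2 := by positivity
        nlinarith
      calc _ ≤ 3 * ‖ξ‖ ^ 2 * r ^ 2 * (1 + ‖x‖ ^ 2) * ‖coherent (s • ξ) x‖ :=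
            mul_le_mul_of_nonneg_right ((norm_exp_sub_one_sub_le _).trans h3) (norm_nonneg _)
        _ = 3 * ‖ξ‖ ^ 2 * r ^ 2 * ((1 + ‖x‖ ^ 2) * ‖coherent (s • ξ) x‖) := by ring
        _ ≤ 3 * ‖ξ‖ ^ 2 * r ^ 2 * (4 * gaussianAt (1 / 4) 0 x) :=
            mul_le_mul_of_nonneg_left (one_add_mul_norm_coherent_le _ x) (by positivity)
        _ = _ := by ring
    rw [norm_pow, Real.norm_eq_abs, sq_abs]
    linarith
  refine (Asymptotics.IsBigO.of_bound _ (.of_forall key)).trans_isLittleO ?_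
  exact Asymptotics.isLittleO_pow_id one_lt_two

theorem inner_coherentLp (ξ : Rn n) (f : L2 n) :
    inner ℂ (coherentLp ξ) f = ∫ x, f x * coherent (-ξ) x := by
  rw [L2.inner_def]
  refine integral_congr_ae ?_
  filter_upwards [coeFn_coherentLp ξ] with x hx
  rw [hx, RCLike.inner_apply, ← star_coherent]
  rfl

/-- `w = e^{-2t}` and the curve `e^{-nt} e_{wξ}`, where `e_ξ = e^{|ξ|²/4} coherent ξ`. -/
def flowCoeff (ξ : Rn n) (t : ℝ) : ℝ :=
  Real.exp (-(n * t) + Real.exp (-2 * t) ^ 2 * ‖ξ‖ ^ 2 / 4)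

/-- The evolution of a coherent state under the Hermite semigroup. -/
def coherentFlow (ξ : Rn n) (t : ℝ) : L2 n :=
  (flowCoeff ξ t : ℂ) • coherentLp (Real.exp (-2 * t) • ξ)

/-- The Hermite operator applied to `coherentFlow ξ t`. -/
def coherentFlowImage (ξ : Rn n) (t : ℝ) : L2 n :=
  (flowCoeff ξ t : ℂ) • (((n + Real.exp (-2 * t) ^ 2 * ‖ξ‖ ^ 2 : ℝ) : ℂ) •
      coherentLp (Real.exp (-2 * t) • ξ)
    + ((2 * Real.exp (-2 * t) : ℝ) : ℂ) • coherentDerivLp (Real.exp (-2 * t) • ξ) ξ)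

/-- The ansatz `κ(t) e^{iw(t) ξ·x - |x|²/2}` solves the heat equation iff `w' = -2w` and `κ' = -κ (n
+ w²|ξ|²)`; the two exponentials in the definition solve these equations. -/
theorem hasDerivAt_coherentFlow (ξ : Rn n) (t : ℝ) :
    HasDerivAt (coherentFlow ξ) (-coherentFlowImage ξ t) t := by
  have hw : HasDerivAt (fun t : ℝ => Real.exp (-2 * t)) (Real.exp (-2 * t) * (-2)) t := by
    have h : HasDerivAt (fun t : ℝ => -2 * t) (-2) t := by
      simpa using (hasDerivAt_id t).const_mul (-2)
    exact h.exp
  have hK : HasDerivAt (flowCoeff ξ)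
      (flowCoeff ξ t * -(n + Real.exp (-2 * t) ^ 2 * ‖ξ‖ ^ 2)) t := by
    have h1 := (((hasDerivAt_id t).const_mul (n : ℝ)).fun_neg.add
      (((hw.fun_pow 2).mul_const (‖ξ‖ ^ 2)).div_const 4)).exp
    refine h1.congr_deriv ?_
    simp only [flowCoeff, Pi.add_apply, id]
    push_cast
    ring
  have h := (hK.ofReal_comp).smul ((hasDerivAt_coherentLp ξ (Real.exp (-2 * t))).scomp t hw)
  refine h.congr_deriv ?_
  simp only [coherentFlowImage, Function.comp_apply]
  generalize Real.exp (-2 * t) = w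
  have e : (w * -2) • coherentDerivLp (w • ξ) ξ
      = ((w * -2 : ℝ) : ℂ) • coherentDerivLp (w • ξ) ξ := (Complex.coe_smul _ _).symm
  rw [e]
  push_cast
  module

theorem inner_coherentFlow (ξ : Rn n) (t : ℝ) {u g : L2 n} (h : (u, g) ∈ (hermiteOp n).graph) :
    inner ℂ (coherentFlow ξ t) g = inner ℂ (coherentFlowImage ξ t) u := by
  rw [hermiteOp, graph_schrodingerOp] at h
  rw [coherentFlow, coherentFlowImage, inner_smul_left, inner_smul_left]
  congr 1
  have hw : 0 < Real.exp (-2 * t) := Real.exp_pos _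
  generalize Real.exp (-2 * t) = w at hw
  rw [inner_coherentLp, integral_mul_coherent_eq h, L2.inner_def]
  refine integral_congr_ae ?_
  filter_upwards [Lp.coeFn_add (((n + w ^ 2 * ‖ξ‖ ^ 2 : ℝ) : ℂ) • coherentLp (w • ξ))
      (((2 * w : ℝ) : ℂ) • coherentDerivLp (w • ξ) ξ),
    Lp.coeFn_smul ((n + w ^ 2 * ‖ξ‖ ^ 2 : ℝ) : ℂ) (coherentLp (w • ξ)),
    Lp.coeFn_smul ((2 * w : ℝ) : ℂ) (coherentDerivLp (w • ξ) ξ),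
    coeFn_coherentLp (w • ξ), coeFn_coherentDerivLp (w • ξ) ξ] with x e1 e2 e3 e4 e5
  rw [e1, Pi.add_apply, e2, e3, Pi.smul_apply, Pi.smul_apply, e4, e5, RCLike.inner_apply,
    coherentDeriv]
  have hs : (starRingEnd ℂ) (coherent (w • ξ) x) = coherent (-(w • ξ)) x := star_coherent _ _
  simp only [smul_eq_mul, map_add, map_mul, Complex.conj_ofReal, Complex.conj_I, hs, norm_neg,
    norm_smul, inner_neg_left, inner_smul_left, conj_trivial, Real.norm_eq_abs, abs_of_pos hw]
  push_cast
  ring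

open scoped FourierTransform in
-- The inner products are values of the Fourier transform of `e^{-|x|²/2} f`, which is in `L¹`.
-- Pairing with inverse transforms of test functions shows that this function vanishes, and the
-- Gaussian has no zeros.
theorem eq_zero_of_forall_inner_coherentLp {f : L2 n}
    (h : ∀ ξ, inner ℂ (coherentLp ξ) f = 0) : f = 0 := by
  set F : Rn n → ℂ := fun x => coherent 0 x * f x with hF
  have hFi : Integrable F := (memLp_coherent 0).integrable_mul (Lp.memLp f)
  have hF0 : 𝓕 F = 0 := by
    funext η
    rw [Real.fourier_eq', Pi.zero_apply, ← h ((2 * Real.pi) • η), inner_coherentLp]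
    refine integral_congr_ae (.of_forall fun x => ?_)
    simp only [hF, smul_eq_mul, coherent, ← mul_assoc, ← Complex.exp_add]
    rw [mul_comm]
    congr 2
    rw [inner_neg_left, inner_smul_left, real_inner_comm, inner_zero_left]
    simp only [conj_trivial]
    push_cast
    ring
  have hae : ∀ᵐ x, F x = 0 := by
    refine ae_eq_zero_of_integral_contDiff_smul_eq_zero hFi.locallyIntegrable fun ψ hψ hψc => ?_
    have hψ' : ContDiff ℝ ∞ fun x => (ψ x : ℂ) := Complex.ofRealCLM.contDiff.comp hψ
    have hψc' : HasCompactSupport fun x => (ψ x : ℂ) :=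
      hψc.comp_left (g := fun r : ℝ => (r : ℂ)) (by simp)
    set S : SchwartzMap (Rn n) ℂ := hψc'.toSchwartzMap hψ' with hS
    have h1 := VectorFourier.integral_fourierIntegral_smul_eq_flip (L := innerₗ (Rn n))
      (e := Real.fourierChar) (μ := volume) (ν := volume) (f := F) (g := ⇑(𝓕⁻ S : SchwartzMap (Rn n) ℂ))
      Real.continuous_fourierChar continuous_inner hFi (𝓕⁻ S : SchwartzMap (Rn n) ℂ).integrable
    rw [flip_innerₗ] at h1
    have h2 : VectorFourier.fourierIntegral Real.fourierChar volume (innerₗ (Rn n)) F = 0 := hF0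
    have h3 : VectorFourier.fourierIntegral Real.fourierChar volume (innerₗ (Rn n))
        (⇑(𝓕⁻ S : SchwartzMap (Rn n) ℂ))
        = fun x => (ψ x : ℂ) := by
      have h4 : 𝓕 (𝓕⁻ S : SchwartzMap (Rn n) ℂ) = S := FourierTransform.fourier_fourierInv_eq S
      funext x
      have h5 := congrArg (fun T : SchwartzMap (Rn n) ℂ => T x) h4
      simp only [SchwartzMap.fourier_coe] at h5
      exact h5
    rw [h2, h3] at h1
    simp only [Pi.zero_apply, zero_smul, integral_zero] at h1
    rw [h1]
    refine integral_congr_ae (.of_forall fun x => ?_)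
    simp [mul_comm]
  refine Lp.eq_zero_iff_ae_eq_zero.2 ?_
  filter_upwards [hae] with x hx
  exact (mul_eq_zero.1 hx).resolve_left (Complex.exp_ne_zero _)

theorem dense_span_coherentFlow :
    Dense (Submodule.span ℂ (Set.range fun ξ : Rn n => coherentFlow ξ 0) : Set (L2 n)) := by
  rw [Submodule.dense_iff_topologicalClosure_eq_top, Submodule.topologicalClosure_eq_top_iff,
    Submodule.eq_bot_iff]
  intro f hf
  refine eq_zero_of_forall_inner_coherentLp fun ξ => ?_
  have h1 := (Submodule.mem_orthogonal _ f).1 hf _ (Submodule.subset_span ⟨ξ, rfl⟩)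
  simp only [coherentFlow, inner_smul_left, mul_zero, Real.exp_zero, one_smul] at h1
  refine (mul_eq_zero.1 h1).resolve_left ?_
  rw [Complex.conj_ofReal]
  exact Complex.ofReal_ne_zero.2 (Real.exp_pos _).ne'

end CoherentFlow

/-! ### Elementary bounds for `coth`. -/

section Coth

open Real

/-- The hyperbolic cotangent. -/
def coth (t : ℝ) : ℝ := Real.cosh t / Real.sinh t

variable {t : ℝ}

theorem sinh_le_mul_cosh (ht : 0 ≤ t) : Real.sinh t ≤ t * Real.cosh t := by
  have h := (convex_Icc 0 t).image_sub_le_mul_sub_of_deriv_le (f := Real.sinh)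
    Real.continuous_sinh.continuousOn Real.differentiable_sinh.differentiableOn
    (C := Real.cosh t) (fun x hx => by
      rw [interior_Icc] at hx
      rw [Real.deriv_sinh, Real.cosh_le_cosh, abs_of_pos hx.1, abs_of_nonneg ht]
      exact hx.2.le) 0 ⟨le_rfl, ht⟩ t ⟨ht, le_rfl⟩ ht
  simpa [mul_comm] using h

theorem inv_le_coth (ht : 0 < t) : t⁻¹ ≤ coth t := by
  have hS : 0 < Real.sinh t := Real.sinh_pos_iff.2 ht
  rw [coth, inv_le_iff_one_le_mul₀ ht, div_mul_eq_mul_div, one_le_div hS, mul_comm]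
  exact sinh_le_mul_cosh ht.le

theorem one_lt_coth (ht : 0 < t) : 1 < coth t := by
  rw [coth, one_lt_div (Real.sinh_pos_iff.2 ht)]
  exact Real.sinh_lt_cosh t

/-- `coth² - 1 = 1 / sinh²` and `sinh t ≥ t`. The next bound is similar, with `coth - tanh = 1 /
(sinh cosh)`. -/
theorem coth_sq_sub_one_le (ht : 0 < t) : coth t ^ 2 - 1 ≤ (t ^ 2)⁻¹ := by
  have hS : 0 < Real.sinh t := Real.sinh_pos_iff.2 ht
  have hle : t ≤ Real.sinh t := Real.self_le_sinh_iff.2 ht.le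
  have e : coth t ^ 2 - 1 = (Real.sinh t ^ 2)⁻¹ := by
    rw [coth, div_pow, Real.cosh_sq]
    field_simp
    ring
  rw [e]
  gcongr

theorem coth_sub_inv_le (ht : 0 < t) : coth t - (coth t)⁻¹ ≤ t⁻¹ := by
  have hS : 0 < Real.sinh t := Real.sinh_pos_iff.2 ht
  have hC := Real.cosh_pos t
  have hle : t ≤ Real.sinh t := Real.self_le_sinh_iff.2 ht.le
  have e : coth t - (coth t)⁻¹ = (Real.sinh t * Real.cosh t)⁻¹ := by
    have := Real.cosh_sq t
    rw [coth]
    field_simp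
    linarith
  rw [e]
  gcongr
  nlinarith [Real.one_le_cosh t]

/-- Links the frequency factor `e^{-2t}` of the flow with the parameter `a = coth t` of Mehler's
kernel. -/
theorem exp_neg_two_mul_eq (ht : 0 < t) : Real.exp (-2 * t) = (coth t - 1) / (coth t + 1) := by
  have hS : 0 < Real.sinh t := Real.sinh_pos_iff.2 ht
  have hC := Real.cosh_pos t
  have e1 : coth t - 1 = Real.exp (-t) / Real.sinh t := by
    rw [coth, ← Real.cosh_sub_sinh]
    field_simp
  have e2 : coth t + 1 = Real.exp t / Real.sinh t := by
    rw [coth, ← Real.cosh_add_sinh]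
    field_simp
  rw [e1, e2, div_div_div_cancel_right₀ hS.ne', ← Real.exp_sub]
  congr 1
  ring

end Coth

/-! ### Mehler's kernel: action on coherent states and gradient bound. -/

section Mehler

variable {n : ℕ}

/-- Mehler's kernel, the heat kernel of the Hermite operator at time `t`, where `a = coth t`. -/
def mehler (a : ℝ) (x y : Rn n) : ℝ :=
  ((a - a⁻¹) / (4 * Real.pi)) ^ ((n : ℝ) / 2) *
    Real.exp (-(a / 4) * ‖x - y‖ ^ 2 - (4 * a)⁻¹ * ‖x + y‖ ^ 2)

theorem mehler_nonneg {a : ℝ} (ha : 1 < a) (x y : Rn n) : 0 ≤ mehler a x y := by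
  have : 0 ≤ a - a⁻¹ := sub_nonneg.2 ((inv_le_one_of_one_le₀ ha.le).trans ha.le)
  rw [mehler]
  positivity

theorem mehler_comm (a : ℝ) (x y : Rn n) : mehler a x y = mehler a y x := by
  rw [mehler, mehler, norm_sub_rev, add_comm x y]

theorem gaussianKernel_mehler {a : ℝ} (ha : 1 < a) :
    GaussianKernel (n := n) ((4 * Real.pi)⁻¹ ^ ((n : ℝ) / 2)) (1 / 4) (Real.sqrt a)
      (fun x y => (mehler a x y : ℂ)) where
  A_nonneg := by positivity
  c_pos := by norm_num
  q_pos := Real.sqrt_pos.2 (by linarith)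
  meas := by
    simp only [Function.uncurry_def, mehler]
    fun_prop
  le x y := by
    have ha0 : 0 < a := by linarith
    have h1 : 0 ≤ a - a⁻¹ := sub_nonneg.2 ((inv_le_one_of_one_le₀ ha.le).trans ha.le)
    rw [Complex.norm_real, Real.norm_of_nonneg (mehler_nonneg ha x y), mehler, gaussianAt,
      Real.sq_sqrt ha0.le]
    have h2 : Real.sqrt a ^ n = a ^ ((n : ℝ) / 2) := by
      rw [Real.sqrt_eq_rpow, ← Real.rpow_natCast, ← Real.rpow_mul ha0.le]
      congr 1
      ring
    rw [h2, ← Real.mul_rpow (by positivity) ha0.le]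
    have h3 : (a - a⁻¹) / (4 * Real.pi) ≤ (4 * Real.pi)⁻¹ * a := by
      rw [div_eq_inv_mul]
      gcongr
      linarith [inv_pos.2 ha0]
    have h4 : -(a / 4) * ‖x - y‖ ^ 2 - (4 * a)⁻¹ * ‖x + y‖ ^ 2 ≤ -(1 / 4 * a) * ‖x - y‖ ^ 2 := by
      have : 0 ≤ (4 * a)⁻¹ * ‖x + y‖ ^ 2 := by positivity
      linarith
    gcongr

/-- A Gaussian integral. The exponent in `y` is `-β|y|² + c·y`, where `β = a/4 + 1/(4a) + 1/2 = (a +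
1)²/(4a)`, the `1/2` coming from the coherent state, and `c = (a - 1/a) x / 2 + iξ`. -/
theorem integral_mehler_coherent {a : ℝ} (ha : 1 < a) (ξ x : Rn n) :
    ∫ y, (mehler a x y : ℂ) * coherent ξ y
      = (((a - 1) / (a + 1)) ^ ((n : ℝ) / 2)
          * Real.exp ((((a - 1) / (a + 1)) ^ 2 - 1) * ‖ξ‖ ^ 2 / 4) : ℝ)
        * coherent (((a - 1) / (a + 1)) • ξ) x := by
  have ha0 : 0 < a := by linarith
  have ha1 : 0 < a - a⁻¹ := sub_pos.2 ((inv_lt_one_of_one_lt₀ ha).trans ha)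
  set β : ℝ := (a + 1) ^ 2 / (4 * a) with hβ
  have hβ0 : 0 < β := by positivity
  set c : Fin n → ℂ := fun i => ((a - a⁻¹) / 2 * x i : ℝ) + (ξ i : ℝ) * Complex.I with hc
  have hsq : ∀ z : Rn n, ((‖z‖ : ℝ) : ℂ) ^ 2 = ∑ i, ((z i : ℝ) : ℂ) ^ 2 := fun z => by
    have := EuclideanSpace.real_norm_sq_eq z
    exact_mod_cast this
  have hin : ∀ z : Rn n, ((inner ℝ ξ z : ℝ) : ℂ) = ∑ i, ((ξ i : ℝ) : ℂ) * (z i : ℝ) := fun z => by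
    rw [PiLp.inner_apply]
    push_cast
    refine Finset.sum_congr rfl fun i _ => ?_
    simp [mul_comm]
  have hG := GaussianFourier.integral_cexp_neg_mul_sum_add (b := (β : ℂ)) (by simpa using hβ0) c
  have hint : ∫ y : Rn n, Complex.exp (-(β : ℂ) * ∑ i, ((y i : ℝ) : ℂ) ^ 2
        + ∑ i, c i * ((y i : ℝ) : ℂ))
      = (Real.pi / β : ℂ) ^ (Fintype.card (Fin n) / 2 : ℂ)
        * Complex.exp ((∑ i, c i ^ 2) / (4 * β)) := by
    rw [← hG, ← (PiLp.volume_preserving_toLp (Fin n)).integral_comp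
      (MeasurableEquiv.toLp 2 _).measurableEmbedding]
  have hpt : ∀ y : Rn n, (mehler a x y : ℂ) * coherent ξ y
      = (((a - a⁻¹) / (4 * Real.pi)) ^ ((n : ℝ) / 2) : ℝ)
          * Complex.exp (-((a + a⁻¹) / 4 * ‖x‖ ^ 2 : ℝ))
        * Complex.exp (-(β : ℂ) * ∑ i, ((y i : ℝ) : ℂ) ^ 2 + ∑ i, c i * ((y i : ℝ) : ℂ)) := by
    intro y
    rw [mehler, coherent, Complex.ofReal_mul, Complex.ofReal_exp, mul_assoc, mul_assoc,
      ← Complex.exp_add, ← Complex.exp_add]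
    congr 2
    have h1 : ‖x - y‖ ^ 2 = ‖x‖ ^ 2 - 2 * inner ℝ x y + ‖y‖ ^ 2 := norm_sub_sq_real x y
    have h2 : ‖x + y‖ ^ 2 = ‖x‖ ^ 2 + 2 * inner ℝ x y + ‖y‖ ^ 2 := norm_add_sq_real x y
    have h3 : ∑ i, c i * ((y i : ℝ) : ℂ)
        = (((a - a⁻¹) / 2 : ℝ) : ℂ) * (inner ℝ x y : ℝ) + (inner ℝ ξ y : ℝ) * Complex.I := by
      rw [hin, PiLp.inner_apply]
      push_cast
      rw [Finset.mul_sum, Finset.sum_mul, ← Finset.sum_add_distrib]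
      refine Finset.sum_congr rfl fun i _ => ?_
      simp only [hc, RCLike.inner_apply, conj_trivial]
      push_cast
      ring
    rw [h1, h2, h3, ← hsq, hβ]
    have : (a : ℂ) ≠ 0 := Complex.ofReal_ne_zero.2 ha0.ne'
    push_cast
    field_simp
    ring
  have hpow : ((((a - a⁻¹) / (4 * Real.pi)) ^ ((n : ℝ) / 2) : ℝ) : ℂ)
      * (Real.pi / β : ℂ) ^ (Fintype.card (Fin n) / 2 : ℂ)
      = ((((a - 1) / (a + 1)) ^ ((n : ℝ) / 2) : ℝ) : ℂ) := by
    have h1 : (Real.pi / β : ℂ) ^ (Fintype.card (Fin n) / 2 : ℂ)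
        = (((Real.pi / β) ^ ((n : ℝ) / 2) : ℝ) : ℂ) := by
      rw [Complex.ofReal_cpow (by positivity)]
      simp
    rw [h1, ← Complex.ofReal_mul, ← Real.mul_rpow (by positivity) (by positivity)]
    congr 2
    rw [hβ]
    field_simp
    ring
  simp only [hpt]
  rw [integral_const_mul, hint, coherent, mul_mul_mul_comm, hpow,
    Complex.ofReal_mul (((a - 1) / (a + 1)) ^ ((n : ℝ) / 2)), Complex.ofReal_exp, mul_assoc,
    ← Complex.exp_add, ← Complex.exp_add]
  congr 2
  have h4 : ∑ i, c i ^ 2 = (((a - a⁻¹) / 2 : ℝ) : ℂ) ^ 2 * ((‖x‖ : ℝ) : ℂ) ^ 2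
      + ((a - a⁻¹ : ℝ) : ℂ) * (inner ℝ ξ x : ℝ) * Complex.I - ((‖ξ‖ : ℝ) : ℂ) ^ 2 := by
    rw [hsq, hsq, hin, Finset.mul_sum, Finset.mul_sum, Finset.sum_mul, ← Finset.sum_add_distrib,
      ← Finset.sum_sub_distrib]
    refine Finset.sum_congr rfl fun i _ => ?_
    simp only [hc]
    push_cast
    linear_combination ((ξ i : ℝ) : ℂ) ^ 2 * Complex.I_sq
  rw [h4, inner_smul_left, hβ, conj_trivial]
  have h5 : (a : ℂ) ≠ 0 := Complex.ofReal_ne_zero.2 ha0.ne'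
  have h6 : (a : ℂ) + 1 ≠ 0 := by
    have : ((a + 1 : ℝ) : ℂ) ≠ 0 := Complex.ofReal_ne_zero.2 (by positivity)
    simpa using this
  push_cast
  field_simp
  ring

theorem isSelfAdjoint_of_symm_kernel {K : Rn n → Rn n → ℂ} {g : Rn n → ℝ} (h : IsDominated K g)
    {T : L2 n →L[ℂ] L2 n} (hT : IsIntegralKernel T K)
    (hK : ∀ x y, star (K x y) = K y x) : IsSelfAdjoint T := by
  rw [ContinuousLinearMap.isSelfAdjoint_iff_isSymmetric]
  intro f f'
  have h1 : inner ℂ (T f) f' = ∫ y, (∫ x, star (f x) * K x y) * f' y := by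
    rw [L2.inner_def]
    refine integral_congr_ae ?_
    filter_upwards [hT.2 f] with y hy
    rw [RCLike.inner_apply, hy.2, mul_comm]
    congr 1
    refine integral_conj.symm.trans (integral_congr_ae (.of_forall fun x => ?_))
    simp only [map_mul]
    rw [mul_comm, ← hK y x]
    rfl
  have h2 : inner ℂ f (T f') = ∫ x, star (f x) * ∫ y, K x y * f' y := by
    rw [L2.inner_def]
    refine integral_congr_ae ?_
    filter_upwards [hT.2 f'] with x hx
    rw [RCLike.inner_apply, hx.2, mul_comm]
    rfl
  exact h1.trans ((h.integral_swap (Lp.memLp f).star (Lp.memLp f')).symm.trans h2.symm)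

theorem half_mul_exp_le (z : ℝ) : z / 2 * Real.exp (-(z ^ 2 / 8)) ≤ 1 := by
  have h1 := Real.add_one_le_exp (z ^ 2 / 8)
  have h2 : z / 2 ≤ Real.exp (z ^ 2 / 8) := by nlinarith [sq_nonneg (z - 2)]
  rw [Real.exp_neg, ← div_eq_mul_inv, div_le_one (Real.exp_pos _)]
  exact h2

theorem hasFDerivAt_mehler (a : ℝ) (x y : Rn n) :
    HasFDerivAt (fun x => (mehler a x y : ℂ)) (Complex.ofRealCLM.comp (mehler a x y •
      (-(a / 4) • (2 • innerSL ℝ (x - y)) - (4 * a)⁻¹ • (2 • innerSL ℝ (x + y))))) x := by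
  refine Complex.ofRealCLM.hasFDerivAt.comp x ?_
  have h1 : HasFDerivAt (fun x : Rn n => ‖x - y‖ ^ 2) (2 • innerSL ℝ (x - y)) x := by
    simpa using ((hasFDerivAt_id x).sub_const y).norm_sq
  have h2 : HasFDerivAt (fun x : Rn n => ‖x + y‖ ^ 2) (2 • innerSL ℝ (x + y)) x := by
    simpa using ((hasFDerivAt_id x).add_const y).norm_sq
  have h3 := (((h1.const_mul (-(a / 4))).sub (h2.const_mul (4 * a)⁻¹)).exp.const_mul
    (((a - a⁻¹) / (4 * Real.pi)) ^ ((n : ℝ) / 2)))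
  rw [smul_smul] at h3
  exact h3

/-- Differentiation produces the factor `a|x-y|/2 + |x+y|/(2a)`. Half of the Gaussian in `x - y`
pays for the first summand and the Gaussian in `x + y` for the second. The costs are `√a` and `1/√a
≤ √a`. -/
theorem norm_fderiv_mehler_le {a : ℝ} (ha : 1 < a) (x y : Rn n) :
    ‖fderiv ℝ (fun x => (mehler a x y : ℂ)) x‖
      ≤ 2 * Real.sqrt a * (a - a⁻¹) ^ ((n : ℝ) / 2) * Real.exp (-(a / 8) * ‖x - y‖ ^ 2) := by
  have ha0 : 0 < a := by linarith
  have ha1 : 0 < a - a⁻¹ := sub_pos.2 ((inv_lt_one_of_one_lt₀ ha).trans ha)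
  rw [(hasFDerivAt_mehler a x y).fderiv]
  set r := ‖x - y‖ with hr
  set s := ‖x + y‖ with hs
  set k := Real.sqrt a with hk
  have hk0 : 0 < k := Real.sqrt_pos.2 ha0
  have hkk : k ^ 2 = a := Real.sq_sqrt ha0.le
  have hk1 : 1 ≤ k := Real.one_le_sqrt.2 ha.le
  have hL : ‖(-(a / 4) • (2 • innerSL ℝ (x - y)) - (4 * a)⁻¹ • (2 • innerSL ℝ (x + y)) :
      Rn n →L[ℝ] ℝ)‖ ≤ a * r / 2 + s / (2 * a) := by
    refine (norm_sub_le _ _).trans (le_of_eq ?_)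
    rw [norm_smul (-(a / 4)), norm_smul (4 * a)⁻¹, RCLike.norm_nsmul ℝ, RCLike.norm_nsmul ℝ,
      innerSL_apply_norm, innerSL_apply_norm,
      norm_neg, Real.norm_of_nonneg (by positivity), Real.norm_of_nonneg (by positivity)]
    simp only [nsmul_eq_mul]
    push_cast
    field_simp
    ring
  have h1 := (Complex.ofRealCLM.comp (mehler a x y • (-(a / 4) • (2 • innerSL ℝ (x - y))
    - (4 * a)⁻¹ • (2 • innerSL ℝ (x + y))))).opNorm_le_bound
      (M := mehler a x y * (a * r / 2 + s / (2 * a)))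
      (mul_nonneg (mehler_nonneg ha x y) (by positivity)) fun v => by
        rw [ContinuousLinearMap.comp_apply, Complex.ofRealCLM_apply, Complex.norm_real]
        refine (ContinuousLinearMap.le_opNorm _ v).trans ?_
        rw [norm_smul, Real.norm_of_nonneg (mehler_nonneg ha x y)]
        gcongr
        exact mehler_nonneg ha x y
  refine h1.trans ?_
  have hpre : ((a - a⁻¹) / (4 * Real.pi)) ^ ((n : ℝ) / 2) ≤ (a - a⁻¹) ^ ((n : ℝ) / 2) := by
    refine Real.rpow_le_rpow (by positivity) (div_le_self ha1.le ?_) (by positivity)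
    linarith [Real.pi_gt_three]
  have hb1 : a * r / 2 * Real.exp (-(a / 8) * r ^ 2) ≤ k := by
    have h := half_mul_exp_le (k * r)
    have e : -((k * r) ^ 2 / 8) = -(a / 8) * r ^ 2 := by rw [mul_pow, hkk]; ring
    rw [e] at h
    calc a * r / 2 * Real.exp (-(a / 8) * r ^ 2)
        = k * (k * r / 2 * Real.exp (-(a / 8) * r ^ 2)) := by rw [← hkk]; ring
      _ ≤ k * 1 := by gcongr
      _ = k := mul_one k
  have hb2 : s / (2 * a) * Real.exp (-((4 * a)⁻¹ * s ^ 2)) ≤ k := by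
    have h := half_mul_exp_le (s / k)
    have h' : s / k / 2 * Real.exp (-((4 * a)⁻¹ * s ^ 2)) ≤ 1 := by
      refine le_trans ?_ h
      gcongr
      rw [div_pow, hkk, div_div, mul_comm a 8, div_eq_inv_mul]
      gcongr
      norm_num
    calc s / (2 * a) * Real.exp (-((4 * a)⁻¹ * s ^ 2))
        = k⁻¹ * (s / k / 2 * Real.exp (-((4 * a)⁻¹ * s ^ 2))) := by
          rw [← hkk]; field_simp
      _ ≤ k⁻¹ * 1 := by gcongr
      _ ≤ k := by
          rw [mul_one]
          exact (inv_le_one_of_one_le₀ hk1).trans hk1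
  have hexp : Real.exp (-(a / 4) * r ^ 2 - (4 * a)⁻¹ * s ^ 2)
      = Real.exp (-(a / 8) * r ^ 2) * Real.exp (-(a / 8) * r ^ 2)
        * Real.exp (-((4 * a)⁻¹ * s ^ 2)) := by
    rw [← Real.exp_add, ← Real.exp_add]
    congr 1
    ring
  have hE1 : Real.exp (-(a / 8) * r ^ 2) ≤ 1 := Real.exp_le_one_iff.2 (by
    have : 0 ≤ a / 8 * r ^ 2 := by positivity
    linarith)
  have hE2 : Real.exp (-((4 * a)⁻¹ * s ^ 2)) ≤ 1 := Real.exp_le_one_iff.2 (by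
    have : 0 ≤ (4 * a)⁻¹ * s ^ 2 := by positivity
    linarith)
  have hmain : Real.exp (-(a / 4) * r ^ 2 - (4 * a)⁻¹ * s ^ 2) * (a * r / 2 + s / (2 * a))
      ≤ 2 * k * Real.exp (-(a / 8) * r ^ 2) := by
    rw [hexp]
    set E := Real.exp (-(a / 8) * r ^ 2) with hE
    set G := Real.exp (-((4 * a)⁻¹ * s ^ 2)) with hG
    have hE0 : 0 < E := Real.exp_pos _
    have hG0 : 0 < G := Real.exp_pos _
    have u1 : a * r / 2 * E * G ≤ k * 1 := mul_le_mul hb1 hE2 hG0.le hk0.le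
    have u2 : s / (2 * a) * G * E ≤ k * 1 := mul_le_mul hb2 hE1 hE0.le hk0.le
    calc E * E * G * (a * r / 2 + s / (2 * a))
        = (a * r / 2 * E * G + s / (2 * a) * G * E) * E := by ring
      _ ≤ (k * 1 + k * 1) * E := by gcongr
      _ = 2 * k * E := by ring
  calc mehler a x y * (a * r / 2 + s / (2 * a))
      = ((a - a⁻¹) / (4 * Real.pi)) ^ ((n : ℝ) / 2)
        * (Real.exp (-(a / 4) * r ^ 2 - (4 * a)⁻¹ * s ^ 2) * (a * r / 2 + s / (2 * a))) := by
        rw [mehler, mul_assoc]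
    _ ≤ (a - a⁻¹) ^ ((n : ℝ) / 2) * (2 * k * Real.exp (-(a / 8) * r ^ 2)) := by
        gcongr
    _ = _ := by ring

end Mehler

/-! ### Self-adjointness of the Hermite operator and its heat kernel bound. -/

section Hermite

variable {n : ℕ}

theorem IsTestFunction.memLp {ψ : Rn n → ℂ} (hψ : IsTestFunction ψ) : MemLp ψ 2 :=
  hψ.1.continuous.memLp_of_hasCompactSupport hψ.2

theorem IsTestFunction.star {ψ : Rn n → ℂ} (hψ : IsTestFunction ψ) :
    IsTestFunction fun x => star (ψ x) :=
  ⟨Complex.conjCLE.contDiff.comp hψ.1, hψ.2.comp_left (g := fun z : ℂ => Star.star z) (star_zero _)⟩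

theorem laplacian_star (ψ : Rn n → ℂ) (x : Rn n) :
    Laplacian.laplacian (fun x => star (ψ x)) x = star (Laplacian.laplacian ψ x) :=
  congrFun (InnerProductSpace.laplacian_CLE_comp_left (f := ψ) (l := Complex.conjCLE)) x

/-- `-Δψ + |x|²ψ`. -/
def hermiteApply (ψ : Rn n → ℂ) (x : Rn n) : ℂ :=
  -Laplacian.laplacian ψ x + (‖x‖ ^ 2 : ℝ) * ψ x

theorem IsTestFunction.hermiteApply {ψ : Rn n → ℂ} (hψ : IsTestFunction ψ) :
    IsTestFunction (hermiteApply ψ) := by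
  have h := hψ.laplacian
  exact ⟨h.1.neg.add ((Complex.ofRealCLM.contDiff.comp (contDiff_norm_sq ℝ)).mul hψ.1),
    h.2.neg.add hψ.2.mul_left⟩

theorem IsTestFunction.integral_mul_laplacian {φ ψ : Rn n → ℂ} (hφ : IsTestFunction φ)
    (hψ : IsTestFunction ψ) :
    ∫ x, φ x * Laplacian.laplacian ψ x = ∫ x, Laplacian.laplacian φ x * ψ x := by
  have h := SchwartzMap.integral_mul_laplacian_right_eq_left (μ := volume)
    (hφ.2.toSchwartzMap hφ.1) (hψ.2.toSchwartzMap hψ.1)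
  simp only [SchwartzMap.laplacian_apply] at h
  exact h

theorem locallyIntegrable_norm_sq_mul {u : Rn n → ℂ} (hu : LocallyIntegrable u volume) :
    LocallyIntegrable (fun x => ((‖x‖ ^ 2 : ℝ) : ℂ) * u x) volume := by
  have h := hu.continuous_smul (g := fun x : Rn n => ((‖x‖ ^ 2 : ℝ) : ℂ)) (by fun_prop)
  exact h

theorem IsTestFunction.toLp_mem_graph {φ : Rn n → ℂ} (hφ : IsTestFunction φ) :
    (hφ.memLp.toLp φ, hφ.hermiteApply.memLp.toLp _) ∈ (hermiteOp n).graph := by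
  rw [hermiteOp, graph_schrodingerOp]
  refine ⟨locallyIntegrable_norm_sq_mul (locallyIntegrable_L2 _), fun ψ hψ => ?_⟩
  have e1 := hφ.memLp.coeFn_toLp
  have e2 := hφ.hermiteApply.memLp.coeFn_toLp
  have a1 : ∫ x, (hφ.memLp.toLp φ) x * (-Laplacian.laplacian ψ x)
      = ∫ x, -Laplacian.laplacian φ x * ψ x := by
    simp only [mul_neg, neg_mul, integral_neg]
    rw [← hφ.integral_mul_laplacian hψ]
    congr 1
    refine integral_congr_ae ?_
    filter_upwards [e1] with x hx
    rw [hx]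
  have a2 : ∫ x, ((‖x‖ ^ 2 : ℝ) : ℂ) * (hφ.memLp.toLp φ) x * ψ x
      = ∫ x, ((‖x‖ ^ 2 : ℝ) : ℂ) * φ x * ψ x := by
    refine integral_congr_ae ?_
    filter_upwards [e1] with x hx
    rw [hx]
  have i1 : Integrable fun x => -Laplacian.laplacian φ x * ψ x :=
    hψ.integrable_mul hφ.laplacian.1.continuous.neg.locallyIntegrable
  have i2 : Integrable fun x => ((‖x‖ ^ 2 : ℝ) : ℂ) * φ x * ψ x :=
    hψ.integrable_mul (locallyIntegrable_norm_sq_mul hφ.1.continuous.locallyIntegrable)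
  rw [a1, a2, ← integral_add i1 i2]
  refine integral_congr_ae ?_
  filter_upwards [e2] with x hx
  rw [hx, SchrodingerKernel.hermiteApply]
  ring

theorem dense_domain_hermiteOp : Dense ((hermiteOp n).domain : Set (L2 n)) := by
  intro f
  refine Metric.mem_closure_iff.2 fun ε hε => ?_
  obtain ⟨g, hg1, hg2, hg3⟩ := MemLp.exist_eLpNorm_sub_le ENNReal.ofNat_ne_top (by norm_num)
    (Lp.memLp f) (half_pos hε)
  have hg : IsTestFunction g := ⟨hg2, hg1⟩
  refine ⟨hg.memLp.toLp g, LinearPMap.mem_domain_of_mem_graph hg.toLp_mem_graph, ?_⟩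
  have e : (f : Rn n → ℂ) - (hg.memLp.toLp g : Rn n → ℂ) =ᵐ[volume] (f : Rn n → ℂ) - g := by
    filter_upwards [hg.memLp.coeFn_toLp] with x hx
    rw [Pi.sub_apply, Pi.sub_apply, hx]
  rw [Lp.dist_def, eLpNorm_congr_ae e]
  exact (ENNReal.toReal_le_of_le_ofReal (by positivity) hg3).trans_lt (half_lt_self hε)

/-- A pair in the graph of the adjoint satisfies `-Δz + |x|²z = w` in the sense of distributions. -/
theorem mem_graph_of_forall_inner {z w : L2 n}
    (h : ∀ a b, (a, b) ∈ (hermiteOp n).graph → inner ℂ a w = inner ℂ b z) :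
    (z, w) ∈ (hermiteOp n).graph := by
  rw [hermiteOp, graph_schrodingerOp]
  have hz := locallyIntegrable_norm_sq_mul (locallyIntegrable_L2 z)
  refine ⟨hz, fun ψ hψ => ?_⟩
  have hs := hψ.star
  have h1 := h _ _ hs.toLp_mem_graph
  rw [L2.inner_def, L2.inner_def] at h1
  have e1 : ∫ x, inner ℂ (hs.memLp.toLp _ x) (w x) = ∫ x, w x * ψ x := by
    refine integral_congr_ae ?_
    filter_upwards [hs.memLp.coeFn_toLp] with x hx
    rw [hx, RCLike.inner_apply]
    simp
  have e2 : ∫ x, inner ℂ (hs.hermiteApply.memLp.toLp _ x) (z x)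
      = ∫ x, (z x * (-Laplacian.laplacian ψ x) + ((‖x‖ ^ 2 : ℝ) : ℂ) * z x * ψ x) := by
    refine integral_congr_ae ?_
    filter_upwards [hs.hermiteApply.memLp.coeFn_toLp] with x hx
    rw [hx, RCLike.inner_apply, hermiteApply, laplacian_star]
    simp only [map_add, map_neg, map_mul, Complex.conj_ofReal, Complex.star_def, Complex.conj_conj]
    ring
  have i1 : Integrable fun x => z x * (-Laplacian.laplacian ψ x) := by
    simp only [mul_neg]
    exact (hψ.laplacian.integrable_mul (locallyIntegrable_L2 z)).neg
  rw [e1, e2, integral_add i1 (hψ.integrable_mul hz)] at h1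
  exact h1.symm

/-- The identity for `t ≤ 0` is a convention of which only the value at `t = 0` matters: it starts
the flow. -/
theorem exists_mehlerOp (t : ℝ) : ∃ T : L2 n →L[ℂ] L2 n,
    (0 < t → IsIntegralKernel T fun x y => (mehler (coth t) x y : ℂ)) ∧ (t ≤ 0 → T = 1) := by
  by_cases ht : 0 < t
  · obtain ⟨T, hT⟩ :=
      (gaussianKernel_mehler (n := n) (one_lt_coth ht)).isDominated.exists_isIntegralKernel
    exact ⟨T, fun _ => hT, fun h => absurd ht (not_lt.2 h)⟩
  · exact ⟨1, fun h => absurd h ht, fun _ => rfl⟩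

/-- The Hermite semigroup. -/
def mehlerOp (n : ℕ) (t : ℝ) : L2 n →L[ℂ] L2 n := (exists_mehlerOp t).choose

theorem isIntegralKernel_mehlerOp {t : ℝ} (ht : 0 < t) :
    IsIntegralKernel (mehlerOp n t) fun x y => (mehler (coth t) x y : ℂ) :=
  (exists_mehlerOp t).choose_spec.1 ht

theorem mehlerOp_zero : mehlerOp n 0 = 1 := (exists_mehlerOp 0).choose_spec.2 le_rfl

theorem coeFn_coherentFlow (ξ : Rn n) (t : ℝ) : coherentFlow ξ t =ᵐ[volume]
    fun x => (flowCoeff ξ t : ℂ) * coherent (Real.exp (-2 * t) • ξ) x := by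
  filter_upwards [Lp.coeFn_smul (flowCoeff ξ t : ℂ) (coherentLp (Real.exp (-2 * t) • ξ)),
    coeFn_coherentLp (Real.exp (-2 * t) • ξ)] with x h1 h2
  exact h1.trans (by rw [Pi.smul_apply, h2, smul_eq_mul])

theorem mehlerOp_coherentFlow (ξ : Rn n) {t : ℝ} (ht : 0 < t) :
    mehlerOp n t (coherentFlow ξ 0) = coherentFlow ξ t := by
  apply Lp.ext
  filter_upwards [(isIntegralKernel_mehlerOp ht).2 (coherentFlow ξ 0),
    coeFn_coherentFlow ξ t] with x h1 h2
  rw [h1.2, h2]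
  have h4 : ∫ y, (mehler (coth t) x y : ℂ) * coherentFlow ξ 0 y
      = (flowCoeff ξ 0 : ℂ) * ∫ y, (mehler (coth t) x y : ℂ) * coherent ξ y := by
    rw [← integral_const_mul]
    refine integral_congr_ae ?_
    filter_upwards [coeFn_coherentFlow ξ 0] with y h3
    rw [h3, mul_zero, Real.exp_zero, one_smul]
    ring
  rw [h4, integral_mehler_coherent (one_lt_coth ht), ← exp_neg_two_mul_eq ht, ← mul_assoc,
    ← Complex.ofReal_mul]
  congr 2
  rw [flowCoeff, flowCoeff, ← Real.exp_mul, ← Real.exp_add, ← Real.exp_add]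
  congr 1
  simp only [mul_zero, Real.exp_zero]
  ring

theorem isHeatFlow_mehlerOp (n : ℕ) :
    IsHeatFlow (hermiteOp n) coherentFlow coherentFlowImage (mehlerOp n) where
  deriv := hasDerivAt_coherentFlow
  weak ξ t u g h := inner_coherentFlow ξ t h
  bound := by
    -- The `1` covers `t = 0`; the other entry is free of `t` because the operator bound for
    -- Gaussian kernels does not depend on `q`.
    refine ⟨max 1 ((4 * Real.pi)⁻¹ ^ ((n : ℝ) / 2) * (Real.pi / (1 / 4)) ^ ((n : ℝ) / 2)),
      by positivity, fun t ht => ?_⟩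
    rcases ht.eq_or_lt with rfl | ht
    · rw [mehlerOp_zero]
      exact ContinuousLinearMap.norm_id_le.trans (le_max_left _ _)
    · exact ((gaussianKernel_mehler (one_lt_coth ht)).opNorm_le
        (isIntegralKernel_mehlerOp ht)).trans (le_max_right _ _)
  symm t ht := by
    rcases ht.eq_or_lt with rfl | ht
    · rw [mehlerOp_zero]
      exact IsSelfAdjoint.one _
    · refine isSelfAdjoint_of_symm_kernel (gaussianKernel_mehler (one_lt_coth ht)).isDominated
        (isIntegralKernel_mehlerOp ht) fun x y => ?_
      rw [mehler_comm]
      exact Complex.conj_ofReal _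
  flow ξ t ht := by
    rcases ht.eq_or_lt with rfl | ht
    · rw [mehlerOp_zero, one_apply_eq_self]
    · exact mehlerOp_coherentFlow ξ ht
  total := dense_span_coherentFlow

/-- `H* ⊆ H` because the domain is maximal: pairing with test functions gives the distributional
equation. `H ⊆ H*` is symmetry, which comes from the heat flow. -/
theorem isSelfAdjoint_hermiteOp (n : ℕ) : IsSelfAdjoint (hermiteOp n) := by
  have hd := dense_domain_hermiteOp (n := n)
  refine le_antisymm (a := (hermiteOp n).adjoint) ?_ ?_
  · refine LinearPMap.le_of_le_graph ?_
    rintro ⟨z, w⟩ hzw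
    obtain ⟨y, rfl, rfl⟩ := (LinearPMap.mem_graph_iff _).1 hzw
    refine mem_graph_of_forall_inner fun a b hab => ?_
    obtain ⟨x, rfl, rfl⟩ := (LinearPMap.mem_graph_iff _).1 hab
    exact ((LinearPMap.adjoint_isFormalAdjoint hd).symm x y).symm
  · refine LinearPMap.IsFormalAdjoint.le_adjoint hd fun x y => ?_
    exact ((isHeatFlow_mehlerOp n).graph_symm ((hermiteOp n).mem_graph x)
      ((hermiteOp n).mem_graph y)).symm

theorem heatGaussianBound_hermiteOp (hn : 1 ≤ n) : HeatGaussianBound (hermiteOp n) 1 := by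
  refine ⟨fun t x y => (mehler (coth t) x y : ℂ), fun t ht => ⟨⟨mehlerOp n t,
    (isHeatFlow_mehlerOp n).isFunctionOf (isSelfAdjoint_hermiteOp n) (le_of_lt ht),
    isIntegralKernel_mehlerOp ht⟩, fun _ y x => (hasFDerivAt_mehler _ x y).differentiableAt⟩,
    2, 1 / 8, by norm_num, fun t ht x y => ?_⟩
  have ht : 0 < t := ht
  rw [xGradNorm, if_neg (by decide)]
  have ha := one_lt_coth ht
  refine (norm_fderiv_mehler_le ha x y).trans ?_
  set a := coth t with hadef
  have ha0 : 0 < a := by linarith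
  have ha1 : 0 < a - a⁻¹ := sub_pos.2 ((inv_lt_one_of_one_lt₀ ha).trans ha)
  -- As `a → 1` for large `t`, the factor `√a` alone does not decay. It is joined with one factor
  -- `(a - 1/a)^{1/2}` to form `(a² - 1)^{1/2} ≤ 1/t`, and `n ≥ 1` makes the remaining exponent `(n
  -- - 1)/2` nonnegative.
  have h1 : Real.sqrt a * (a - a⁻¹) ^ ((n : ℝ) / 2)
      ≤ t ^ (-((n : ℝ) + ((1 : Fin 2) : ℕ)) / 2) := by
    have hn' : (0 : ℝ) ≤ ((n : ℝ) - 1) / 2 := by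
      have : (1 : ℝ) ≤ n := by exact_mod_cast hn
      linarith
    have e1 : Real.sqrt a * (a - a⁻¹) ^ ((n : ℝ) / 2)
        = (a ^ 2 - 1) ^ ((1 : ℝ) / 2) * (a - a⁻¹) ^ (((n : ℝ) - 1) / 2) := by
      have : a ^ 2 - 1 = a * (a - a⁻¹) := by field_simp
      rw [this, Real.mul_rpow ha0.le ha1.le, mul_assoc, ← Real.rpow_add ha1, Real.sqrt_eq_rpow]
      congr 2
      ring
    have e2 : t ^ (-((n : ℝ) + ((1 : Fin 2) : ℕ)) / 2)
        = ((t ^ 2)⁻¹) ^ ((1 : ℝ) / 2) * (t⁻¹) ^ (((n : ℝ) - 1) / 2) := by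
      rw [← inv_pow, ← Real.rpow_natCast, ← Real.rpow_mul (by positivity),
        ← Real.rpow_add (by positivity), Real.inv_rpow ht.le, ← Real.rpow_neg ht.le]
      congr 1
      push_cast
      simp only [Fin.val_one, Nat.cast_one]
      ring
    rw [e1, e2]
    have h3 : 0 ≤ a ^ 2 - 1 := by nlinarith
    have := coth_sq_sub_one_le ht
    have := coth_sub_inv_le ht
    gcongr
  have h2 : Real.exp (-(a / 8) * ‖x - y‖ ^ 2) ≤ Real.exp (-(1 / 8) * ‖x - y‖ ^ 2 / t) := by
    refine Real.exp_le_exp.2 ?_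
    have h3 : t⁻¹ * ‖x - y‖ ^ 2 ≤ a * ‖x - y‖ ^ 2 :=
      mul_le_mul_of_nonneg_right (inv_le_coth ht) (by positivity)
    have e : -(1 / 8) * ‖x - y‖ ^ 2 / t = -(1 / 8) * (t⁻¹ * ‖x - y‖ ^ 2) := by
      rw [div_eq_mul_inv]; ring
    rw [e]
    linarith
  rw [mul_assoc 2]
  gcongr

end Hermite

end SchrodingerKernel

end

open SchrodingerKernel in
theorem proposition3 (n : ℕ) (hn : 1 ≤ n) :
    (∀ (V : Rn n → ℝ) (H : L2 n →ₗ.[ℂ] L2 n),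
      (∀ x, 0 ≤ V x) → IsSelfAdjoint H → H ≤ schrodingerOp V →
        (∀ α : Fin 2, HeatGaussianBound H α →
          ∀ φ : ℤ → ℝ → ℂ, IsDyadicSystem φ →
            ∃ K : ℤ → Rn n → Rn n → ℂ, (∀ j, IsKernelOf H (φ j) (K j)) ∧ UniformDecay α K) ∧
        (HeatGaussianBound H 0 → HeatGaussianBound H 1 → DyadicKernelDecay H)) ∧
    (IsSelfAdjoint (hermiteOp n) ∧ DyadicKernelDecay (hermiteOp n)) := by
  refine ⟨fun V H _ hH _ => ⟨fun α hα φ hφ => ?_, fun _ h1 => h1.dyadicKernelDecay hn hH⟩,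
    isSelfAdjoint_hermiteOp n,
    (heatGaussianBound_hermiteOp hn).dyadicKernelDecay hn (isSelfAdjoint_hermiteOp n)⟩
  obtain rfl | rfl : α = 0 ∨ α = 1 := by
    fin_cases α <;> simp
  · exact hα.exists_kernel_zero hH hφ
  · obtain ⟨K, h, -, h1⟩ := hα.dyadicKernelDecay hn hH φ hφ
    exact ⟨K, h, h1⟩
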